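/- Let $\nu$ be a measure on $\mathbb R$ with $\nu(\{0\})=0$ and $\int_{\mathbb R}x^2\,d\nu(x)<\infty$, let $N$ be a Poisson random measure on $\mathbb R^+\times\mathbb R$ with intensity $ds\otimes\nu(dx)$ (the jump measure of a Lévy process with Lévy measure $\nu$), $\widetilde N=N-ds\otimes\nu$ the compensated measure, and $I_1(f)=\iint f(s,x)\,x\,d\widetilde N(s,x)$ the $L^2$-integral, for $\iint f^2x^2\,ds\,d\nu<\infty$. Let $\sigma(\epsilon)=\bigl(\int_{\{|x|\le\epsilon\}}x^2\,d\nu(x)\bigr)^{1/2}$. For kernels $h_t$ ($t\ge 0$) with $\int_0^t h_t(s)^2ds<\infty$ put $$X_t=\iint_{[0,t]\times\mathbb R}h_t(s)x\,d\widetilde N,\qquad F^\epsilon_t=\sigma(\epsilon)^{-1}\iint_{[0,t]\times\{|x|\le\epsilon\}}h_t(s)x\,d\widetilde N,\qquad N^\epsilon_t=\iint_{[0,t]\times\{|x|>\epsilon\}}h_t(s)x\,d\widetilde N .$$ Let $\widehat W$ be an isonormal Gaussian process over $L^2(\mathbb R^+)$, i.e. a centered Gaussian family with $E[\widehat W(f)\widehat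 W(g)]=\int_{\mathbb R^+}f(s)g(s)\,ds$, and write $\widehat W(h_t)$ for $\widehat W(h_t1_{[0,t]})$. Assume $\lim_{\epsilon\to0}\sigma(\epsilon)/\epsilon=\infty$. Then: **(1)** If $0\le T<\infty$ and $h_t\in L^3(0,T)$ for all $t\in[0,T]$, then $(F_t^\epsilon)_{t\in[0,T]}$ converges to $(\widehat W(h_t))_{t\in[0,T]}$ in finite-dimensional distributions as $\epsilon\to0^+$. **(2)** Let $H\in(0,1)$ and let $h_t=K_H(t,\cdot)$ be the Molchan–Golosov kernel: for $0<s<t$, $$K_H(t,s)=\begin{cases}c^{(1)}_H\Bigl[\bigl(\tfrac ts\bigr)^{H-\frac12}(t-s)^{H-\frac12}-(H-\tfrac12)s^{\frac12-H}\int_s^tu^{H-\frac32}(u-s)^{H-\frac12}du\Bigr],&H<\tfrac12,\\ 1,&H=\tfrac12,\\ c^{(2)}_Hs^{\frac12-H}\int_s^t(u-s)^{H-\frac32}u^{H-\frac12}du,&H>\tfrac12,\end{cases}$$ with $c^{(1)}_H=\sqrt{\frac{2H}{(1-2H)\beta(1-2H,H+1/2)}}$, $c^{(2)}_H=\sqrt{\frac{H(2H-1)}{\beta(2-2H,H-1/2)}}$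 and $\beta$ the beta function, so that $X_t=\mathcal L^H_t$, $t\ge0$, is the fractional Lévy process of Molchan–Golosov type. Then $(F^\epsilon_t)_{t\ge0}$ converges in finite-dimensional distributions, as $\epsilon\to0^+$, to $B^H_t=\widehat W(K_H(t,\cdot))$, and $B^H$ is a fractional Brownian motion, i.e. a centered Gaussian process with covariance $\frac12(s^{2H}+t^{2H}-|t-s|^{2H})$. For every $\epsilon>0$ and $t\ge 0$, almost surely $\mathcal L^H_t=N^\epsilon_t+\sigma(\epsilon)F^\epsilon_t$, $N([0,t]\times\{|x|>\epsilon\})<\infty$, and $N^\epsilon_t=\int_{[0,t]\times\{|x|>\epsilon\}}K_H(t,s)x\,dN-\int_{[0,t]\times\{|x|>\epsilon\}}K_H(t,s)x\,ds\,d\nu(x)$ (the compensated sum over the finitely many jumps larger than $\epsilon$); for every $\epsilon>0$ and all finite sets of times, the vectors of values of $N^\epsilon$ and of $F^\epsilon$ are independent. Finally, if $B^H$ is taken independent of $N$ (on a product space), then $N^\epsilon_t+\sigma(\epsilon)B^H_t$ converges to $\mathcal L^H_t$ in finite-dimensional distributions as $\epsilon\to0^+$. -/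

import Mathlib

open MeasureTheory ProbabilityTheory Filter Set Topology
open scoped NNReal ENNReal

/-! ### Poisson random measures and the compensated integral -/

/-- `N` is a Poisson random measure on `E` with intensity measure `lam`: the variables `N A` are
measurable, `N A` is Poisson distributed with parameter `lam A` whenever `lam A < ∞`, and the
variables `N A₁, …, N Aₙ` are independent for pairwise disjoint `A₁, …, Aₙ`. -/
structure IsPoissonRandomMeasure {Ω E : Type*} [MeasurableSpace Ω] [MeasurableSpace E]
    (N : Ω → Measure E) (lam : Measure E) (P : Measure Ω) : Prop where
  measurable : ∀ A : Set E, MeasurableSet A → Measurable (fun ω => N ω A)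
  hasLaw : ∀ A : Set E, MeasurableSet A → lam A ≠ ∞ →
    HasLaw (fun ω => N ω A)
      ((poissonMeasure (lam A).toNNReal).map (fun k : ℕ => (k : ℝ≥0∞))) P
  indep : ∀ (n : ℕ) (A : Fin n → Set E), (∀ i, MeasurableSet (A i)) →
    Pairwise (fun i j => Disjoint (A i) (A j)) → iIndepFun (fun i ω => N ω (A i)) P

/-- The compensated integral of a step function `G`: the finite sum of the terms
`c * (N {G = c} - lam {G = c})` over the values `c` of `G`. -/
noncomputable def stepIntegral {Ω E : Type*} [MeasurableSpace E]
    (N : Ω → Measure E) (lam : Measure E) (G : SimpleFunc E ℝ) (ω : Ω) : ℝ :=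
  ∑ c ∈ G.range, c * ((N ω).real (G ⁻¹' {c}) - lam.real (G ⁻¹' {c}))

/-- `Y` is (a version of) the integral of `g ∈ L²(lam)` with respect to the compensated measure
`N - lam`: it is the `L²(P)`-limit of the integrals of step functions, supported on sets of finite
intensity, that converge to `g` in `L²(lam)`. -/
def IsCompensatedIntegral {Ω E : Type*} [MeasurableSpace Ω] [MeasurableSpace E]
    (N : Ω → Measure E) (lam : Measure E) (P : Measure Ω) (g : E → ℝ) (Y : Ω → ℝ) : Prop :=
  MemLp Y 2 P ∧ ∃ G : ℕ → SimpleFunc E ℝ, (∀ n, (G n).FinMeasSupp lam) ∧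
    Tendsto (fun n => eLpNorm (fun z => G n z - g z) 2 lam) atTop (𝓝 0) ∧
    Tendsto (fun n => eLpNorm (fun ω => stepIntegral N lam (G n) ω - Y ω) 2 P) atTop (𝓝 0)

open Classical in
/-- A version of the integral of `g` with respect to `N - lam`. For a Poisson random measure `N`
with intensity `lam` the integral exists for every `g ∈ L²(lam)` and is almost surely unique. -/
noncomputable def compensatedIntegral {Ω E : Type*} [MeasurableSpace Ω] [MeasurableSpace E]
    (N : Ω → Measure E) (lam : Measure E) (P : Measure Ω) (g : E → ℝ) : Ω → ℝ :=
  if h : ∃ Y, IsCompensatedIntegral N lam P g Y then h.choose else 0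

/-! ### The jumps of a square integrable Lévy process -/

/-- A Lévy measure on `ℝ` with `∫ x² dν < ∞`. -/
structure IsSquareIntegrableLevyMeasure (ν : Measure ℝ) : Prop where
  zero : ν {0} = 0
  integrable_sq : Integrable (fun x : ℝ => x ^ 2) ν

/-- Lebesgue measure on the time axis `ℝ⁺ = [0, ∞)`, as a measure on `ℝ`. -/
noncomputable def timeMeasure : Measure ℝ := volume.restrict (Ici 0)

/-- The intensity `ds ⊗ ν(dx)` of the jump measure, on pairs (time, jump size). -/
noncomputable def jumpIntensity (ν : Measure ℝ) : Measure (ℝ × ℝ) := timeMeasure.prod ν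

/-- The first order integral `I₁(f) = ∬ f(s, x) x dÑ(s, x)`. -/
noncomputable def poissonI1 {Ω : Type*} [MeasurableSpace Ω] (N : Ω → Measure (ℝ × ℝ))
    (ν : Measure ℝ) (P : Measure Ω) (f : ℝ × ℝ → ℝ) : Ω → ℝ :=
  compensatedIntegral N (jumpIntensity ν) P (fun z => f z * z.2)

/-- `σ(ε) = (∫_{|x| ≤ ε} x² dν)^{1/2}`. -/
noncomputable def smallJumpStd (ν : Measure ℝ) (ε : ℝ) : ℝ :=
  Real.sqrt (∫ x in {x : ℝ | |x| ≤ ε}, x ^ 2 ∂ν)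

/-- `X_t = I₁(h_t 1_{[0,t]})`. -/
noncomputable def chaosProcess {Ω : Type*} [MeasurableSpace Ω] (N : Ω → Measure (ℝ × ℝ))
    (ν : Measure ℝ) (P : Measure Ω) (h : ℝ≥0 → ℝ → ℝ) (t : ℝ≥0) : Ω → ℝ :=
  poissonI1 N ν P ((Icc 0 (t : ℝ) ×ˢ univ).indicator (fun z => h t z.1))

/-- The normalized small jump part `F_t^ε = σ(ε)⁻¹ ∬_{[0,t]×{|x|≤ε}} h_t(s) x dÑ(s, x)`. -/
noncomputable def smallJumpPart {Ω : Type*} [MeasurableSpace Ω] (N : Ω → Measure (ℝ × ℝ))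
    (ν : Measure ℝ) (P : Measure Ω) (h : ℝ≥0 → ℝ → ℝ) (ε : ℝ) (t : ℝ≥0) (ω : Ω) : ℝ :=
  (smallJumpStd ν ε)⁻¹ *
    poissonI1 N ν P ((Icc 0 (t : ℝ) ×ˢ {x : ℝ | |x| ≤ ε}).indicator (fun z => h t z.1)) ω

/-- The large jump part `N_t^ε = ∬_{[0,t]×{|x|>ε}} h_t(s) x dÑ(s, x)`. -/
noncomputable def largeJumpPart {Ω : Type*} [MeasurableSpace Ω] (N : Ω → Measure (ℝ × ℝ))
    (ν : Measure ℝ) (P : Measure Ω) (h : ℝ≥0 → ℝ → ℝ) (ε : ℝ) (t : ℝ≥0) : Ω → ℝ :=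
  poissonI1 N ν P ((Icc 0 (t : ℝ) ×ˢ {x : ℝ | ε < |x|}).indicator (fun z => h t z.1))

/-! ### Gaussian processes -/

/-- `W` is an isonormal Gaussian process over `L²(ℝ⁺)`: a centered Gaussian family with
`E[W(f) W(g)] = ∫_{ℝ⁺} f(s) g(s) ds`. -/
structure IsIsonormal {Ω : Type*} [MeasurableSpace Ω]
    (W : Lp ℝ 2 timeMeasure → Ω → ℝ) (P : Measure Ω) : Prop where
  gaussian : IsGaussianProcess W P
  mean_zero : ∀ f, ∫ ω, W f ω ∂P = 0
  cov : ∀ f g, ∫ ω, W f ω * W g ω ∂P = ∫ s, f s * g s ∂timeMeasure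

open Classical in
/-- The class in `L²(ℝ⁺)` of a square integrable function (and `0` for any other function). -/
noncomputable def toL2 (f : ℝ → ℝ) : Lp ℝ 2 timeMeasure :=
  if hf : MemLp f 2 timeMeasure then hf.toLp f else 0

/-- The Gaussian functional `t ↦ W(h_t)`, where `h_t` is viewed as the kernel `h_t 1_{[0,t]}`. -/
noncomputable def gaussianPart {Ω : Type*} (W : Lp ℝ 2 timeMeasure → Ω → ℝ)
    (h : ℝ≥0 → ℝ → ℝ) (t : ℝ≥0) : Ω → ℝ :=
  W (toL2 ((Icc 0 (t : ℝ)).indicator (h t)))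

/-- `B` is a fractional Brownian motion on `[0, ∞)` with Hurst parameter `H`. -/
structure IsFractionalBrownianMotion {Ω : Type*} [MeasurableSpace Ω] (H : ℝ)
    (B : ℝ≥0 → Ω → ℝ) (P : Measure Ω) : Prop where
  gaussian : IsGaussianProcess B P
  mean_zero : ∀ t, ∫ ω, B t ω ∂P = 0
  cov : ∀ s t : ℝ≥0, ∫ ω, B s ω * B t ω ∂P =
    ((s : ℝ) ^ (2 * H) + (t : ℝ) ^ (2 * H) - |(t : ℝ) - s| ^ (2 * H)) / 2

/-- The Molchan–Golosov kernel `K_H(t, s)`, `0 < s < t`, where `beta` is Euler's beta function.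
For `H = 1/2` it is the constant `1`. -/
noncomputable def molchanGolosovKernel (H : ℝ) (t : ℝ≥0) (s : ℝ) : ℝ :=
  if H < 1 / 2 then
    Real.sqrt (2 * H / ((1 - 2 * H) * beta (1 - 2 * H) (H + 1 / 2))) *
      (((t : ℝ) / s) ^ (H - 1 / 2) * ((t : ℝ) - s) ^ (H - 1 / 2) -
        (H - 1 / 2) * s ^ (1 / 2 - H) *
          ∫ u in s..(t : ℝ), u ^ (H - 3 / 2) * (u - s) ^ (H - 1 / 2))
  else if 1 / 2 < H then
    Real.sqrt (H * (2 * H - 1) / beta (2 - 2 * H) (H - 1 / 2)) * s ^ (1 / 2 - H) *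
      ∫ u in s..(t : ℝ), (u - s) ^ (H - 3 / 2) * u ^ (H - 1 / 2)
  else 1

/-! ### Convergence of finite-dimensional distributions -/

/-- The processes `X ε`, with times in `S`, converge to `Z` in finite-dimensional distributions
along the filter `l`. -/
def TendstoFDD {ι Ω Ω' : Type*} [MeasurableSpace Ω] [MeasurableSpace Ω']
    (X : ι → ℝ≥0 → Ω → ℝ) (l : Filter ι) (Z : ℝ≥0 → Ω' → ℝ) (S : Set ℝ≥0)
    (P : Measure Ω) [IsProbabilityMeasure P] (P' : Measure Ω') [IsProbabilityMeasure P'] : Prop :=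
  ∀ (d : ℕ) (t : Fin d → ℝ≥0), (∀ i, t i ∈ S) →
    TendstoInDistribution (fun ε ω i => X ε (t i) ω) l (fun ω i => Z (t i) ω) (fun _ => P) P'

/-!
The compensated integral `I(g)` of `g ∈ L²(λ)` with respect to a Poisson random measure of
intensity `λ` is an isometry on step functions, and for them the independence of `N` on disjoint
sets gives the Lévy–Khintchine formula `E exp(i I(g)) = exp (∫ ψ(g) dλ)`, `ψ(x) = e^{ix} - 1 - ix`.
Both pass to all of `L²(λ)` by completeness (`exists_isCompensatedIntegral`,
`integral_cexp_compensatedIntegral`). As `g ↦ I(g)` is linear, the joint characteristic function of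
the processes in question is therefore `exp (∫∫ ψ(k(s) x) ds ν(dx))`, with `k` a linear combination
of the kernels and `x` restricted to small or to large jumps, and each probabilistic assertion
becomes an assertion on these exponents.

* Small jumps: for jump sizes `ρ` with `∫ ρ² dν = 1` and `|ρ| ≤ r`, replacing `ψ(y)` by `-y²/2` costs
  at most `4 ∫ k² min(1, r |k|) ds`. Here `r = ε / σ(ε) → 0`, and dominated convergence gives the
  exponent `-∫ k² / 2` of the Gaussian limit (`tendsto_integral_compensatedExponent_small`). Square
  integrability of the kernels suffices.
* Large jumps: their exponent converges to that of the whole process by dominated convergence, while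
  `σ(ε) → 0` removes the Gaussian term.
* Independence: `ψ(a + b) = ψ(a) + ψ(b)` if `a = 0` or `b = 0`, so the exponents of the small and of
  the large jumps add up (`indepFun_largeJumpPart_smallJumpPart`).
* The compensated sum: on a set of finite intensity Campbell's formula bounds `∫ |f| dN` in `L¹`, so
  the formula `I(g) = ∫ g dN - ∫ g dλ` extends from step functions
  (`compensatedIntegral_indicator_ae_eq`).

It remains to show that the Molchan–Golosov kernel satisfies
`∫_0^s K_H(t, u) K_H(s, u) du = (s^{2H} + t^{2H} - (t - s)^{2H}) / 2` for `s ≤ t`, which yields both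
its square integrability and the covariance of the limit. All integrands are nonnegative, so the
computation is made with Lebesgue integrals in `ℝ≥0∞`, where Tonelli's theorem applies freely.
Its core is the integral `∫_0^v u^{a-1} (v-u)^{b-1} (r-u)^{-a-b} du`, which a Möbius substitution
turns into a beta integral (`lintegral_beta_moebius`).

* For `H > 1/2` the product of the two kernels is a double integral over `(r, v)`, the integral over
  `u` is of that type and equals a constant times `(r v)^{1/2-H} |r - v|^{2H-2}`, and the remaining
  double integral of `|r - v|^{2H-2}` is elementary (`lintegral_smoothKernel_mul_smoothKernel`).
* For `H < 1/2`, `K_H(t, ·)` is rewritten as an integral over the future `(t, ∞)` plus a power of `u`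
  (`roughKernel_eq`). The integral of the power against `K_H(s, ·)` is explicit, and for a fixed
  future time `r` the integral over `u` reduces to the Möbius type, leaving a multiple of
  `(r - s)^{2H-1} - r^{2H-1}`, whose integral over `(t, ∞)` is again elementary
  (`lintegral_roughKernel_mul_roughKernel`).
-/

/-! ### Moments of the Poisson distribution -/

lemma hasSum_natCast_mul_poisson (r : ℝ≥0) :
    HasSum (fun n : ℕ => Real.exp (-r) * r ^ n / n.factorial * n) r := by
  rw [← hasSum_nat_add_iff' 1]
  have h := (hasSum_one_poissonMeasure r).mul_left (r : ℝ)
  simp only [Finset.sum_range_one, Nat.cast_zero, mul_zero, sub_zero]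
  rw [mul_one] at h
  refine h.congr_fun fun n => ?_
  rw [Nat.factorial_succ]
  push_cast
  have : ((n : ℝ) + 1) ≠ 0 := by positivity
  field_simp
  ring

lemma hasSum_natCast_mul_pred_poisson (r : ℝ≥0) :
    HasSum (fun n : ℕ => Real.exp (-r) * r ^ n / n.factorial * (n * (n - 1) : ℝ)) (r ^ 2) := by
  rw [← hasSum_nat_add_iff' 2]
  have h := (hasSum_one_poissonMeasure r).mul_left ((r : ℝ) ^ 2)
  rw [mul_one] at h
  have h0 : ∑ i ∈ Finset.range 2,
      Real.exp (-r) * r ^ i / i.factorial * ((i : ℝ) * (i - 1)) = 0 := by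
    simp [Finset.sum_range_succ]
  rw [h0, sub_zero]
  refine h.congr_fun fun n => ?_
  rw [Nat.factorial_succ, Nat.factorial_succ]
  push_cast
  have h1 : ((n : ℝ) + 1) ≠ 0 := by positivity
  have h2 : ((n : ℝ) + 1 + 1) ≠ 0 := by positivity
  field_simp
  ring

lemma hasSum_sq_centered_poisson (r : ℝ≥0) :
    HasSum (fun n : ℕ => Real.exp (-r) * r ^ n / n.factorial * ((n : ℝ) - r) ^ 2) r := by
  have h := ((hasSum_natCast_mul_pred_poisson r).add
    ((hasSum_natCast_mul_poisson r).mul_left (1 - 2 * (r : ℝ)))).add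
    ((hasSum_one_poissonMeasure r).mul_left ((r : ℝ) ^ 2))
  convert! h using 1
  · ext n; ring
  · ring

lemma memLp_natCast_sub_poisson (r : ℝ≥0) :
    MemLp (fun n : ℕ => (n : ℝ) - r) 2 (poissonMeasure r) := by
  rw [memLp_two_iff_integrable_sq (by fun_prop), integrable_poissonMeasure_iff]
  simpa using (hasSum_sq_centered_poisson r).summable

lemma integral_natCast_poisson (r : ℝ≥0) : ∫ n : ℕ, (n : ℝ) ∂(poissonMeasure r) = r := by
  rw [integral_poissonMeasure]
  simpa [smul_eq_mul] using (hasSum_natCast_mul_poisson r).tsum_eq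

lemma integral_sq_centered_poisson (r : ℝ≥0) :
    ∫ n : ℕ, ((n : ℝ) - r) ^ 2 ∂(poissonMeasure r) = r := by
  rw [integral_poissonMeasure]
  simpa [smul_eq_mul] using (hasSum_sq_centered_poisson r).tsum_eq

/-- The exponent of the characteristic function of a compensated Poisson variable with unit
jumps, `x ↦ e^{ix} - 1 - ix`. -/
noncomputable def compensatedExponent (x : ℝ) : ℂ :=
  Complex.exp (x * Complex.I) - 1 - x * Complex.I

lemma compensatedExponent_zero : compensatedExponent 0 = 0 := by simp [compensatedExponent]

lemma integral_cexp_centered_poisson (r : ℝ≥0) (c : ℝ) :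
    ∫ n : ℕ, Complex.exp ((c * ((n : ℝ) - r) : ℝ) * Complex.I) ∂(poissonMeasure r) =
      Complex.exp (r * compensatedExponent c) := by
  have h := charFun_map_cast_poissonMeasure r c
  rw [charFun_apply, integral_map (by fun_prop) (by fun_prop)] at h
  have h2 : ∀ n : ℕ, Complex.exp ((c * ((n : ℝ) - r) : ℝ) * Complex.I) =
      Complex.exp (((inner ℝ (n : ℝ) c : ℝ) : ℂ) * Complex.I) *
        Complex.exp (-(r * c * Complex.I)) := by
    intro n
    rw [← Complex.exp_add]
    congr 1
    simp
    ring
  simp_rw [h2]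
  rw [integral_mul_const, h, ← Complex.exp_add, compensatedExponent]
  congr 1
  ring

namespace IsPoissonRandomMeasure

variable {Ω E : Type*} [MeasurableSpace Ω] [MeasurableSpace E]
  {N : Ω → Measure E} {lam : Measure E} {P : Measure Ω}

lemma hasLaw_real (hN : IsPoissonRandomMeasure N lam P) {A : Set E} (hA : MeasurableSet A)
    (hA' : lam A ≠ ∞) :
    HasLaw (fun ω => (N ω).real A)
      ((poissonMeasure (lam A).toNNReal).map (fun k : ℕ => (k : ℝ))) P := by
  have h1 := hN.hasLaw A hA hA'
  refine ⟨(hN.measurable A hA).ennreal_toReal.aemeasurable, ?_⟩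
  have h2 := congrArg (Measure.map ENNReal.toReal) h1.map_eq
  rw [AEMeasurable.map_map_of_aemeasurable ENNReal.measurable_toReal.aemeasurable h1.aemeasurable,
    Measure.map_map ENNReal.measurable_toReal (by fun_prop)] at h2
  simpa [Function.comp_def, Measure.real] using h2

lemma measure_lt_top_ae (hN : IsPoissonRandomMeasure N lam P) {A : Set E} (hA : MeasurableSet A)
    (hA' : lam A ≠ ∞) : ∀ᵐ ω ∂P, N ω A < ∞ := by
  have h1 := hN.hasLaw A hA hA'
  refine (h1.ae_iff (p := fun x => x < ∞) (measurableSet_setOfPred.1 measurableSet_Iio)).2 ?_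
  rw [ae_map_iff (by fun_prop) measurableSet_Iio]
  simp

lemma memLp_centered (hN : IsPoissonRandomMeasure N lam P) {A : Set E} (hA : MeasurableSet A)
    (hA' : lam A ≠ ∞) : MemLp (fun ω => (N ω).real A - lam.real A) 2 P := by
  have h1 := hN.hasLaw_real hA hA'
  have h2 := memLp_natCast_sub_poisson (lam A).toNNReal
  have h3 : MemLp (fun x : ℝ => x - lam.real A) 2
      ((poissonMeasure (lam A).toNNReal).map (fun k : ℕ => (k : ℝ))) := by
    rw [memLp_map_measure_iff (by fun_prop) (by fun_prop)]
    exact h2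
  rw [← h1.map_eq, memLp_map_measure_iff (by fun_prop) h1.aemeasurable] at h3
  exact h3

lemma integral_comp_real {F : Type*} [NormedAddCommGroup F] [NormedSpace ℝ F]
    (hN : IsPoissonRandomMeasure N lam P) {A : Set E} (hA : MeasurableSet A)
    (hA' : lam A ≠ ∞) {f : ℝ → F} (hf : StronglyMeasurable f) :
    ∫ ω, f ((N ω).real A) ∂P = ∫ n : ℕ, f n ∂(poissonMeasure (lam A).toNNReal) := by
  have h1 := hN.hasLaw_real hA hA'
  have h2 := h1.integral_comp (f := f) hf.aestronglyMeasurable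
  rw [integral_map (by fun_prop) hf.aestronglyMeasurable] at h2
  exact h2

lemma integral_centered (hN : IsPoissonRandomMeasure N lam P) [IsProbabilityMeasure P]
    {A : Set E} (hA : MeasurableSet A)
    (hA' : lam A ≠ ∞) : ∫ ω, ((N ω).real A - lam.real A) ∂P = 0 := by
  rw [hN.integral_comp_real hA hA' (f := fun x => x - lam.real A) (by fun_prop)]
  have h2 := (memLp_natCast_sub_poisson (lam A).toNNReal).integrable one_le_two
  have h3 : Integrable (fun n : ℕ => (n : ℝ)) (poissonMeasure (lam A).toNNReal) := by
    refine (h2.add (integrable_const ((lam A).toNNReal : ℝ))).congr (ae_of_all _ fun n => ?_)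
    simp
  rw [integral_sub h3 (integrable_const _), integral_natCast_poisson]
  simp [Measure.real, ENNReal.coe_toNNReal_eq_toReal]

lemma integral_sq_centered (hN : IsPoissonRandomMeasure N lam P) {A : Set E}
    (hA : MeasurableSet A) (hA' : lam A ≠ ∞) :
    ∫ ω, ((N ω).real A - lam.real A) ^ 2 ∂P = lam.real A := by
  rw [hN.integral_comp_real hA hA' (f := fun x => (x - lam.real A) ^ 2)
    (by fun_prop)]
  exact integral_sq_centered_poisson (lam A).toNNReal

lemma integral_cexp_centered (hN : IsPoissonRandomMeasure N lam P) {A : Set E}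
    (hA : MeasurableSet A) (hA' : lam A ≠ ∞) (c : ℝ) :
    ∫ ω, Complex.exp ((c * ((N ω).real A - lam.real A) : ℝ) * Complex.I) ∂P =
      Complex.exp (lam.real A * compensatedExponent c) := by
  rw [hN.integral_comp_real hA hA'
    (f := fun x => Complex.exp ((c * (x - lam.real A) : ℝ) * Complex.I))
    (by fun_prop)]
  exact integral_cexp_centered_poisson (lam A).toNNReal c

lemma iIndepFun_of_pairwise_disjoint (hN : IsPoissonRandomMeasure N lam P) {ι : Type*} [Fintype ι]
    {A : ι → Set E} (hA : ∀ i, MeasurableSet (A i))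
    (hd : Pairwise (fun i j => Disjoint (A i) (A j))) : iIndepFun (fun i ω => N ω (A i)) P := by
  let e := Fintype.equivFin ι
  have h := hN.indep _ (fun k => A (e.symm k)) (fun k => hA _)
    (fun i j hij => hd fun h => hij (e.symm.injective h))
  have h2 := h.precomp e.injective
  simpa using h2

end IsPoissonRandomMeasure

/-! ### The compensated integral of step functions -/

section Step

lemma stepIntegral_eq_sum {Ω E : Type*} [MeasurableSpace E] {N : Ω → Measure E} {lam : Measure E}
    (G : SimpleFunc E ℝ) (ω : Ω) :
    stepIntegral N lam G ω =
      ∑ c : G.range, (c : ℝ) * ((N ω).real (G ⁻¹' {(c : ℝ)}) - lam.real (G ⁻¹' {(c : ℝ)})) := by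
  rw [stepIntegral]
  exact (Finset.sum_coe_sort G.range (fun c : ℝ =>
    c * ((N ω).real (G ⁻¹' {c}) - lam.real (G ⁻¹' {c})))).symm

variable {Ω E : Type*} [MeasurableSpace Ω] [MeasurableSpace E]
  {N : Ω → Measure E} {lam : Measure E} {P : Measure Ω}

lemma iIndepFun_fiber (hN : IsPoissonRandomMeasure N lam P) (G : SimpleFunc E ℝ) :
    iIndepFun (fun (c : G.range) ω =>
      (c : ℝ) * ((N ω).real (G ⁻¹' {(c : ℝ)}) - lam.real (G ⁻¹' {(c : ℝ)}))) P := by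
  have h := hN.iIndepFun_of_pairwise_disjoint (A := fun c : G.range => G ⁻¹' {(c : ℝ)})
    (fun c => G.measurableSet_fiber _) (fun c d hcd => by
      refine Disjoint.preimage _ (disjoint_singleton.2 fun h => hcd (Subtype.ext h)))
  exact h.comp (fun (c : G.range) (x : ℝ≥0∞) => (c : ℝ) * (x.toReal - lam.real (G ⁻¹' {(c : ℝ)})))
    (fun c => by fun_prop)

lemma memLp_fiber (hN : IsPoissonRandomMeasure N lam P) {G : SimpleFunc E ℝ}
    (hG : G.FinMeasSupp lam) (c : ℝ) :
    MemLp (fun ω => c * ((N ω).real (G ⁻¹' {c}) - lam.real (G ⁻¹' {c}))) 2 P := by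
  by_cases hc : c = 0
  · simp [hc]
  · exact (hN.memLp_centered (G.measurableSet_fiber c)
      (hG.meas_preimage_singleton_ne_zero hc).ne).const_mul c

lemma memLp_stepIntegral (hN : IsPoissonRandomMeasure N lam P) {G : SimpleFunc E ℝ}
    (hG : G.FinMeasSupp lam) : MemLp (stepIntegral N lam G) 2 P :=
  memLp_finsetSum G.range fun c _ => memLp_fiber hN hG c

/-- The isometry: the terms of the sum are independent and centered, so that variances add. -/
lemma integral_stepIntegral_sq [IsProbabilityMeasure P] (hN : IsPoissonRandomMeasure N lam P)
    {G : SimpleFunc E ℝ} (hG : G.FinMeasSupp lam) :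
    ∫ ω, stepIntegral N lam G ω ^ 2 ∂P = ∫ z, G z ^ 2 ∂lam := by
  have hmean : ∀ c : ℝ,
      ∫ ω, c * ((N ω).real (G ⁻¹' {c}) - lam.real (G ⁻¹' {c})) ∂P = 0 := by
    intro c
    by_cases hc : c = 0
    · simp [hc]
    · rw [integral_const_mul, hN.integral_centered (G.measurableSet_fiber c)
        (hG.meas_preimage_singleton_ne_zero hc).ne, mul_zero]
  have hvar := IndepFun.variance_sum (μ := P) (s := Finset.univ)
    (X := fun (c : G.range) ω =>
      (c : ℝ) * ((N ω).real (G ⁻¹' {(c : ℝ)}) - lam.real (G ⁻¹' {(c : ℝ)})))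
    (fun c _ => memLp_fiber hN hG c)
    (fun c _ d _ hcd => (iIndepFun_fiber hN G).indepFun hcd)
  have hS : (∑ c : G.range, fun ω =>
      (c : ℝ) * ((N ω).real (G ⁻¹' {(c : ℝ)}) - lam.real (G ⁻¹' {(c : ℝ)}))) =
      stepIntegral N lam G := by
    ext ω
    rw [stepIntegral_eq_sum, Finset.sum_apply]
  rw [hS, variance_eq_integral (memLp_stepIntegral hN hG).aemeasurable] at hvar
  have h0 : ∫ ω, stepIntegral N lam G ω ∂P = 0 := by
    unfold stepIntegral
    rw [integral_finsetSum _ fun c _ => (memLp_fiber hN hG c).integrable one_le_two]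
    exact Finset.sum_eq_zero fun c _ => hmean c
  simp only [h0, sub_zero] at hvar
  rw [hvar]
  have hv : ∀ c : G.range, Var[fun ω =>
      (c : ℝ) * ((N ω).real (G ⁻¹' {(c : ℝ)}) - lam.real (G ⁻¹' {(c : ℝ)})); P] =
      lam.real (G ⁻¹' {(c : ℝ)}) * (c : ℝ) ^ 2 := by
    intro c
    rw [variance_of_integral_eq_zero (memLp_fiber hN hG _).aemeasurable (hmean _)]
    by_cases hc : (c : ℝ) = 0
    · simp [hc]
    · simp only [mul_pow]
      rw [integral_const_mul, hN.integral_sq_centered (G.measurableSet_fiber _)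
        (hG.meas_preimage_singleton_ne_zero hc).ne, mul_comm]
  rw [Finset.sum_congr rfl fun c _ => hv c,
    Finset.sum_coe_sort G.range (fun c : ℝ => lam.real (G ⁻¹' {c}) * c ^ 2)]
  have h2 := SimpleFunc.map_integral G (fun x : ℝ => x ^ 2) hG.integrable (by simp)
  have h3 := SimpleFunc.integral_eq_integral (G.map fun x : ℝ => x ^ 2)
    (hG.map (by simp)).integrable
  rw [h3] at h2
  simpa [smul_eq_mul] using h2.symm

lemma integral_cexp_stepIntegral [IsProbabilityMeasure P] (hN : IsPoissonRandomMeasure N lam P)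
    {G : SimpleFunc E ℝ} (hG : G.FinMeasSupp lam) :
    ∫ ω, Complex.exp (stepIntegral N lam G ω * Complex.I) ∂P =
      Complex.exp (∫ z, compensatedExponent (G z) ∂lam) := by
  have h := iIndepFun.integral_fun_prod_comp (X := fun (c : G.range) ω =>
      (c : ℝ) * ((N ω).real (G ⁻¹' {(c : ℝ)}) - lam.real (G ⁻¹' {(c : ℝ)})))
    (iIndepFun_fiber hN G) (f := fun _ x => Complex.exp ((x : ℂ) * Complex.I))
    (fun c => (memLp_fiber hN hG (c : ℝ)).aemeasurable) (fun c => by fun_prop)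
  have h1 : ∀ ω, ∏ c : G.range, Complex.exp
      ((((c : ℝ) * ((N ω).real (G ⁻¹' {(c : ℝ)}) - lam.real (G ⁻¹' {(c : ℝ)})) : ℝ) : ℂ)
        * Complex.I) = Complex.exp (stepIntegral N lam G ω * Complex.I) := by
    intro ω
    rw [← Complex.exp_sum, stepIntegral_eq_sum, ← Finset.sum_mul, Complex.ofReal_sum]
  simp_rw [h1] at h
  rw [h]
  have hv : ∀ c : ℝ, ∫ ω, Complex.exp
      (((c * ((N ω).real (G ⁻¹' {c}) - lam.real (G ⁻¹' {c})) : ℝ) : ℂ)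
        * Complex.I) ∂P = Complex.exp (lam.real (G ⁻¹' {c}) * compensatedExponent c) := by
    intro c
    by_cases hc : c = 0
    · simp [hc, compensatedExponent]
    · exact hN.integral_cexp_centered (G.measurableSet_fiber _)
        (hG.meas_preimage_singleton_ne_zero hc).ne c
  rw [Finset.prod_congr rfl fun (c : G.range) _ => hv c, ← Complex.exp_sum,
    Finset.sum_coe_sort G.range
      (fun c : ℝ => (lam.real (G ⁻¹' {c}) : ℂ) * compensatedExponent c)]
  have h2 := SimpleFunc.map_integral G compensatedExponent hG.integrable compensatedExponent_zero
  have h3 := SimpleFunc.integral_eq_integral (G.map compensatedExponent)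
    (hG.map compensatedExponent_zero).integrable
  rw [h3] at h2
  congr 1
  simpa using h2.symm

/-- Almost surely, the support of a step function has finite `N`-measure, so that its compensated
integral is a difference of ordinary integrals. -/
lemma stepIntegral_ae_eq (hN : IsPoissonRandomMeasure N lam P) {G : SimpleFunc E ℝ}
    (hG : G.FinMeasSupp lam) :
    ∀ᵐ ω ∂P, Integrable G (N ω) ∧
      stepIntegral N lam G ω = ∫ z, G z ∂(N ω) - ∫ z, G z ∂lam := by
  have h1 : lam (Function.support G) ≠ ∞ := (SimpleFunc.finMeasSupp_iff_support.1 hG).ne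
  filter_upwards [hN.measure_lt_top_ae G.measurableSet_support h1] with ω hω
  have h2 : G.FinMeasSupp (N ω) := SimpleFunc.finMeasSupp_iff_support.2 hω
  refine ⟨h2.integrable, ?_⟩
  rw [← SimpleFunc.integral_eq_integral _ h2.integrable,
    ← SimpleFunc.integral_eq_integral _ hG.integrable, SimpleFunc.integral_def,
    SimpleFunc.integral_def, SimpleFunc.setToSimpleFunc, SimpleFunc.setToSimpleFunc,
    ← Finset.sum_sub_distrib, stepIntegral]
  refine Finset.sum_congr rfl fun c _ => ?_
  simp [weightedSMul]
  ring

lemma stepIntegral_add_smul (hN : IsPoissonRandomMeasure N lam P) {G G' : SimpleFunc E ℝ}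
    (hG : G.FinMeasSupp lam) (hG' : G'.FinMeasSupp lam) (a b : ℝ)
    (hGG : (a • G + b • G').FinMeasSupp lam) :
    ∀ᵐ ω ∂P, stepIntegral N lam (a • G + b • G') ω =
      a * stepIntegral N lam G ω + b * stepIntegral N lam G' ω := by
  filter_upwards [stepIntegral_ae_eq hN hG, stepIntegral_ae_eq hN hG',
    stepIntegral_ae_eq hN hGG] with ω h1 h2 h3
  rw [h1.2, h2.2, h3.2]
  simp only [SimpleFunc.coe_add, SimpleFunc.coe_smul, Pi.add_apply, Pi.smul_apply, smul_eq_mul]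
  rw [integral_add (h1.1.const_mul a) (h2.1.const_mul b),
    integral_add (hG.integrable.const_mul a) (hG'.integrable.const_mul b), integral_const_mul,
    integral_const_mul, integral_const_mul, integral_const_mul]
  ring

lemma SimpleFunc.FinMeasSupp.const_smul {G : SimpleFunc E ℝ} (hG : G.FinMeasSupp lam) (a : ℝ) :
    (a • G).FinMeasSupp lam :=
  hG.map (g := fun x => a • x) (by simp)

end Step

/-! ### Estimates for the characteristic exponent -/

lemma norm_compensatedExponent_le (x : ℝ) : ‖compensatedExponent x‖ ≤ 3 * x ^ 2 := by
  rw [compensatedExponent]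
  have hn : ‖(x : ℂ) * Complex.I‖ = |x| := by simp
  rcases le_or_gt |x| 1 with hx | hx
  · have h := Complex.norm_exp_sub_one_sub_id_le (x := (x : ℂ) * Complex.I) (by rwa [hn])
    rw [hn, sq_abs] at h
    nlinarith [sq_nonneg x]
  · have h1 : ‖Complex.exp (x * Complex.I) - 1 - x * Complex.I‖ ≤ 1 + 1 + |x| := by
      refine (norm_sub_le _ _).trans (add_le_add ((norm_sub_le _ _).trans ?_) hn.le)
      simp [Complex.norm_exp_ofReal_mul_I]
    rw [← sq_abs]
    nlinarith

/-- Second order Taylor estimate, in the form that controls both large and small arguments. -/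
lemma norm_compensatedExponent_add_le (x : ℝ) :
    ‖compensatedExponent x + x ^ 2 / 2‖ ≤ 4 * min (x ^ 2) (|x| ^ 3) := by
  have hn : ‖(x : ℂ) * Complex.I‖ = |x| := by simp
  have h1 : ‖compensatedExponent x + x ^ 2 / 2‖ ≤ 4 * x ^ 2 := by
    refine (norm_add_le _ _).trans ?_
    have h := norm_compensatedExponent_le x
    have h2 : ‖(x : ℂ) ^ 2 / 2‖ = x ^ 2 / 2 := by simp
    rw [h2]
    nlinarith [sq_nonneg x]
  rw [mul_min_of_nonneg _ _ (by norm_num)]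
  refine le_min h1 ?_
  rcases le_or_gt |x| 1 with hx | hx
  · have h := Complex.exp_bound (x := (x : ℂ) * Complex.I) (by rwa [hn]) (n := 3) (by norm_num)
    rw [hn] at h
    have e : Complex.exp (x * Complex.I) - ∑ m ∈ Finset.range 3,
        ((x : ℂ) * Complex.I) ^ m / m.factorial = compensatedExponent x + x ^ 2 / 2 := by
      simp only [Finset.sum_range_succ, Finset.sum_range_zero, compensatedExponent, mul_pow,
        Complex.I_sq]
      norm_num [Nat.factorial]
      ring
    rw [e] at h
    refine h.trans ?_
    rw [mul_comm]
    gcongr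
    norm_num [Nat.factorial]
  · refine h1.trans ?_
    rw [← sq_abs]
    have : 0 ≤ |x| ^ 2 := by positivity
    nlinarith

/-- The bound is a product in which one factor is a difference and the other one square integrable,
so that the Cauchy–Schwarz inequality makes `g ↦ ψ ∘ g` continuous from `L²` to `L¹`. -/
lemma norm_compensatedExponent_sub_le (x y : ℝ) :
    ‖compensatedExponent x - compensatedExponent y‖ ≤
      4 * (|x - y| * (|x - y| + 2 * |y|)) := by
  have e : compensatedExponent x - compensatedExponent y =
      Complex.exp (y * Complex.I) * compensatedExponent (x - y) +
        (x - y) * Complex.I * (Complex.exp (Complex.I * y) - 1) := by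
    have : Complex.exp (x * Complex.I) =
        Complex.exp (y * Complex.I) * Complex.exp (((x - y : ℝ) : ℂ) * Complex.I) := by
      rw [← Complex.exp_add]
      congr 1
      push_cast
      ring
    simp only [compensatedExponent, this, mul_comm Complex.I (y : ℂ)]
    push_cast
    ring
  rw [e]
  refine (norm_add_le _ _).trans ?_
  rw [norm_mul, norm_mul, norm_mul, Complex.norm_exp_ofReal_mul_I, Complex.norm_I, one_mul,
    mul_one, ← Complex.ofReal_sub, Complex.norm_real]
  have h1 := norm_compensatedExponent_le (x - y)
  have h2 : ‖Complex.exp (Complex.I * y) - 1‖ ≤ |y| := Real.norm_exp_I_mul_ofReal_sub_one_le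
  have h3 := mul_le_mul_of_nonneg_left h2 (norm_nonneg (x - y))
  rw [Real.norm_eq_abs] at h3 ⊢
  rw [← sq_abs] at h1
  have := mul_nonneg (abs_nonneg (x - y)) (abs_nonneg y)
  nlinarith [sq_nonneg |x - y|]

lemma continuous_compensatedExponent : Continuous compensatedExponent := by
  unfold compensatedExponent
  fun_prop

section Limit

variable {E : Type*} [MeasurableSpace E] {lam : Measure E}

lemma integrable_compensatedExponent {g : E → ℝ} (hg : MemLp g 2 lam) :
    Integrable (fun z => compensatedExponent (g z)) lam := by
  have h := (memLp_two_iff_integrable_sq hg.1).1 hg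
  refine (h.const_mul 3).mono' (continuous_compensatedExponent.comp_aestronglyMeasurable hg.1)
    (ae_of_all _ fun z => ?_)
  exact norm_compensatedExponent_le (g z)

lemma tendsto_integral_compensatedExponent {G : ℕ → E → ℝ} {g : E → ℝ}
    (hG : ∀ n, MemLp (G n) 2 lam) (hg : MemLp g 2 lam)
    (h : Tendsto (fun n => eLpNorm (fun z => G n z - g z) 2 lam) atTop (𝓝 0)) :
    Tendsto (fun n => ∫ z, compensatedExponent (G n z) ∂lam) atTop
      (𝓝 (∫ z, compensatedExponent (g z) ∂lam)) := by
  refine tendsto_integral_of_L1' _ (integrable_compensatedExponent hg).1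
    (Eventually.of_forall fun n => integrable_compensatedExponent (hG n)) ?_
  have hbound : ∀ n, eLpNorm ((fun z => compensatedExponent (G n z)) -
      fun z => compensatedExponent (g z)) 1 lam ≤
      4 * (eLpNorm (fun z => G n z - g z) 2 lam *
        (eLpNorm (fun z => G n z - g z) 2 lam + 2 * eLpNorm g 2 lam)) := by
    intro n
    have hd : MemLp (fun z => G n z - g z) 2 lam := (hG n).sub hg
    have hk : AEStronglyMeasurable (fun z => |G n z - g z| + 2 * |g z|) lam := by
      have h1 : AEStronglyMeasurable (fun z => |G n z - g z|) lam := hd.1.norm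
      have h2 : AEStronglyMeasurable (fun z => |g z|) lam := hg.1.norm
      exact h1.add (h2.const_mul 2)
    calc eLpNorm ((fun z => compensatedExponent (G n z)) -
          fun z => compensatedExponent (g z)) 1 lam
        ≤ eLpNorm (fun z => 4 * ((G n z - g z) * (|G n z - g z| + 2 * |g z|))) 1 lam := by
          refine eLpNorm_mono fun z => ?_
          refine (norm_compensatedExponent_sub_le _ _).trans (le_of_eq ?_)
          rw [Real.norm_eq_abs, abs_mul, abs_mul, abs_of_pos (show (0 : ℝ) < 4 by norm_num),
            abs_of_nonneg (show 0 ≤ |G n z - g z| + 2 * |g z| by positivity)]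
      _ = 4 * eLpNorm (fun z => (G n z - g z) * (|G n z - g z| + 2 * |g z|)) 1 lam := by
          have := eLpNorm_const_smul (4 : ℝ)
            (fun z => (G n z - g z) * (|G n z - g z| + 2 * |g z|)) 1 lam
          have h4 : ‖(4 : ℝ)‖ₑ = 4 := by
            rw [← ofReal_norm]; norm_num
          rw [h4] at this
          exact this
      _ ≤ 4 * (1 * eLpNorm (fun z => G n z - g z) 2 lam *
            eLpNorm (fun z => |G n z - g z| + 2 * |g z|) 2 lam) := by
          have h1 := eLpNorm_le_eLpNorm_mul_eLpNorm_of_nnnorm (p := (2 : ℝ≥0∞)) (q := (2 : ℝ≥0∞))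
            (r := (1 : ℝ≥0∞)) hd.1 hk (fun a b : ℝ => a * b) 1
            (ae_of_all _ fun z => by rw [nnnorm_mul, one_mul])
          rw [ENNReal.coe_one] at h1
          exact mul_le_mul_right h1 _
      _ ≤ 4 * (eLpNorm (fun z => G n z - g z) 2 lam *
            (eLpNorm (fun z => G n z - g z) 2 lam + 2 * eLpNorm g 2 lam)) := by
          rw [one_mul]
          have h1 : AEStronglyMeasurable (fun z => |G n z - g z|) lam := hd.1.norm
          have h2 : AEStronglyMeasurable (fun z => |g z|) lam := hg.1.norm
          have e1 : eLpNorm (fun z => |G n z - g z|) 2 lam =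
              eLpNorm (fun z => G n z - g z) 2 lam := eLpNorm_norm (fun z => G n z - g z)
          have e2 : eLpNorm (fun z => 2 * |g z|) 2 lam = 2 * eLpNorm g 2 lam := by
            have := eLpNorm_const_smul (2 : ℝ) (fun z => |g z|) 2 lam
            have h4 : ‖(2 : ℝ)‖ₑ = 2 := by
              rw [← ofReal_norm]; norm_num
            rw [h4] at this
            rw [← eLpNorm_norm g]
            exact this
          have h3 := eLpNorm_add_le h1 (h2.const_mul 2) one_le_two
          rw [e1, e2] at h3
          exact mul_le_mul_right (mul_le_mul_right h3 _) _
  refine tendsto_of_tendsto_of_tendsto_of_le_of_le tendsto_const_nhds ?_ (fun n => zero_le)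
    hbound
  have hfin : eLpNorm g 2 lam ≠ ∞ := hg.eLpNorm_ne_top
  have h1 : Tendsto (fun n => eLpNorm (fun z => G n z - g z) 2 lam + 2 * eLpNorm g 2 lam) atTop
      (𝓝 (0 + 2 * eLpNorm g 2 lam)) := h.add tendsto_const_nhds
  have h2 := ENNReal.Tendsto.mul h (Or.inr (by finiteness)) h1 (Or.inr (by simp))
  have h3 := ENNReal.Tendsto.const_mul (a := 4) h2 (Or.inr (by simp))
  simpa using h3

end Limit

/-! ### The compensated integral -/

section Integral

variable {Ω E : Type*} [MeasurableSpace Ω] [MeasurableSpace E]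
  {N : Ω → Measure E} {lam : Measure E} {P : Measure Ω}

lemma eLpNorm_stepIntegral [IsProbabilityMeasure P] (hN : IsPoissonRandomMeasure N lam P)
    {G : SimpleFunc E ℝ} (hG : G.FinMeasSupp lam) :
    eLpNorm (stepIntegral N lam G) 2 P = eLpNorm G 2 lam := by
  have h1 := (memLp_stepIntegral hN hG).eLpNorm_eq_integral_rpow_norm (by simp) (by simp)
  have h2 := ((SimpleFunc.memLp_iff_finMeasSupp (p := 2) (by simp)
    (by simp)).2 hG).eLpNorm_eq_integral_rpow_norm (by simp) (by simp)
  rw [h1, h2]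
  have h3 := integral_stepIntegral_sq hN hG
  simp only [ENNReal.toReal_ofNat, Real.rpow_ofNat, Real.norm_eq_abs, sq_abs]
  rw [h3]

lemma IsCompensatedIntegral.congr {g g' : E → ℝ} {Y Y' : Ω → ℝ}
    (h : IsCompensatedIntegral N lam P g Y) (hg : g =ᵐ[lam] g') (hY : Y =ᵐ[P] Y') :
    IsCompensatedIntegral N lam P g' Y' := by
  obtain ⟨h0, G, hG, h1, h2⟩ := h
  refine ⟨h0.ae_eq hY, G, hG, ?_, ?_⟩
  · refine h1.congr fun n => eLpNorm_congr_ae ?_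
    filter_upwards [hg] with z hz
    rw [hz]
  · refine h2.congr fun n => eLpNorm_congr_ae ?_
    filter_upwards [hY] with z hz
    rw [hz]

lemma memLp_compensatedIntegral (g : E → ℝ) : MemLp (compensatedIntegral N lam P g) 2 P := by
  unfold compensatedIntegral
  split_ifs with h
  · exact h.choose_spec.1
  · exact MemLp.zero

lemma tendsto_eLpNorm_add_smul {α : Type*} [MeasurableSpace α] {μ : Measure α}
    {F F' : ℕ → α → ℝ} {f f' : α → ℝ} (hF : ∀ n, MemLp (F n) 2 μ) (hF' : ∀ n, MemLp (F' n) 2 μ)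
    (hf : MemLp f 2 μ) (hf' : MemLp f' 2 μ)
    (h1 : Tendsto (fun n => eLpNorm (fun z => F n z - f z) 2 μ) atTop (𝓝 0))
    (h2 : Tendsto (fun n => eLpNorm (fun z => F' n z - f' z) 2 μ) atTop (𝓝 0)) (a b : ℝ) :
    Tendsto (fun n => eLpNorm (fun z => (a * F n z + b * F' n z) - (a * f z + b * f' z)) 2 μ)
      atTop (𝓝 0) := by
  have h3 : Tendsto (fun n => ‖a‖ₑ * eLpNorm (fun z => F n z - f z) 2 μ +
      ‖b‖ₑ * eLpNorm (fun z => F' n z - f' z) 2 μ) atTop (𝓝 (‖a‖ₑ * 0 + ‖b‖ₑ * 0)) :=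
    (ENNReal.Tendsto.const_mul h1 (Or.inr (by simp))).add
      (ENNReal.Tendsto.const_mul h2 (Or.inr (by simp)))
  rw [mul_zero, mul_zero, add_zero] at h3
  refine tendsto_of_tendsto_of_tendsto_of_le_of_le tendsto_const_nhds h3 (fun n => zero_le)
    fun n => ?_
  have e : (fun z => (a * F n z + b * F' n z) - (a * f z + b * f' z)) =
      (a • fun z => F n z - f z) + b • fun z => F' n z - f' z := by
    ext z
    simp only [Pi.add_apply, Pi.smul_apply, smul_eq_mul]
    ring
  have h4 := eLpNorm_add_le (((hF n).sub hf).1.const_smul a)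
    (((hF' n).sub hf').1.const_smul b) one_le_two
  rw [eLpNorm_const_smul, eLpNorm_const_smul] at h4
  simp only
  rw [e]
  exact h4

/-- Linearity of the compensated integral. -/
lemma IsCompensatedIntegral.add_smul (hN : IsPoissonRandomMeasure N lam P) {g g' : E → ℝ}
    {Y Y' : Ω → ℝ} (hg : MemLp g 2 lam) (hg' : MemLp g' 2 lam)
    (h : IsCompensatedIntegral N lam P g Y)
    (h' : IsCompensatedIntegral N lam P g' Y') (a b : ℝ) :
    IsCompensatedIntegral N lam P (fun z => a * g z + b * g' z)
      (fun ω => a * Y ω + b * Y' ω) := by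
  obtain ⟨h0, G, hG, h1, h2⟩ := h
  obtain ⟨h0', G', hG', h1', h2'⟩ := h'
  have hGG : ∀ n, (a • G n + b • G' n).FinMeasSupp lam := fun n =>
    (SimpleFunc.FinMeasSupp.const_smul (hG n) a).add
      (SimpleFunc.FinMeasSupp.const_smul (hG' n) b)
  have hm : ∀ {G : SimpleFunc E ℝ}, G.FinMeasSupp lam → MemLp G 2 lam := fun h =>
    (SimpleFunc.memLp_iff_finMeasSupp (by simp) (by simp)).2 h
  refine ⟨(h0.const_mul a).add (h0'.const_mul b), fun n => a • G n + b • G' n, hGG, ?_, ?_⟩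
  · exact tendsto_eLpNorm_add_smul (fun n => hm (hG n)) (fun n => hm (hG' n)) hg hg' h1 h1' a b
  · refine (tendsto_eLpNorm_add_smul (fun n => memLp_stepIntegral hN (hG n))
      (fun n => memLp_stepIntegral hN (hG' n)) h0 h0' h2 h2' a b).congr fun n => ?_
    refine eLpNorm_congr_ae ?_
    filter_upwards [stepIntegral_add_smul hN (hG n) (hG' n) a b (hGG n)] with ω hω
    rw [hω]

lemma IsCompensatedIntegral.eLpNorm_le [IsProbabilityMeasure P]
    (hN : IsPoissonRandomMeasure N lam P) {g : E → ℝ} {Y : Ω → ℝ} (hg : MemLp g 2 lam)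
    (h : IsCompensatedIntegral N lam P g Y) : eLpNorm Y 2 P ≤ eLpNorm g 2 lam := by
  obtain ⟨h0, G, hG, h1, h2⟩ := h
  have hm : ∀ {G : SimpleFunc E ℝ}, G.FinMeasSupp lam → MemLp G 2 lam := fun h =>
    (SimpleFunc.memLp_iff_finMeasSupp (by simp) (by simp)).2 h
  have h3 : Tendsto (fun n => eLpNorm (fun ω => stepIntegral N lam (G n) ω - Y ω) 2 P +
      (eLpNorm (fun z => G n z - g z) 2 lam + eLpNorm g 2 lam)) atTop
      (𝓝 (0 + (0 + eLpNorm g 2 lam))) := h2.add (h1.add tendsto_const_nhds)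
  rw [zero_add, zero_add] at h3
  refine ge_of_tendsto' h3 fun n => ?_
  have hS := memLp_stepIntegral hN (hG n)
  calc eLpNorm Y 2 P ≤ eLpNorm (stepIntegral N lam (G n) - Y) 2 P +
        eLpNorm (stepIntegral N lam (G n)) 2 P := by
        have e : Y = -(stepIntegral N lam (G n) - Y) + stepIntegral N lam (G n) := by
          ext ω; simp
        conv_lhs => rw [e]
        refine (eLpNorm_add_le (hS.1.sub h0.1).neg hS.1 one_le_two).trans ?_
        rw [eLpNorm_neg]
    _ ≤ _ := by
        gcongr
        · exact le_rfl
        · rw [eLpNorm_stepIntegral hN (hG n)]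
          have e : (G n : E → ℝ) = (fun z => G n z - g z) + g := by ext z; simp
          conv_lhs => rw [e]
          exact eLpNorm_add_le ((hm (hG n)).sub hg).1 hg.1 one_le_two

lemma IsCompensatedIntegral.unique [IsProbabilityMeasure P]
    (hN : IsPoissonRandomMeasure N lam P) {g : E → ℝ} {Y Y' : Ω → ℝ} (hg : MemLp g 2 lam)
    (h : IsCompensatedIntegral N lam P g Y) (h' : IsCompensatedIntegral N lam P g Y') :
    Y =ᵐ[P] Y' := by
  have h1 := h.add_smul hN hg hg h' 1 (-1)
  have e : (fun z => 1 * g z + -1 * g z) = fun _ => (0 : ℝ) := by ext z; ring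
  rw [e] at h1
  have h2 := h1.eLpNorm_le hN (MemLp.zero' (p := 2))
  have h3 : eLpNorm (fun ω => 1 * Y ω + -1 * Y' ω) 2 P = 0 := by
    refine le_antisymm (h2.trans ?_) zero_le
    simp
  rw [eLpNorm_eq_zero_iff h1.1.1 (by simp)] at h3
  filter_upwards [h3] with ω hω
  simp only [Pi.zero_apply] at hω
  linarith

/-- Existence of the integral: the isometry for step functions and the completeness of `L²(P)`. -/
lemma exists_isCompensatedIntegral [IsProbabilityMeasure P]
    (hN : IsPoissonRandomMeasure N lam P) {g : E → ℝ} (hg : MemLp g 2 lam) :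
    ∃ Y, IsCompensatedIntegral N lam P g Y := by
  have hex : ∀ n : ℕ, ∃ G : SimpleFunc E ℝ, eLpNorm (g - ⇑G) 2 lam < (n + 1 : ℝ≥0∞)⁻¹ ∧
      MemLp G 2 lam := fun n =>
    hg.exists_simpleFunc_eLpNorm_sub_lt (by simp) (by simp)
  choose G hG1 hG2 using hex
  have hG : ∀ n, (G n).FinMeasSupp lam := fun n =>
    (SimpleFunc.memLp_iff_finMeasSupp (by simp) (by simp)).1 (hG2 n)
  have hlim : Tendsto (fun n => eLpNorm (⇑(G n) - g) 2 lam) atTop (𝓝 0) := by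
    have h1 : Tendsto (fun n : ℕ => (n + 1 : ℝ≥0∞)⁻¹) atTop (𝓝 0) := by
      have := (tendsto_add_atTop_iff_nat 1).2 ENNReal.tendsto_inv_nat_nhds_zero
      simpa using this
    refine tendsto_of_tendsto_of_tendsto_of_le_of_le tendsto_const_nhds h1 (fun n => zero_le)
      fun n => ?_
    rw [← eLpNorm_neg, neg_sub]
    exact (hG1 n).le
  have hc : CauchySeq fun n => (hG2 n).toLp (G n) :=
    ((Lp.tendsto_Lp_iff_tendsto_eLpNorm'' _ hG2 g hg).2 hlim).cauchySeq
  have hS : ∀ n, MemLp (stepIntegral N lam (G n)) 2 P := fun n => memLp_stepIntegral hN (hG n)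
  have hc2 : CauchySeq fun n => (hS n).toLp (stepIntegral N lam (G n)) := by
    rw [EMetric.cauchySeq_iff] at hc ⊢
    intro ε hε
    obtain ⟨M, hM⟩ := hc ε hε
    refine ⟨M, fun m hm n hn => ?_⟩
    have := hM m hm n hn
    rw [Lp.edist_toLp_toLp] at this ⊢
    refine lt_of_le_of_lt (le_of_eq ?_) this
    have hsub : ((1 : ℝ) • G m + (-1 : ℝ) • G n).FinMeasSupp lam :=
      (SimpleFunc.FinMeasSupp.const_smul (hG m) 1).add
        (SimpleFunc.FinMeasSupp.const_smul (hG n) (-1))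
    have h1 := eLpNorm_stepIntegral hN hsub
    rw [eLpNorm_congr_ae (stepIntegral_add_smul hN (hG m) (hG n) 1 (-1) hsub)] at h1
    convert! h1 using 2
    · ext ω; simp; ring
    · ext z; simp; ring
  obtain ⟨Y, hY⟩ := cauchySeq_tendsto_of_complete hc2
  refine ⟨Y, Lp.memLp Y, G, hG, hlim, ?_⟩
  have hY' : Tendsto (fun n => (hS n).toLp (stepIntegral N lam (G n))) atTop
      (𝓝 ((Lp.memLp Y).toLp Y)) := by
    rw [Lp.toLp_coeFn]
    exact hY
  exact (Lp.tendsto_Lp_iff_tendsto_eLpNorm'' _ hS Y (Lp.memLp Y)).1 hY'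

lemma isCompensatedIntegral_compensatedIntegral [IsProbabilityMeasure P]
    (hN : IsPoissonRandomMeasure N lam P) {g : E → ℝ} (hg : MemLp g 2 lam) :
    IsCompensatedIntegral N lam P g (compensatedIntegral N lam P g) := by
  have h := exists_isCompensatedIntegral hN hg
  unfold compensatedIntegral
  rw [dif_pos h]
  exact h.choose_spec

lemma compensatedIntegral_add_smul [IsProbabilityMeasure P]
    (hN : IsPoissonRandomMeasure N lam P) {g g' : E → ℝ} (hg : MemLp g 2 lam)
    (hg' : MemLp g' 2 lam) (a b : ℝ) :
    compensatedIntegral N lam P (fun z => a * g z + b * g' z) =ᵐ[P]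
      fun ω => a * compensatedIntegral N lam P g ω + b * compensatedIntegral N lam P g' ω :=
  (isCompensatedIntegral_compensatedIntegral hN
    ((hg.const_mul a).add (hg'.const_mul b))).unique hN ((hg.const_mul a).add (hg'.const_mul b))
    ((isCompensatedIntegral_compensatedIntegral hN hg).add_smul hN hg hg'
      (isCompensatedIntegral_compensatedIntegral hN hg') a b)

lemma compensatedIntegral_sum [IsProbabilityMeasure P]
    (hN : IsPoissonRandomMeasure N lam P) {ι : Type*} (s : Finset ι) {g : ι → E → ℝ}
    (hg : ∀ i, MemLp (g i) 2 lam) (a : ι → ℝ) :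
    compensatedIntegral N lam P (fun z => ∑ i ∈ s, a i * g i z) =ᵐ[P]
      fun ω => ∑ i ∈ s, a i * compensatedIntegral N lam P (g i) ω := by
  classical
  induction s using Finset.induction_on with
  | empty =>
    have h0 : MemLp (fun _ : E => (0 : ℝ)) 2 lam := MemLp.zero'
    have h := compensatedIntegral_add_smul hN h0 h0 0 0
    simpa using h
  | insert i s hi ih =>
    have hs : MemLp (fun z => ∑ i ∈ s, a i * g i z) 2 lam :=
      memLp_finsetSum s fun j _ => (hg j).const_mul (a j)
    have h := compensatedIntegral_add_smul hN (hg i) hs (a i) 1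
    filter_upwards [h, ih] with ω h1 h2
    simp only [Finset.sum_insert hi]
    rw [h2, one_mul] at h1
    simpa using h1

/-- The Lévy–Khintchine formula for the compensated integral. -/
lemma integral_cexp_compensatedIntegral [IsProbabilityMeasure P]
    (hN : IsPoissonRandomMeasure N lam P) {g : E → ℝ} (hg : MemLp g 2 lam) :
    ∫ ω, Complex.exp (compensatedIntegral N lam P g ω * Complex.I) ∂P =
      Complex.exp (∫ z, compensatedExponent (g z) ∂lam) := by
  obtain ⟨h0, G, hG, h1, h2⟩ := isCompensatedIntegral_compensatedIntegral hN hg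
  set Y := compensatedIntegral N lam P g
  have hm : ∀ n, MemLp (G n) 2 lam := fun n =>
    (SimpleFunc.memLp_iff_finMeasSupp (by simp) (by simp)).2 (hG n)
  have hS : ∀ n, MemLp (stepIntegral N lam (G n)) 2 P := fun n => memLp_stepIntegral hN (hG n)
  have hlim1 := (Complex.continuous_exp.tendsto _).comp
    (tendsto_integral_compensatedExponent hm hg h1)
  have hmeas : ∀ {X : Ω → ℝ}, MemLp X 2 P →
      AEStronglyMeasurable (fun ω => Complex.exp (X ω * Complex.I)) P := by
    intro X hX
    exact (by fun_prop : Continuous fun x : ℝ =>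
      Complex.exp (x * Complex.I)).comp_aestronglyMeasurable hX.1
  have hlim2 : Tendsto (fun n => ∫ ω, Complex.exp (stepIntegral N lam (G n) ω * Complex.I) ∂P)
      atTop (𝓝 (∫ ω, Complex.exp (Y ω * Complex.I) ∂P)) := by
    refine tendsto_integral_of_L1' _ (hmeas h0) (Eventually.of_forall fun n => ?_) ?_
    · refine Integrable.of_bound (hmeas (hS n)) 1 (ae_of_all _ fun ω => ?_)
      rw [Complex.norm_exp_ofReal_mul_I]
    · refine tendsto_of_tendsto_of_tendsto_of_le_of_le tendsto_const_nhds h2 (fun n => zero_le)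
        fun n => ?_
      refine le_trans ?_ (eLpNorm_le_eLpNorm_of_exponent_le one_le_two ((hS n).sub h0).1)
      refine eLpNorm_mono fun ω => ?_
      simp only [Pi.sub_apply]
      have e : Complex.exp (stepIntegral N lam (G n) ω * Complex.I) -
          Complex.exp (Y ω * Complex.I) = Complex.exp (Y ω * Complex.I) *
          (Complex.exp (Complex.I * ((stepIntegral N lam (G n) ω - Y ω : ℝ) : ℂ)) - 1) := by
        rw [mul_sub, ← Complex.exp_add, mul_one]
        congr 2
        push_cast
        ring
      rw [e, norm_mul, Complex.norm_exp_ofReal_mul_I, one_mul]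
      exact Real.norm_exp_I_mul_ofReal_sub_one_le
  refine tendsto_nhds_unique hlim2 (hlim1.congr fun n => ?_)
  exact (integral_cexp_stepIntegral hN (hG n)).symm

end Integral

/-! ### Integrals over sets of finite intensity -/

section FiniteIntensity

variable {Ω E : Type*} [MeasurableSpace Ω] [MeasurableSpace E]
  {N : Ω → Measure E} {lam : Measure E} {P : Measure Ω}

lemma IsPoissonRandomMeasure.lintegral_apply (hN : IsPoissonRandomMeasure N lam P) {A : Set E}
    (hA : MeasurableSet A) (hA' : lam A ≠ ∞) : ∫⁻ ω, N ω A ∂P = lam A := by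
  rw [(hN.hasLaw A hA hA').lintegral_comp (f := fun x => x) (by fun_prop),
    lintegral_map (by fun_prop) (by fun_prop)]
  have h2 := (memLp_natCast_sub_poisson (lam A).toNNReal).integrable one_le_two
  have h3 : Integrable (fun n : ℕ => (n : ℝ)) (poissonMeasure (lam A).toNNReal) := by
    refine (h2.add (integrable_const ((lam A).toNNReal : ℝ))).congr (ae_of_all _ fun n => ?_)
    simp
  have h4 := ofReal_integral_eq_lintegral_ofReal h3 (ae_of_all _ fun n => Nat.cast_nonneg n)
  rw [integral_natCast_poisson] at h4
  simp only [ENNReal.ofReal_natCast, ENNReal.ofReal_coe_nnreal] at h4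
  rw [← h4, ENNReal.coe_toNNReal hA']

lemma IsPoissonRandomMeasure.measurable_restrict (hN : IsPoissonRandomMeasure N lam P) {A : Set E}
    (hA : MeasurableSet A) : Measurable (fun ω => (N ω).restrict A) := by
  refine Measure.measurable_of_measurable_coe _ fun B hB => ?_
  simp_rw [Measure.restrict_apply hB]
  exact hN.measurable _ (hB.inter hA)

/-- Campbell's formula on a set of finite intensity: the mean measure of `N` is `lam`. -/
lemma IsPoissonRandomMeasure.bind_restrict (hN : IsPoissonRandomMeasure N lam P) {A : Set E}
    (hA : MeasurableSet A) (hA' : lam A ≠ ∞) :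
    P.bind (fun ω => (N ω).restrict A) = lam.restrict A := by
  ext B hB
  rw [Measure.bind_apply hB (hN.measurable_restrict hA).aemeasurable]
  simp_rw [Measure.restrict_apply hB]
  exact hN.lintegral_apply (hB.inter hA) (measure_ne_top_of_subset inter_subset_right hA')

lemma IsPoissonRandomMeasure.lintegral_enorm_restrict (hN : IsPoissonRandomMeasure N lam P)
    {A : Set E} (hA : MeasurableSet A) (hA' : lam A ≠ ∞) {f : E → ℝ}
    (hf : AEStronglyMeasurable f (lam.restrict A)) :
    ∫⁻ ω, ∫⁻ z in A, ‖f z‖ₑ ∂(N ω) ∂P = ∫⁻ z in A, ‖f z‖ₑ ∂lam := by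
  rw [← hN.bind_restrict hA hA'] at hf ⊢
  rw [Measure.lintegral_bind (hN.measurable_restrict hA).aemeasurable hf.enorm]

lemma IsPoissonRandomMeasure.ae_integrable_restrict (hN : IsPoissonRandomMeasure N lam P)
    {A : Set E} (hA : MeasurableSet A) (hA' : lam A ≠ ∞) {f : E → ℝ}
    (hf : Integrable f (lam.restrict A)) :
    ∀ᵐ ω ∂P, Integrable f ((N ω).restrict A) := by
  have hκ := (hN.measurable_restrict hA).aemeasurable (μ := P)
  have h1 : ∀ᵐ z ∂(P.bind (fun ω => (N ω).restrict A)), f z = hf.1.mk f z := by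
    rw [hN.bind_restrict hA hA']
    exact hf.1.ae_eq_mk
  have h2 : ∀ᵐ ω ∂P, ∫⁻ z in A, ‖hf.1.mk f z‖ₑ ∂(N ω) < ∞ := by
    refine ae_lt_top' ((Measure.measurable_lintegral
      hf.1.stronglyMeasurable_mk.measurable.enorm).comp_aemeasurable hκ) ?_
    have h3 := hN.lintegral_enorm_restrict hA hA' hf.1.stronglyMeasurable_mk.aestronglyMeasurable
    rw [h3, lintegral_congr_ae (g := fun z => ‖f z‖ₑ)]
    · exact hf.2.ne
    · filter_upwards [hf.1.ae_eq_mk] with z hz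
      rw [hz]
  filter_upwards [Measure.ae_ae_of_ae_bind hκ h1, h2] with ω h3 h4
  have h5 : Integrable (hf.1.mk f) ((N ω).restrict A) :=
    ⟨hf.1.stronglyMeasurable_mk.aestronglyMeasurable, h4⟩
  exact h5.congr (h3.mono fun z hz => hz.symm)

lemma IsPoissonRandomMeasure.aemeasurable_integral_restrict
    (hN : IsPoissonRandomMeasure N lam P) {A : Set E} (hA : MeasurableSet A) (hA' : lam A ≠ ∞)
    {f : E → ℝ} (hf : Integrable f (lam.restrict A)) :
    AEMeasurable (fun ω => ∫ z in A, f z ∂(N ω)) P := by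
  have hκ := hN.measurable_restrict hA
  have h1 : ∀ᵐ z ∂(P.bind (fun ω => (N ω).restrict A)), f z = hf.1.mk f z := by
    rw [hN.bind_restrict hA hA']
    exact hf.1.ae_eq_mk
  have hm := hf.1.stronglyMeasurable_mk.measurable
  refine ⟨fun ω => (∫⁻ z in A, ENNReal.ofReal (hf.1.mk f z) ∂(N ω)).toReal -
    (∫⁻ z in A, ENNReal.ofReal (-hf.1.mk f z) ∂(N ω)).toReal, ?_, ?_⟩
  · exact ((Measure.measurable_lintegral hm.ennreal_ofReal).comp hκ).ennreal_toReal.sub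
      ((Measure.measurable_lintegral hm.neg.ennreal_ofReal).comp hκ).ennreal_toReal
  · filter_upwards [Measure.ae_ae_of_ae_bind hκ.aemeasurable h1,
      hN.ae_integrable_restrict hA hA' hf] with ω h3 h4
    rw [integral_congr_ae h3]
    exact integral_eq_lintegral_pos_part_sub_lintegral_neg_part (h4.congr h3)

lemma IsCompensatedIntegral.of_simpleFunc (hN : IsPoissonRandomMeasure N lam P)
    {G : SimpleFunc E ℝ} (hG : G.FinMeasSupp lam) :
    IsCompensatedIntegral N lam P G (stepIntegral N lam G) :=
  ⟨memLp_stepIntegral hN hG, fun _ => G, fun _ => hG, by simp, by simp⟩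

/-- Over a set of finite intensity, the compensated integral is a difference of two ordinary
integrals: both sides are limits in `L¹(P)` of the integrals of the same step functions. -/
lemma compensatedIntegral_indicator_ae_eq [IsProbabilityMeasure P]
    (hN : IsPoissonRandomMeasure N lam P) {A : Set E} (hA : MeasurableSet A) (hA' : lam A ≠ ∞)
    {g : E → ℝ} (hg : MemLp (A.indicator g) 2 lam) :
    ∀ᵐ ω ∂P, compensatedIntegral N lam P (A.indicator g) ω =
      ∫ z in A, g z ∂(N ω) - ∫ z in A, g z ∂lam := by
  have : IsFiniteMeasure (lam.restrict A) := ⟨by simpa using hA'.lt_top⟩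
  have hgA : MemLp g 2 (lam.restrict A) := (memLp_indicator_iff_restrict hA).1 hg
  have hgi : Integrable g (lam.restrict A) := hgA.integrable one_le_two
  set Y := compensatedIntegral N lam P (A.indicator g) with hYdef
  have hY := isCompensatedIntegral_compensatedIntegral hN hg
  have hYm : AEMeasurable Y P := hY.1.aemeasurable
  have hZm := (hN.aemeasurable_integral_restrict hA hA' hgi).sub_const (∫ z in A, g z ∂lam)
  -- Hölder's inequality on `A` bounds the `L¹` norm by `C` times the `L²` norm.
  set C : ℝ≥0∞ := lam A ^ (1 / (1 : ℝ≥0∞).toReal - 1 / (2 : ℝ≥0∞).toReal) with hC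
  have hCtop : C ≠ ∞ := by
    rw [hC]
    exact ENNReal.rpow_ne_top_of_nonneg (by norm_num) hA'
  have key : ∀ e : ℝ≥0∞, e ≠ 0 → ∫⁻ ω, ‖Y ω - (∫ z in A, g z ∂(N ω) - ∫ z in A, g z ∂lam)‖ₑ ∂P ≤
      e + (e * C + e * C) := by
    intro e he
    obtain ⟨G, hGe, hG⟩ := hgA.exists_simpleFunc_eLpNorm_sub_lt (by simp) he
    set G' := G.restrict A with hG'
    have hG'c : ⇑G' = A.indicator G := SimpleFunc.coe_restrict G hA
    have hG'm : MemLp G' 2 lam := by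
      rw [hG'c]
      exact (memLp_indicator_iff_restrict hA).2 hG
    have hG's : G'.FinMeasSupp lam :=
      (SimpleFunc.memLp_iff_finMeasSupp (by simp) (by simp)).1 hG'm
    have hd1 : eLpNorm (fun z => g z - G z) 1 (lam.restrict A) ≤ e * C := by
      refine (eLpNorm_le_eLpNorm_mul_rpow_measure_univ one_le_two (hgA.sub hG).1).trans ?_
      rw [Measure.restrict_apply_univ]
      exact mul_le_mul_left hGe.le _
    rw [eLpNorm_one_eq_lintegral_enorm] at hd1
    have hstep := (hY.add_smul hN hg hG'm (IsCompensatedIntegral.of_simpleFunc hN hG's)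
      1 (-1)).eLpNorm_le hN ((hg.const_mul 1).add (hG'm.const_mul (-1)))
    have hd2 : eLpNorm (fun z => 1 * A.indicator g z + -1 * G' z) 2 lam ≤ e := by
      have e1 : (fun z => 1 * A.indicator g z + -1 * G' z) = A.indicator (g - ⇑G) := by
        ext z
        rw [hG'c]
        by_cases hz : z ∈ A
        · simp [hz]; ring
        · simp [hz]
      rw [e1, eLpNorm_indicator_eq_eLpNorm_restrict hA]
      exact hGe.le
    have h1 : ∫⁻ ω, ‖Y ω - stepIntegral N lam G' ω‖ₑ ∂P ≤ e := by
      rw [← eLpNorm_one_eq_lintegral_enorm]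
      refine (eLpNorm_le_eLpNorm_of_exponent_le one_le_two
        (hY.1.sub (memLp_stepIntegral hN hG's)).1).trans ?_
      refine le_trans (le_of_eq ?_) (hstep.trans hd2)
      congr 1
      ext ω
      simp only [Pi.sub_apply]
      ring
    have h2 : ∀ᵐ ω ∂P, ‖Y ω - (∫ z in A, g z ∂(N ω) - ∫ z in A, g z ∂lam)‖ₑ ≤
        ‖Y ω - stepIntegral N lam G' ω‖ₑ +
          (∫⁻ z in A, ‖g z - G z‖ₑ ∂(N ω) + ∫⁻ z in A, ‖g z - G z‖ₑ ∂lam) := by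
      filter_upwards [stepIntegral_ae_eq hN hG's, hN.ae_integrable_restrict hA hA' hgi,
        hN.ae_integrable_restrict hA hA' (hG.integrable one_le_two)] with ω h3 h4 h5
      have e1 : ∀ μ : Measure E, ∫ z, G' z ∂μ = ∫ z in A, G z ∂μ := fun μ => by
        rw [hG'c, integral_indicator hA]
      have e2 : Y ω - (∫ z in A, g z ∂(N ω) - ∫ z in A, g z ∂lam) =
          (Y ω - stepIntegral N lam G' ω) + (-(∫ z in A, (g z - G z) ∂(N ω)) +
            ∫ z in A, (g z - G z) ∂lam) := by
        rw [h3.2, e1, e1, integral_sub h4 h5, integral_sub hgi (hG.integrable one_le_two)]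
        ring
      rw [e2]
      refine (enorm_add_le _ _).trans (add_le_add le_rfl ((enorm_add_le _ _).trans ?_))
      rw [enorm_neg]
      exact add_le_add (enorm_integral_le_lintegral_enorm _) (enorm_integral_le_lintegral_enorm _)
    have hms : AEMeasurable (fun ω => ‖Y ω - stepIntegral N lam G' ω‖ₑ) P :=
      (hYm.sub (memLp_stepIntegral hN hG's).aemeasurable).enorm
    have hcamp := hN.lintegral_enorm_restrict hA hA' (hgA.sub hG).1
    simp only [Pi.sub_apply] at hcamp
    refine (lintegral_mono_ae h2).trans ?_
    rw [lintegral_add_left' hms, lintegral_add_right _ measurable_const, hcamp]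
    simp only [lintegral_const, measure_univ, mul_one]
    exact add_le_add h1 (add_le_add hd1 hd1)
  have hzero : ∫⁻ ω, ‖Y ω - (∫ z in A, g z ∂(N ω) - ∫ z in A, g z ∂lam)‖ₑ ∂P = 0 := by
    refine le_antisymm ?_ zero_le
    have hlim : Tendsto (fun n : ℕ => ((n : ℝ≥0∞)⁻¹ + ((n : ℝ≥0∞)⁻¹ * C + (n : ℝ≥0∞)⁻¹ * C)))
        atTop (𝓝 (0 + (0 * C + 0 * C))) := by
      have h1 := ENNReal.tendsto_inv_nat_nhds_zero
      have h2 := ENNReal.Tendsto.mul_const (b := C) h1 (Or.inr hCtop)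
      exact h1.add (h2.add h2)
    simp only [zero_mul, add_zero] at hlim
    exact ge_of_tendsto' hlim fun n => key _ (by simp)
  have hYZ : AEMeasurable
      (fun ω => ‖Y ω - (∫ z in A, g z ∂(N ω) - ∫ z in A, g z ∂lam)‖ₑ) P := (hYm.sub hZm).enorm
  rw [lintegral_eq_zero_iff' hYZ] at hzero
  filter_upwards [hzero] with ω hω
  simpa [sub_eq_zero] using hω

end FiniteIntensity

/-! ### Convergence in distribution and independence via characteristic functions -/

lemma charFun_map_toLp {Ω : Type*} [MeasurableSpace Ω] {P : Measure Ω} {d : ℕ}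
    {X : Ω → Fin d → ℝ} (hX : AEMeasurable X P) (t : EuclideanSpace ℝ (Fin d)) :
    charFun (P.map (fun ω => WithLp.toLp 2 (X ω))) t =
      ∫ ω, Complex.exp ((∑ j, t j * X ω j : ℝ) * Complex.I) ∂P := by
  have hX' : AEMeasurable (fun ω => WithLp.toLp 2 (X ω)) P := by fun_prop
  rw [charFun_apply, integral_map hX' (by fun_prop)]
  simp [PiLp.inner_apply]

/-- Lévy's continuity theorem for random vectors. -/
lemma tendstoInDistribution_of_tendsto_integral_cexp {ι Ω Ω' : Type*} [MeasurableSpace Ω]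
    [MeasurableSpace Ω'] {P : Measure Ω} [IsProbabilityMeasure P] {P' : Measure Ω'}
    [IsProbabilityMeasure P'] {d : ℕ} {l : Filter ι} [l.IsCountablyGenerated]
    {X : ι → Ω → Fin d → ℝ} {Z : Ω' → Fin d → ℝ} (hX : ∀ i, AEMeasurable (X i) P)
    (hZ : AEMeasurable Z P')
    (h : ∀ a : Fin d → ℝ, Tendsto
      (fun i => ∫ ω, Complex.exp ((∑ j, a j * X i ω j : ℝ) * Complex.I) ∂P) l
      (𝓝 (∫ ω, Complex.exp ((∑ j, a j * Z ω j : ℝ) * Complex.I) ∂P'))) :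
    TendstoInDistribution X l Z (fun _ => P) P' := by
  have hX' : ∀ i, AEMeasurable (fun ω => WithLp.toLp 2 (X i ω)) P := fun i => by
    have := hX i
    fun_prop
  have hZ' : AEMeasurable (fun ω => WithLp.toLp 2 (Z ω)) P' := by fun_prop
  have main : TendstoInDistribution (fun i ω => WithLp.toLp 2 (X i ω)) l
      (fun ω => WithLp.toLp 2 (Z ω)) (fun _ => P) P' := by
    refine ⟨hX', hZ', tendsto_of_seq_tendsto fun x hx => ?_⟩
    refine ProbabilityMeasure.tendsto_of_tendsto_charFun fun t => ?_
    have := (h t).comp hx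
    refine (this.congr fun n => ?_).trans (le_of_eq ?_)
    · exact (charFun_map_toLp (hX (x n)) t).symm
    · exact congrArg 𝓝 (charFun_map_toLp hZ t).symm
  exact main.continuous_comp (PiLp.continuous_ofLp 2 _)

/-- Kac's theorem: random vectors are independent if their joint characteristic function factors. -/
lemma indepFun_of_integral_cexp_add {Ω : Type*} [MeasurableSpace Ω] {P : Measure Ω}
    [IsProbabilityMeasure P] {d : ℕ} {X Y : Ω → Fin d → ℝ} (hX : AEMeasurable X P)
    (hY : AEMeasurable Y P)
    (h : ∀ a b : Fin d → ℝ,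
      ∫ ω, Complex.exp ((∑ j, a j * X ω j + ∑ j, b j * Y ω j : ℝ) * Complex.I) ∂P =
        (∫ ω, Complex.exp ((∑ j, a j * X ω j : ℝ) * Complex.I) ∂P) *
          ∫ ω, Complex.exp ((∑ j, b j * Y ω j : ℝ) * Complex.I) ∂P) :
    IndepFun X Y P := by
  rw [indepFun_iff_charFunDual_prod hX hY]
  intro L
  rw [charFunDual_apply, charFunDual_apply, charFunDual_apply,
    integral_map (hX.prodMk hY) (by fun_prop), integral_map hX (by fun_prop),
    integral_map hY (by fun_prop)]
  have h1 : ∀ x : Fin d → ℝ, (L.comp (.inl ℝ (Fin d → ℝ) (Fin d → ℝ))) x =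
      ∑ j, L.comp (.inl ℝ (Fin d → ℝ) (Fin d → ℝ)) (fun k => if j = k then 1 else 0) * x j := by
    intro x
    have := LinearMap.pi_apply_eq_sum_univ
      (L.comp (.inl ℝ (Fin d → ℝ) (Fin d → ℝ))).toLinearMap x
    simpa [mul_comm] using this
  have h2 : ∀ x : Fin d → ℝ, (L.comp (.inr ℝ (Fin d → ℝ) (Fin d → ℝ))) x =
      ∑ j, L.comp (.inr ℝ (Fin d → ℝ) (Fin d → ℝ)) (fun k => if j = k then 1 else 0) * x j := by
    intro x
    have := LinearMap.pi_apply_eq_sum_univ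
      (L.comp (.inr ℝ (Fin d → ℝ) (Fin d → ℝ))).toLinearMap x
    simpa [mul_comm] using this
  have h3 : ∀ x y : Fin d → ℝ, L (x, y) = (L.comp (.inl ℝ (Fin d → ℝ) (Fin d → ℝ))) x +
      (L.comp (.inr ℝ (Fin d → ℝ) (Fin d → ℝ))) y := by
    intro x y
    rw [ContinuousLinearMap.comp_apply, ContinuousLinearMap.comp_apply, ← map_add]
    simp
  have h4 := h
    (fun j => L.comp (.inl ℝ (Fin d → ℝ) (Fin d → ℝ)) (fun k => if j = k then 1 else 0))
    (fun j => L.comp (.inr ℝ (Fin d → ℝ) (Fin d → ℝ)) (fun k => if j = k then 1 else 0))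
  simp_rw [← h1, ← h2, ← h3] at h4
  exact h4

/-! ### Isonormal Gaussian processes -/

section Gaussian

lemma integral_sq_sum {α : Type*} [MeasurableSpace α] {μ : Measure α} {d : ℕ}
    {X : Fin d → α → ℝ} (hX : ∀ j, MemLp (X j) 2 μ) :
    ∫ x, (∑ j, X j x) ^ 2 ∂μ = ∑ j, ∑ k, ∫ x, X j x * X k x ∂μ := by
  have hi : ∀ j k, Integrable (fun x => X j x * X k x) μ := fun j k => (hX j).integrable_mul (hX k)
  simp_rw [sq, Finset.sum_mul_sum]
  rw [integral_finsetSum _ fun j _ => integrable_finsetSum _ fun k _ => hi j k]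
  exact Finset.sum_congr rfl fun j _ => integral_finsetSum _ fun k _ => hi j k

variable {Ω : Type*} [MeasurableSpace Ω] {W : Lp ℝ 2 timeMeasure → Ω → ℝ} {P : Measure Ω}

lemma IsIsonormal.memLp (hW : IsIsonormal W P) (f : Lp ℝ 2 timeMeasure) : MemLp (W f) 2 P :=
  (hW.gaussian.hasGaussianLaw_eval f).memLp_two

lemma integral_toL2_mul_toL2 {f g : ℝ → ℝ} (hf : MemLp f 2 timeMeasure)
    (hg : MemLp g 2 timeMeasure) :
    ∫ s, toL2 f s * toL2 g s ∂timeMeasure = ∫ s, f s * g s ∂timeMeasure := by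
  rw [toL2, toL2, dif_pos hf, dif_pos hg]
  refine integral_congr_ae ?_
  filter_upwards [hf.coeFn_toLp, hg.coeFn_toLp] with s h1 h2
  rw [h1, h2]

lemma IsIsonormal.integral_cexp (hW : IsIsonormal W P) {d : ℕ} {f : Fin d → ℝ → ℝ}
    (hf : ∀ j, MemLp (f j) 2 timeMeasure) (a : Fin d → ℝ) :
    ∫ ω, Complex.exp ((∑ j, a j * W (toL2 (f j)) ω : ℝ) * Complex.I) ∂P =
      Complex.exp (-((∫ s, (∑ j, a j * f j s) ^ 2 ∂timeMeasure : ℝ) : ℂ) / 2) := by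
  have hm : ∀ j, MemLp (fun ω => a j * W (toL2 (f j)) ω) 2 P := fun j =>
    (hW.memLp (toL2 (f j))).const_mul (a j)
  have hG : HasGaussianLaw (fun ω => ∑ j, a j * W (toL2 (f j)) ω) P := by
    have h1 := (hW.gaussian.comp_right (fun j : Fin d => toL2 (f j))).smul a
    simpa using h1.hasGaussianLaw_fun_sum (I := Finset.univ)
  have hmean : ∫ ω, ∑ j, a j * W (toL2 (f j)) ω ∂P = 0 := by
    have := hW.gaussian.isProbabilityMeasure
    rw [integral_finsetSum _ fun j _ => (hm j).integrable one_le_two]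
    refine Finset.sum_eq_zero fun j _ => ?_
    rw [integral_const_mul, hW.mean_zero, mul_zero]
  have hvar : Var[fun ω => ∑ j, a j * W (toL2 (f j)) ω; P] =
      ∫ s, (∑ j, a j * f j s) ^ 2 ∂timeMeasure := by
    rw [variance_of_integral_eq_zero hG.aemeasurable hmean]
    rw [integral_sq_sum hm, integral_sq_sum fun j => (hf j).const_mul (a j)]
    refine Finset.sum_congr rfl fun j _ => ?_
    refine Finset.sum_congr rfl fun k _ => ?_
    have e1 : ∀ ω, a j * W (toL2 (f j)) ω * (a k * W (toL2 (f k)) ω) =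
      (a j * a k) * (W (toL2 (f j)) ω * W (toL2 (f k)) ω) := fun ω => by ring
    have e2 : ∀ s, a j * f j s * (a k * f k s) = (a j * a k) * (f j s * f k s) :=
      fun s => by ring
    simp_rw [e1, e2]
    rw [integral_const_mul, integral_const_mul, hW.cov, integral_toL2_mul_toL2 (hf j) (hf k)]
  have hch := charFun_gaussianReal (μ := ∫ ω, ∑ j, a j * W (toL2 (f j)) ω ∂P)
    (v := Var[fun ω => ∑ j, a j * W (toL2 (f j)) ω; P].toNNReal) 1
  rw [← hG.map_eq_gaussianReal, charFun_apply, integral_map hG.aemeasurable (by fun_prop),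
    hmean, Real.coe_toNNReal _ (variance_nonneg _ _), hvar] at hch
  simp only [Real.inner_apply, mul_one] at hch
  rw [hch]
  congr 1
  simp
  ring

end Gaussian

/-! ### Product kernels under the jump intensity -/

section Jumps

instance : SigmaFinite timeMeasure := by
  unfold timeMeasure
  infer_instance

lemma IsSquareIntegrableLevyMeasure.memLp_id {ν : Measure ℝ}
    (hν : IsSquareIntegrableLevyMeasure ν) : MemLp (fun x : ℝ => x) 2 ν :=
  (memLp_two_iff_integrable_sq (by fun_prop)).2 hν.integrable_sq

lemma IsSquareIntegrableLevyMeasure.measure_le_abs_lt_top {ν : Measure ℝ}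
    (hν : IsSquareIntegrableLevyMeasure ν) {ε : ℝ} (hε : 0 < ε) : ν {x : ℝ | ε ≤ |x|} < ∞ := by
  have h := hν.integrable_sq.measure_norm_ge_lt_top (ε := ε ^ 2) (by positivity)
  refine lt_of_le_of_lt (measure_mono fun x hx => ?_) h
  simp only [mem_ofPred_eq, Real.norm_eq_abs, abs_sq] at hx ⊢
  rw [← sq_abs x]
  gcongr

lemma IsSquareIntegrableLevyMeasure.sigmaFinite {ν : Measure ℝ}
    (hν : IsSquareIntegrableLevyMeasure ν) : SigmaFinite ν := by
  refine ⟨⟨⟨fun n : ℕ => {x : ℝ | 1 / ((n : ℝ) + 1) ≤ |x|} ∪ {0}, fun n => trivial,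
    fun n => ?_, ?_⟩⟩⟩
  · refine (measure_union_le _ _).trans_lt ?_
    rw [hν.zero, add_zero]
    exact hν.measure_le_abs_lt_top (by positivity)
  · refine eq_univ_of_forall fun x => ?_
    rcases eq_or_ne x 0 with rfl | hx
    · exact mem_iUnion.2 ⟨0, Or.inr rfl⟩
    · obtain ⟨n, hn⟩ := exists_nat_one_div_lt (abs_pos.2 hx)
      exact mem_iUnion.2 ⟨n, Or.inl hn.le⟩

variable {ν : Measure ℝ}

lemma memLp_jump_mul [SigmaFinite ν] {k ρ : ℝ → ℝ} (hk : MemLp k 2 timeMeasure)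
    (hρ : MemLp ρ 2 ν) : MemLp (fun z : ℝ × ℝ => k z.1 * ρ z.2) 2 (jumpIntensity ν) := by
  have hm : AEStronglyMeasurable (fun z : ℝ × ℝ => k z.1 * ρ z.2) (jumpIntensity ν) :=
    hk.1.comp_fst.mul hρ.1.comp_snd
  rw [memLp_two_iff_integrable_sq hm]
  simp_rw [mul_pow]
  exact ((memLp_two_iff_integrable_sq hk.1).1 hk).mul_prod
    ((memLp_two_iff_integrable_sq hρ.1).1 hρ)

/-- Replacing the characteristic exponent by its Gaussian part costs little when the jumps are
small compared with their standard deviation. -/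
lemma norm_integral_compensatedExponent_add_le [SigmaFinite ν] {k ρ : ℝ → ℝ}
    (hk : MemLp k 2 timeMeasure) (hρ : MemLp ρ 2 ν) (hρ1 : ∫ x, ρ x ^ 2 ∂ν = 1) {r : ℝ}
    (hr : ∀ x, |ρ x| ≤ r) :
    ‖∫ z, compensatedExponent (k z.1 * ρ z.2) ∂(jumpIntensity ν) -
        (-((∫ s, k s ^ 2 ∂timeMeasure : ℝ) : ℂ) / 2)‖ ≤
      4 * ∫ s, k s ^ 2 * min 1 (r * |k s|) ∂timeMeasure := by
  have hr0 : 0 ≤ r := (abs_nonneg _).trans (hr 0)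
  have hu := memLp_jump_mul hk hρ
  have hk2 := (memLp_two_iff_integrable_sq hk.1).1 hk
  have hρ2 := (memLp_two_iff_integrable_sq hρ.1).1 hρ
  have h1 : ∫ z, (k z.1 * ρ z.2) ^ 2 ∂(jumpIntensity ν) = ∫ s, k s ^ 2 ∂timeMeasure := by
    simp_rw [mul_pow]
    rw [jumpIntensity, integral_prod_mul (fun s => k s ^ 2) (fun x => ρ x ^ 2), hρ1, mul_one]
  have h2 : ∫ z, compensatedExponent (k z.1 * ρ z.2) ∂(jumpIntensity ν) -
        (-((∫ s, k s ^ 2 ∂timeMeasure : ℝ) : ℂ) / 2) =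
      ∫ z, (compensatedExponent (k z.1 * ρ z.2) + ((k z.1 * ρ z.2 : ℝ) : ℂ) ^ 2 / 2)
        ∂(jumpIntensity ν) := by
    have hi : Integrable (fun z : ℝ × ℝ => ((k z.1 * ρ z.2 : ℝ) : ℂ) ^ 2 / 2)
        (jumpIntensity ν) := by
      have := ((memLp_two_iff_integrable_sq hu.1).1 hu).ofReal (𝕜 := ℂ)
      simpa using this.div_const 2
    have h3 : ∫ z, ((k z.1 * ρ z.2 : ℝ) : ℂ) ^ 2 ∂(jumpIntensity ν) =
        ((∫ z, (k z.1 * ρ z.2) ^ 2 ∂(jumpIntensity ν) : ℝ) : ℂ) := by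
      rw [← integral_complex_ofReal]
      simp
    rw [integral_add (integrable_compensatedExponent hu) hi, ← h1, integral_div, h3]
    ring
  have hmeas : AEStronglyMeasurable (fun s => k s ^ 2 * min 1 (r * |k s|)) timeMeasure := by
    have := hk.1.aemeasurable
    exact AEMeasurable.aestronglyMeasurable (by fun_prop)
  have hb : Integrable (fun s => 4 * (k s ^ 2 * min 1 (r * |k s|))) timeMeasure := by
    refine Integrable.const_mul (hk2.mono' hmeas (ae_of_all _ fun s => ?_)) 4
    rw [Real.norm_eq_abs, abs_mul, abs_sq, abs_of_nonneg (by positivity)]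
    exact mul_le_of_le_one_right (sq_nonneg _) (min_le_left _ _)
  rw [h2]
  have h3 : ∫ z, 4 * (k z.1 ^ 2 * min 1 (r * |k z.1|)) * ρ z.2 ^ 2 ∂(jumpIntensity ν) =
      4 * ∫ s, k s ^ 2 * min 1 (r * |k s|) ∂timeMeasure := by
    rw [jumpIntensity, integral_prod_mul (fun s => 4 * (k s ^ 2 * min 1 (r * |k s|)))
      (fun x => ρ x ^ 2), hρ1, mul_one, integral_const_mul]
  rw [← h3]
  refine norm_integral_le_of_norm_le (hb.mul_prod hρ2) (ae_of_all _ fun z => ?_)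
  refine (norm_compensatedExponent_add_le _).trans ?_
  rw [mul_assoc]
  refine mul_le_mul_of_nonneg_left ?_ (by norm_num)
  rcases min_cases 1 (r * |k z.1|) with h | h
  · rw [h.1]
    exact (min_le_left _ _).trans (le_of_eq (by ring))
  · rw [h.1]
    refine (min_le_right _ _).trans ?_
    rw [abs_mul, mul_pow, ← sq_abs (k z.1), ← sq_abs (ρ z.2)]
    have := mul_le_mul_of_nonneg_left (hr z.2)
      (show 0 ≤ |k z.1| ^ 3 * |ρ z.2| ^ 2 by positivity)
    nlinarith [this]

lemma tendsto_integral_sq_mul_min {ι : Type*} {l : Filter ι} [l.IsCountablyGenerated] {r : ι → ℝ}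
    (hr : Tendsto r l (𝓝 0)) (hr0 : ∀ᶠ i in l, 0 ≤ r i) {k : ℝ → ℝ}
    (hk : MemLp k 2 timeMeasure) :
    Tendsto (fun i => ∫ s, k s ^ 2 * min 1 (r i * |k s|) ∂timeMeasure) l (𝓝 0) := by
  have hk2 := (memLp_two_iff_integrable_sq hk.1).1 hk
  have h := tendsto_integral_filter_of_dominated_convergence (μ := timeMeasure) (l := l)
    (F := fun i s => k s ^ 2 * min 1 (r i * |k s|)) (f := fun _ => (0 : ℝ)) (fun s => k s ^ 2)
    (Eventually.of_forall fun i => by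
      have := hk.1.aemeasurable
      exact AEMeasurable.aestronglyMeasurable (by fun_prop)) ?_ hk2 ?_
  · simpa using h
  · filter_upwards [hr0] with i hi
    refine ae_of_all _ fun s => ?_
    rw [Real.norm_eq_abs, abs_mul, abs_sq, abs_of_nonneg (by positivity)]
    exact mul_le_of_le_one_right (sq_nonneg _) (min_le_left _ _)
  · refine ae_of_all _ fun s => ?_
    have h1 : Tendsto (fun i => k s ^ 2 * min 1 (r i * |k s|)) l
        (𝓝 (k s ^ 2 * min 1 (0 * |k s|))) :=
      (tendsto_const_nhds.min (hr.mul_const _)).const_mul _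
    simpa using h1

/-! ### Small and large jumps -/

/-- The jump sizes of modulus at most `ε`, the other ones being replaced by `0`. -/
noncomputable def smallJumpSize (ε : ℝ) : ℝ → ℝ := {x : ℝ | |x| ≤ ε}.indicator fun x => x

/-- The jump sizes of modulus larger than `ε`, the other ones being replaced by `0`. -/
noncomputable def largeJumpSize (ε : ℝ) : ℝ → ℝ := {x : ℝ | ε < |x|}.indicator fun x => x

lemma measurableSet_abs_le (ε : ℝ) : MeasurableSet {x : ℝ | |x| ≤ ε} :=
  measurableSet_le (by fun_prop) (by fun_prop)

lemma measurableSet_lt_abs (ε : ℝ) : MeasurableSet {x : ℝ | ε < |x|} :=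
  measurableSet_lt (by fun_prop) (by fun_prop)

lemma smallJumpSize_zero (ε : ℝ) : smallJumpSize ε 0 = 0 := by
  simp [smallJumpSize, indicator]

lemma largeJumpSize_zero (ε : ℝ) : largeJumpSize ε 0 = 0 := by
  simp [largeJumpSize, indicator]

lemma largeJumpSize_add_smallJumpSize (ε x : ℝ) : largeJumpSize ε x + smallJumpSize ε x = x := by
  unfold largeJumpSize smallJumpSize
  by_cases h : |x| ≤ ε
  · simp [h, not_lt.2 h]
  · simp [h, not_le.1 h]

lemma memLp_smallJumpSize (hν : IsSquareIntegrableLevyMeasure ν) (ε : ℝ) :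
    MemLp (smallJumpSize ε) 2 ν :=
  hν.memLp_id.indicator (measurableSet_abs_le ε)

lemma memLp_largeJumpSize (hν : IsSquareIntegrableLevyMeasure ν) (ε : ℝ) :
    MemLp (largeJumpSize ε) 2 ν :=
  hν.memLp_id.indicator (measurableSet_lt_abs ε)

lemma integral_smallJumpSize_sq (ν : Measure ℝ) (ε : ℝ) :
    ∫ x, smallJumpSize ε x ^ 2 ∂ν = smallJumpStd ν ε ^ 2 := by
  rw [smallJumpStd, Real.sq_sqrt (integral_nonneg fun x => sq_nonneg x),
    ← integral_indicator (measurableSet_abs_le ε)]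
  refine integral_congr_ae (ae_of_all _ fun x => ?_)
  by_cases h : |x| ≤ ε <;> simp [smallJumpSize, h]

lemma smallJumpStd_nonneg (ν : Measure ℝ) (ε : ℝ) : 0 ≤ smallJumpStd ν ε := Real.sqrt_nonneg _

lemma smallJumpStd_mono (hν : IsSquareIntegrableLevyMeasure ν) {ε δ : ℝ} (h : ε ≤ δ) :
    smallJumpStd ν ε ≤ smallJumpStd ν δ := by
  refine Real.sqrt_le_sqrt (setIntegral_mono_set hν.integrable_sq.integrableOn
    (ae_of_all _ fun x => sq_nonneg x) ?_)
  exact LE.le.eventuallyLE fun x (hx : |x| ≤ ε) => hx.trans h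

lemma smallJumpStd_pos (hν : IsSquareIntegrableLevyMeasure ν)
    (hσ : Tendsto (fun ε : ℝ => smallJumpStd ν ε / ε) (𝓝[>] 0) atTop) {ε : ℝ} (hε : 0 < ε) :
    0 < smallJumpStd ν ε := by
  have h1 := hσ.eventually_gt_atTop 0
  have h2 : ∀ᶠ δ in 𝓝[>] (0 : ℝ), δ ∈ Ioo 0 ε := Ioo_mem_nhdsGT hε
  obtain ⟨δ, h3, h4⟩ := (h1.and h2).exists
  refine lt_of_lt_of_le ?_ (smallJumpStd_mono hν h4.2.le)
  exact (div_pos_iff_of_pos_right h4.1).1 h3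

lemma tendsto_smallJumpStd (hν : IsSquareIntegrableLevyMeasure ν) :
    Tendsto (smallJumpStd ν) (𝓝[>] 0) (𝓝 0) := by
  have h := tendsto_integral_filter_of_dominated_convergence (μ := ν) (l := 𝓝[>] (0 : ℝ))
    (F := fun ε x => smallJumpSize ε x ^ 2) (f := fun _ => (0 : ℝ)) (fun x => x ^ 2)
    (Eventually.of_forall fun ε => ((memLp_smallJumpSize hν ε).1.pow 2))
    (Eventually.of_forall fun ε => ae_of_all _ fun x => ?_) hν.integrable_sq
    (ae_of_all _ fun x => ?_)
  · simp_rw [integral_smallJumpSize_sq, integral_zero] at h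
    have h2 := (Real.continuous_sqrt.tendsto _).comp h
    simpa [Function.comp_def, Real.sqrt_sq (smallJumpStd_nonneg ν _)] using h2
  · by_cases h : |x| ≤ ε <;> simp [smallJumpSize, h, sq_nonneg]
  · rcases eq_or_ne x 0 with rfl | hx
    · simp [smallJumpSize_zero]
    · refine tendsto_const_nhds.congr' ?_
      have h2 : ∀ᶠ δ in 𝓝[>] (0 : ℝ), δ ∈ Ioo 0 |x| := Ioo_mem_nhdsGT (abs_pos.2 hx)
      filter_upwards [h2] with δ hδ
      simp [smallJumpSize, not_le.2 hδ.2]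

/-- The central limit theorem for the characteristic exponents of the normalized small jumps. -/
lemma tendsto_integral_compensatedExponent_small (hν : IsSquareIntegrableLevyMeasure ν)
    (hσ : Tendsto (fun ε : ℝ => smallJumpStd ν ε / ε) (𝓝[>] 0) atTop) {k : ℝ → ℝ}
    (hk : MemLp k 2 timeMeasure) :
    Tendsto (fun ε => ∫ z, compensatedExponent
      (k z.1 * ((smallJumpStd ν ε)⁻¹ * smallJumpSize ε z.2)) ∂(jumpIntensity ν)) (𝓝[>] 0)
      (𝓝 (-((∫ s, k s ^ 2 ∂timeMeasure : ℝ) : ℂ) / 2)) := by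
  have := hν.sigmaFinite
  have hr : Tendsto (fun ε => ε / smallJumpStd ν ε) (𝓝[>] 0) (𝓝 0) := by
    have := hσ.inv_tendsto_atTop
    refine this.congr fun ε => ?_
    simp
  have hpos : ∀ᶠ ε in 𝓝[>] (0 : ℝ), 0 < ε := eventually_mem_nhdsWithin
  rw [tendsto_iff_norm_sub_tendsto_zero]
  have h1 := (tendsto_integral_sq_mul_min hr (hpos.mono fun ε hε =>
    div_nonneg hε.le (smallJumpStd_nonneg ν ε)) hk).const_mul 4
  rw [mul_zero] at h1
  refine tendsto_of_tendsto_of_tendsto_of_le_of_le' tendsto_const_nhds h1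
    (Eventually.of_forall fun ε => norm_nonneg _) ?_
  filter_upwards [hpos] with ε hε
  have hs := smallJumpStd_pos hν hσ hε
  refine norm_integral_compensatedExponent_add_le hk
    ((memLp_smallJumpSize hν ε).const_mul _) ?_ fun x => ?_
  · simp_rw [mul_pow]
    rw [integral_const_mul, integral_smallJumpSize_sq]
    field_simp
  · rw [abs_mul, abs_inv, abs_of_pos hs, inv_mul_eq_div]
    gcongr
    by_cases h : |x| ≤ ε
    · simp [smallJumpSize, h]
    · simp [smallJumpSize, h, hε.le]

lemma tendsto_integral_compensatedExponent_large (hν : IsSquareIntegrableLevyMeasure ν)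
    {k : ℝ → ℝ} (hk : MemLp k 2 timeMeasure) :
    Tendsto (fun ε => ∫ z, compensatedExponent (k z.1 * largeJumpSize ε z.2) ∂(jumpIntensity ν))
      (𝓝[>] 0) (𝓝 (∫ z, compensatedExponent (k z.1 * z.2) ∂(jumpIntensity ν))) := by
  have := hν.sigmaFinite
  have hu := memLp_jump_mul hk hν.memLp_id
  refine tendsto_integral_filter_of_dominated_convergence (fun z => 3 * (k z.1 * z.2) ^ 2)
    (Eventually.of_forall fun ε =>
      (integrable_compensatedExponent (memLp_jump_mul hk (memLp_largeJumpSize hν ε))).1)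
    (Eventually.of_forall fun ε => ae_of_all _ fun z => ?_)
    (((memLp_two_iff_integrable_sq hu.1).1 hu).const_mul 3) (ae_of_all _ fun z => ?_)
  · refine (norm_compensatedExponent_le _).trans ?_
    by_cases h : ε < |z.2|
    · simp [largeJumpSize, h]
    · simp only [largeJumpSize, mem_ofPred_eq, h, not_false_eq_true, indicator_of_notMem, mul_zero]
      nlinarith [sq_nonneg (k z.1 * z.2)]
  · rcases eq_or_ne z.2 0 with hz | hz
    · simp [largeJumpSize_zero, hz]
    · refine tendsto_const_nhds.congr' ?_
      have h2 : ∀ᶠ δ in 𝓝[>] (0 : ℝ), δ ∈ Ioo 0 |z.2| := Ioo_mem_nhdsGT (abs_pos.2 hz)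
      filter_upwards [h2] with δ hδ
      simp [largeJumpSize, hδ.2]

end Jumps

/-! ### Finite-dimensional distributions of the small and the large jumps -/

section FiniteDimensional

variable {Ω Ω' : Type*} [MeasurableSpace Ω] [MeasurableSpace Ω'] {P : Measure Ω}
  {P' : Measure Ω'} {ν : Measure ℝ} {N : Ω → Measure (ℝ × ℝ)}
  {W : Lp ℝ 2 timeMeasure → Ω' → ℝ} {h : ℝ≥0 → ℝ → ℝ}

/-- The kernel `h_t 1_{[0,t]}`. -/
noncomputable def truncatedKernel (h : ℝ≥0 → ℝ → ℝ) (t : ℝ≥0) : ℝ → ℝ :=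
  (Icc 0 (t : ℝ)).indicator (h t)

lemma chaosProcess_eq (t : ℝ≥0) : chaosProcess N ν P h t =
    compensatedIntegral N (jumpIntensity ν) P (fun z => truncatedKernel h t z.1 * z.2) := by
  unfold chaosProcess poissonI1 truncatedKernel
  congr 1
  ext z
  by_cases hz : z.1 ∈ Icc 0 (t : ℝ) <;> simp [indicator, mem_prod, hz]

lemma smallJumpPart_eq (ε : ℝ) (t : ℝ≥0) : smallJumpPart N ν P h ε t =
    fun ω => (smallJumpStd ν ε)⁻¹ * compensatedIntegral N (jumpIntensity ν) P
      (fun z => truncatedKernel h t z.1 * smallJumpSize ε z.2) ω := by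
  unfold smallJumpPart poissonI1 truncatedKernel smallJumpSize
  ext ω
  congr 3
  ext z
  by_cases hz : z.1 ∈ Icc 0 (t : ℝ) <;> by_cases hx : |z.2| ≤ ε <;>
    simp [indicator, mem_prod, hz, hx]

lemma largeJumpPart_eq (ε : ℝ) (t : ℝ≥0) : largeJumpPart N ν P h ε t =
    compensatedIntegral N (jumpIntensity ν) P
      (fun z => truncatedKernel h t z.1 * largeJumpSize ε z.2) := by
  unfold largeJumpPart poissonI1 truncatedKernel largeJumpSize
  congr 1
  ext z
  by_cases hz : z.1 ∈ Icc 0 (t : ℝ) <;> by_cases hx : ε < |z.2| <;>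
    simp [indicator, mem_prod, hz, hx]

lemma aemeasurable_chaosProcess (t : ℝ≥0) : AEMeasurable (chaosProcess N ν P h t) P :=
  (memLp_compensatedIntegral _).aemeasurable

lemma aemeasurable_smallJumpPart (ε : ℝ) (t : ℝ≥0) :
    AEMeasurable (smallJumpPart N ν P h ε t) P :=
  (memLp_compensatedIntegral _).aemeasurable.const_mul _

lemma aemeasurable_largeJumpPart (ε : ℝ) (t : ℝ≥0) :
    AEMeasurable (largeJumpPart N ν P h ε t) P :=
  (memLp_compensatedIntegral _).aemeasurable

lemma IsIsonormal.aemeasurable_gaussianPart (hW : IsIsonormal W P') (t : ℝ≥0) :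
    AEMeasurable (gaussianPart W h t) P' :=
  (hW.memLp _).aemeasurable

variable [IsProbabilityMeasure P] [IsProbabilityMeasure P']

lemma integral_cexp_sum_compensatedIntegral (hN : IsPoissonRandomMeasure N (jumpIntensity ν) P)
    {d : ℕ} {g : Fin d → ℝ × ℝ → ℝ} (hg : ∀ j, MemLp (g j) 2 (jumpIntensity ν))
    (a : Fin d → ℝ) :
    ∫ ω, Complex.exp
        ((∑ j, a j * compensatedIntegral N (jumpIntensity ν) P (g j) ω : ℝ) * Complex.I) ∂P =
      Complex.exp (∫ z, compensatedExponent (∑ j, a j * g j z) ∂(jumpIntensity ν)) := by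
  rw [← integral_cexp_compensatedIntegral hN
    (memLp_finsetSum Finset.univ fun j _ => (hg j).const_mul (a j))]
  refine integral_congr_ae ?_
  filter_upwards [compensatedIntegral_sum hN Finset.univ hg a] with ω hω
  rw [hω]

lemma memLp_sum_truncatedKernel {d : ℕ} {t : Fin d → ℝ≥0}
    (hk : ∀ j, MemLp (truncatedKernel h (t j)) 2 timeMeasure) (a : Fin d → ℝ) :
    MemLp (fun s => ∑ j, a j * truncatedKernel h (t j) s) 2 timeMeasure :=
  memLp_finsetSum Finset.univ fun j _ => (hk j).const_mul (a j)

lemma integral_cexp_sum_smallJumpPart (hν : IsSquareIntegrableLevyMeasure ν)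
    (hN : IsPoissonRandomMeasure N (jumpIntensity ν) P) {d : ℕ} {t : Fin d → ℝ≥0}
    (hk : ∀ j, MemLp (truncatedKernel h (t j)) 2 timeMeasure) (a : Fin d → ℝ) (ε : ℝ) :
    ∫ ω, Complex.exp ((∑ j, a j * smallJumpPart N ν P h ε (t j) ω : ℝ) * Complex.I) ∂P =
      Complex.exp (∫ z, compensatedExponent ((∑ j, a j * truncatedKernel h (t j) z.1) *
        ((smallJumpStd ν ε)⁻¹ * smallJumpSize ε z.2)) ∂(jumpIntensity ν)) := by
  have := hν.sigmaFinite
  have h1 := integral_cexp_sum_compensatedIntegral hN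
    (fun j => memLp_jump_mul (hk j) (memLp_smallJumpSize hν ε))
    (fun j => a j * (smallJumpStd ν ε)⁻¹)
  simp_rw [smallJumpPart_eq, ← mul_assoc]
  rw [h1]
  congr 2
  ext z
  simp_rw [Finset.sum_mul]
  exact congrArg _ (Finset.sum_congr rfl fun j _ => by ring)

lemma integral_cexp_sum_largeJumpPart (hν : IsSquareIntegrableLevyMeasure ν)
    (hN : IsPoissonRandomMeasure N (jumpIntensity ν) P) {d : ℕ} {t : Fin d → ℝ≥0}
    (hk : ∀ j, MemLp (truncatedKernel h (t j)) 2 timeMeasure) (a : Fin d → ℝ) (ε : ℝ) :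
    ∫ ω, Complex.exp ((∑ j, a j * largeJumpPart N ν P h ε (t j) ω : ℝ) * Complex.I) ∂P =
      Complex.exp (∫ z, compensatedExponent ((∑ j, a j * truncatedKernel h (t j) z.1) *
        largeJumpSize ε z.2) ∂(jumpIntensity ν)) := by
  have := hν.sigmaFinite
  have h1 := integral_cexp_sum_compensatedIntegral hN
    (fun j => memLp_jump_mul (hk j) (memLp_largeJumpSize hν ε)) a
  simp_rw [largeJumpPart_eq]
  rw [h1]
  congr 2
  ext z
  simp_rw [Finset.sum_mul]
  exact congrArg _ (Finset.sum_congr rfl fun j _ => by ring)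

lemma integral_cexp_sum_chaosProcess (hν : IsSquareIntegrableLevyMeasure ν)
    (hN : IsPoissonRandomMeasure N (jumpIntensity ν) P) {d : ℕ} {t : Fin d → ℝ≥0}
    (hk : ∀ j, MemLp (truncatedKernel h (t j)) 2 timeMeasure) (a : Fin d → ℝ) :
    ∫ ω, Complex.exp ((∑ j, a j * chaosProcess N ν P h (t j) ω : ℝ) * Complex.I) ∂P =
      Complex.exp (∫ z, compensatedExponent ((∑ j, a j * truncatedKernel h (t j) z.1) * z.2)
        ∂(jumpIntensity ν)) := by
  have := hν.sigmaFinite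
  have h1 := integral_cexp_sum_compensatedIntegral hN
    (fun j => memLp_jump_mul (hk j) hν.memLp_id) a
  simp_rw [chaosProcess_eq]
  rw [h1]
  congr 2
  ext z
  simp_rw [Finset.sum_mul]
  exact congrArg _ (Finset.sum_congr rfl fun j _ => by ring)

/-- Convergence of the normalized small jumps for square integrable kernels. -/
lemma tendstoFDD_smallJumpPart (hν : IsSquareIntegrableLevyMeasure ν)
    (hN : IsPoissonRandomMeasure N (jumpIntensity ν) P) (hW : IsIsonormal W P')
    (hσ : Tendsto (fun ε : ℝ => smallJumpStd ν ε / ε) (𝓝[>] 0) atTop) {S : Set ℝ≥0}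
    (hk : ∀ t ∈ S, MemLp (truncatedKernel h t) 2 timeMeasure) :
    TendstoFDD (smallJumpPart N ν P h) (𝓝[>] 0) (gaussianPart W h) S P P' := by
  intro d t ht
  have hkt : ∀ j, MemLp (truncatedKernel h (t j)) 2 timeMeasure := fun j => hk _ (ht j)
  refine tendstoInDistribution_of_tendsto_integral_cexp
    (fun ε => aemeasurable_pi_lambda _ fun j => aemeasurable_smallJumpPart ε (t j))
    (aemeasurable_pi_lambda _ fun j => hW.aemeasurable_gaussianPart (t j)) fun a => ?_
  have h1 := (Complex.continuous_exp.tendsto _).comp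
    (tendsto_integral_compensatedExponent_small hν hσ (memLp_sum_truncatedKernel hkt a))
  rw [← hW.integral_cexp hkt a] at h1
  exact h1.congr fun ε => (integral_cexp_sum_smallJumpPart hν hN hkt a ε).symm

/-- The sum of the large jumps and of an independent Gaussian substitute for the small jumps
converges to the whole process. -/
lemma tendstoFDD_largeJumpPart_add (hν : IsSquareIntegrableLevyMeasure ν)
    (hN : IsPoissonRandomMeasure N (jumpIntensity ν) P) (hW : IsIsonormal W P')
    {S : Set ℝ≥0} (hk : ∀ t ∈ S, MemLp (truncatedKernel h t) 2 timeMeasure) :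
    TendstoFDD (fun (ε : ℝ) (t : ℝ≥0) (ω : Ω × Ω') =>
        largeJumpPart N ν P h ε t ω.1 + smallJumpStd ν ε * gaussianPart W h t ω.2)
      (𝓝[>] 0) (chaosProcess N ν P h) S (P.prod P') P := by
  intro d t ht
  have hkt : ∀ j, MemLp (truncatedKernel h (t j)) 2 timeMeasure := fun j => hk _ (ht j)
  refine tendstoInDistribution_of_tendsto_integral_cexp
    (fun ε => aemeasurable_pi_lambda _ fun j => ?_)
    (aemeasurable_pi_lambda _ fun j => aemeasurable_chaosProcess (t j)) fun a => ?_
  · exact (aemeasurable_largeJumpPart ε (t j)).comp_fst.add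
      ((hW.aemeasurable_gaussianPart (t j)).comp_snd.const_mul _)
  · have h2 : ∀ j ω, gaussianPart W h (t j) ω = W (toL2 (truncatedKernel h (t j))) ω :=
      fun j ω => rfl
    have h3 : ∀ ε : ℝ, ∫ ω, Complex.exp ((∑ j, a j * (largeJumpPart N ν P h ε (t j) ω.1 +
          smallJumpStd ν ε * gaussianPart W h (t j) ω.2) : ℝ) * Complex.I) ∂(P.prod P') =
        Complex.exp (∫ z, compensatedExponent ((∑ j, a j * truncatedKernel h (t j) z.1) *
          largeJumpSize ε z.2) ∂(jumpIntensity ν)) *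
        Complex.exp (-((∫ s, (∑ j, (a j * smallJumpStd ν ε) * truncatedKernel h (t j) s) ^ 2
          ∂timeMeasure : ℝ) : ℂ) / 2) := by
      intro ε
      rw [← integral_cexp_sum_largeJumpPart hν hN hkt, ← hW.integral_cexp hkt,
        ← integral_prod_mul]
      refine integral_congr_ae (ae_of_all _ fun ω => ?_)
      simp only [← Complex.exp_add, ← add_mul, ← Complex.ofReal_add, ← Finset.sum_add_distrib, h2]
      congr 4
      ext j
      ring
    simp_rw [h3, integral_cexp_sum_chaosProcess hν hN hkt]
    have hks := memLp_sum_truncatedKernel hkt a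
    have h4 := (Complex.continuous_exp.tendsto _).comp
      (tendsto_integral_compensatedExponent_large hν hks)
    have h5 : Tendsto (fun ε => Complex.exp (-((∫ s, (∑ j, (a j * smallJumpStd ν ε) *
        truncatedKernel h (t j) s) ^ 2 ∂timeMeasure : ℝ) : ℂ) / 2)) (𝓝[>] 0) (𝓝 1) := by
      have h6 : ∀ ε, ∫ s, (∑ j, (a j * smallJumpStd ν ε) *
          truncatedKernel h (t j) s) ^ 2 ∂timeMeasure =
          smallJumpStd ν ε ^ 2 * ∫ s, (∑ j, a j * truncatedKernel h (t j) s) ^ 2 ∂timeMeasure := by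
        intro ε
        rw [← integral_const_mul]
        congr 1
        ext s
        rw [← mul_pow, Finset.mul_sum]
        congr 1
        exact Finset.sum_congr rfl fun j _ => by ring
      simp_rw [h6]
      have h7 : Continuous fun x : ℝ => Complex.exp (-((x ^ 2 *
        ∫ s, (∑ j, a j * truncatedKernel h (t j) s) ^ 2 ∂timeMeasure : ℝ) : ℂ) / 2) := by
        fun_prop
      have h8 := (h7.tendsto 0).comp (tendsto_smallJumpStd hν)
      simpa [Function.comp_def] using h8
    simpa using h4.mul h5

lemma chaosProcess_ae_eq_add (hν : IsSquareIntegrableLevyMeasure ν)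
    (hN : IsPoissonRandomMeasure N (jumpIntensity ν) P)
    (hσ : Tendsto (fun ε : ℝ => smallJumpStd ν ε / ε) (𝓝[>] 0) atTop) {t : ℝ≥0}
    (hk : MemLp (truncatedKernel h t) 2 timeMeasure) {ε : ℝ} (hε : 0 < ε) :
    ∀ᵐ ω ∂P, chaosProcess N ν P h t ω =
      largeJumpPart N ν P h ε t ω + smallJumpStd ν ε * smallJumpPart N ν P h ε t ω := by
  have := hν.sigmaFinite
  have h1 := compensatedIntegral_add_smul hN (memLp_jump_mul hk (memLp_largeJumpSize hν ε))
    (memLp_jump_mul hk (memLp_smallJumpSize hν ε)) 1 1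
  have h2 : (fun z : ℝ × ℝ => 1 * (truncatedKernel h t z.1 * largeJumpSize ε z.2) +
      1 * (truncatedKernel h t z.1 * smallJumpSize ε z.2)) =
      fun z => truncatedKernel h t z.1 * z.2 := by
    ext z
    conv_rhs => rw [← largeJumpSize_add_smallJumpSize ε z.2]
    ring
  rw [h2] at h1
  rw [chaosProcess_eq, largeJumpPart_eq, smallJumpPart_eq]
  filter_upwards [h1] with ω hω
  rw [hω, one_mul, one_mul, mul_inv_cancel_left₀ (smallJumpStd_pos hν hσ hε).ne']

/-- The large jumps are finite in number, and their part is the compensated sum over them. -/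
lemma largeJumpPart_ae_eq (hν : IsSquareIntegrableLevyMeasure ν)
    (hN : IsPoissonRandomMeasure N (jumpIntensity ν) P) {t : ℝ≥0}
    (hk : MemLp (truncatedKernel h t) 2 timeMeasure) {ε : ℝ} (hε : 0 < ε) :
    ∀ᵐ ω ∂P, N ω (Icc 0 (t : ℝ) ×ˢ {x : ℝ | ε < |x|}) < ∞ ∧
      largeJumpPart N ν P h ε t ω =
        (∫ z in Icc 0 (t : ℝ) ×ˢ {x : ℝ | ε < |x|}, h t z.1 * z.2 ∂(N ω)) -
        ∫ z in Icc 0 (t : ℝ) ×ˢ {x : ℝ | ε < |x|}, h t z.1 * z.2 ∂(jumpIntensity ν) := by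
  have := hν.sigmaFinite
  have hA : MeasurableSet (Icc 0 (t : ℝ) ×ˢ {x : ℝ | ε < |x|}) :=
    measurableSet_Icc.prod (measurableSet_lt_abs ε)
  have hA' : jumpIntensity ν (Icc 0 (t : ℝ) ×ˢ {x : ℝ | ε < |x|}) ≠ ∞ := by
    rw [jumpIntensity, Measure.prod_prod]
    refine ENNReal.mul_ne_top ?_ ?_
    · refine ((Measure.restrict_apply_le _ _).trans_lt ?_).ne
      simp
    · exact ((measure_mono fun x (hx : ε < |x|) => hx.le).trans_lt
        (hν.measure_le_abs_lt_top hε)).ne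
  have h1 : (fun z : ℝ × ℝ => truncatedKernel h t z.1 * largeJumpSize ε z.2) =
      (Icc 0 (t : ℝ) ×ˢ {x : ℝ | ε < |x|}).indicator (fun z => h t z.1 * z.2) := by
    ext z
    unfold truncatedKernel largeJumpSize
    by_cases hz : z.1 ∈ Icc 0 (t : ℝ) <;> by_cases hx : ε < |z.2| <;>
      simp [indicator, mem_prod, hz, hx]
  have h2 := memLp_jump_mul hk (memLp_largeJumpSize hν ε)
  rw [h1] at h2
  rw [largeJumpPart_eq, h1]
  filter_upwards [hN.measure_lt_top_ae hA hA', compensatedIntegral_indicator_ae_eq hN hA hA' h2]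
    with ω h3 h4
  exact ⟨h3, h4⟩

/-- The large and the small jumps live on disjoint sets, so their characteristic exponents add
up; therefore the two parts are independent. -/
lemma indepFun_largeJumpPart_smallJumpPart (hν : IsSquareIntegrableLevyMeasure ν)
    (hN : IsPoissonRandomMeasure N (jumpIntensity ν) P) {d : ℕ} {t : Fin d → ℝ≥0}
    (hk : ∀ j, MemLp (truncatedKernel h (t j)) 2 timeMeasure) (ε : ℝ) :
    IndepFun (fun ω i => largeJumpPart N ν P h ε (t i) ω)
      (fun ω i => smallJumpPart N ν P h ε (t i) ω) P := by
  have := hν.sigmaFinite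
  refine indepFun_of_integral_cexp_add
    (aemeasurable_pi_lambda _ fun j => aemeasurable_largeJumpPart ε (t j))
    (aemeasurable_pi_lambda _ fun j => aemeasurable_smallJumpPart ε (t j)) fun a b => ?_
  rw [integral_cexp_sum_largeJumpPart hν hN hk, integral_cexp_sum_smallJumpPart hν hN hk,
    ← Complex.exp_add]
  set gL : ℝ × ℝ → ℝ := fun z => (∑ j, a j * truncatedKernel h (t j) z.1) * largeJumpSize ε z.2
  set gS : ℝ × ℝ → ℝ := fun z => (∑ j, b j * truncatedKernel h (t j) z.1) *
    ((smallJumpStd ν ε)⁻¹ * smallJumpSize ε z.2)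
  have hL : MemLp gL 2 (jumpIntensity ν) :=
    memLp_jump_mul (memLp_sum_truncatedKernel hk a) (memLp_largeJumpSize hν ε)
  have hS : MemLp gS 2 (jumpIntensity ν) :=
    memLp_jump_mul (memLp_sum_truncatedKernel hk b) ((memLp_smallJumpSize hν ε).const_mul _)
  have h0 : ∀ z, gL z = 0 ∨ gS z = 0 := by
    intro z
    by_cases hx : ε < |z.2|
    · right
      simp [gS, smallJumpSize, hx]
    · left
      simp [gL, largeJumpSize, hx]
  have h1 : ∫ z, compensatedExponent (gL z) ∂(jumpIntensity ν) +
      ∫ z, compensatedExponent (gS z) ∂(jumpIntensity ν) =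
      ∫ z, compensatedExponent (gL z + gS z) ∂(jumpIntensity ν) := by
    rw [← integral_add (integrable_compensatedExponent hL) (integrable_compensatedExponent hS)]
    refine integral_congr_ae (ae_of_all _ fun z => ?_)
    rcases h0 z with h | h <;> simp [h, compensatedExponent_zero]
  refine Eq.trans ?_ (congrArg Complex.exp h1.symm)
  refine Eq.trans ?_ (integral_cexp_compensatedIntegral hN (hL.add hS))
  have hsL := compensatedIntegral_sum hN Finset.univ
    (fun j => memLp_jump_mul (hk j) (memLp_largeJumpSize hν ε)) a
  have hsS := compensatedIntegral_sum hN Finset.univ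
    (fun j => memLp_jump_mul (hk j) (memLp_smallJumpSize hν ε))
    (fun j => b j * (smallJumpStd ν ε)⁻¹)
  have hadd := compensatedIntegral_add_smul hN hL hS 1 1
  simp only [one_mul] at hadd
  have eL : (fun z : ℝ × ℝ => ∑ j, a j * (truncatedKernel h (t j) z.1 * largeJumpSize ε z.2)) =
      gL := by
    ext z
    simp only [gL, Finset.sum_mul]
    exact Finset.sum_congr rfl fun j _ => by ring
  have eS : (fun z : ℝ × ℝ => ∑ j, b j * (smallJumpStd ν ε)⁻¹ *
      (truncatedKernel h (t j) z.1 * smallJumpSize ε z.2)) = gS := by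
    ext z
    simp only [gS, Finset.sum_mul]
    exact Finset.sum_congr rfl fun j _ => by ring
  rw [eL] at hsL
  rw [eS] at hsS
  refine integral_congr_ae ?_
  filter_upwards [hsL, hsS, hadd] with ω h2 h3 h4
  rw [h4, h2, h3]
  simp only [largeJumpPart_eq, smallJumpPart_eq, mul_assoc]

lemma memLp_truncatedKernel_of_memLp_three {T : ℝ≥0} {t : ℝ≥0} (ht : t ≤ T)
    (hh : MemLp (h t) 3 (volume.restrict (Ioo 0 (T : ℝ)))) :
    MemLp (truncatedKernel h t) 2 timeMeasure := by
  have h1 : MemLp (h t) 2 (volume.restrict (Ioo 0 (T : ℝ))) :=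
    hh.mono_exponent (by norm_num)
  rw [restrict_Ioo_eq_restrict_Icc] at h1
  rw [truncatedKernel, memLp_indicator_iff_restrict measurableSet_Icc, timeMeasure,
    Measure.restrict_restrict measurableSet_Icc]
  refine h1.mono_measure (Measure.restrict_mono ?_ le_rfl)
  exact inter_subset_left.trans (Icc_subset_Icc_right (by exact_mod_cast ht))

end FiniteDimensional

/-! ### Tools for integrals of nonnegative functions -/

/-- The fundamental theorem of calculus for a nonnegative derivative, which is automatically
integrable. -/
lemma setLIntegral_Ioo_of_hasDerivAt {F f : ℝ → ℝ} {a b : ℝ} (hab : a ≤ b)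
    (hc : ContinuousOn F (Icc a b)) (hd : ∀ x ∈ Ioo a b, HasDerivAt F (f x) x)
    (hf : ∀ x ∈ Ioo a b, 0 ≤ f x) :
    ∫⁻ x in Ioo a b, ENNReal.ofReal (f x) = ENNReal.ofReal (F b - F a) := by
  have hi : IntervalIntegrable f volume a b := by
    rw [intervalIntegrable_iff_integrableOn_Ioc_of_le hab]
    exact intervalIntegral.integrableOn_deriv_of_nonneg hc hd hf
  have h1 := intervalIntegral.integral_eq_sub_of_hasDerivAt_of_le hab hc hd hi
  rw [← h1, intervalIntegral.integral_of_le hab, integral_Ioc_eq_integral_Ioo]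
  rw [ofReal_integral_eq_lintegral_ofReal]
  · exact ((intervalIntegrable_iff_integrableOn_Ioc_of_le hab).1 hi).mono_set Ioo_subset_Ioc_self
  · exact ae_restrict_of_forall_mem measurableSet_Ioo hf

lemma setLIntegral_Ioi_of_hasDerivAt {F f : ℝ → ℝ} {a m : ℝ}
    (hc : ContinuousWithinAt F (Ici a) a) (hd : ∀ x ∈ Ioi a, HasDerivAt F (f x) x)
    (hf : ∀ x ∈ Ioi a, 0 ≤ f x) (hF : Tendsto F atTop (𝓝 m)) :
    ∫⁻ x in Ioi a, ENNReal.ofReal (f x) = ENNReal.ofReal (m - F a) := by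
  have h1 := integral_Ioi_of_hasDerivAt_of_nonneg hc hd hf hF
  rw [← h1, ofReal_integral_eq_lintegral_ofReal]
  · exact integrableOn_Ioi_deriv_of_nonneg hc hd hf hF
  · exact ae_restrict_of_forall_mem measurableSet_Ioi hf

/-- Tonelli's theorem on the triangle `0 < u < r < s`. -/
lemma lintegral_triangle_swap {F : ℝ → ℝ → ℝ≥0∞} (hF : Measurable (Function.uncurry F)) (s : ℝ) :
    ∫⁻ u in Ioo 0 s, ∫⁻ r in Ioo u s, F u r = ∫⁻ r in Ioo 0 s, ∫⁻ u in Ioo 0 r, F u r := by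
  set T : Set (ℝ × ℝ) := {p | 0 < p.1 ∧ p.1 < p.2 ∧ p.2 < s}
  have hT : MeasurableSet T :=
    (measurableSet_lt measurable_const measurable_fst).inter
      ((measurableSet_lt measurable_fst measurable_snd).inter
        (measurableSet_lt measurable_snd measurable_const))
  have h1 : ∀ u, (Ioo 0 s).indicator (fun u => ∫⁻ r in Ioo u s, F u r) u =
      ∫⁻ r, T.indicator (Function.uncurry F) (u, r) := by
    intro u
    by_cases hu : u ∈ Ioo 0 s
    · rw [indicator_of_mem hu, ← lintegral_indicator measurableSet_Ioo]
      refine lintegral_congr fun r => ?_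
      by_cases hr : r ∈ Ioo u s
      · rw [indicator_of_mem hr, indicator_of_mem (show (u, r) ∈ T from ⟨hu.1, hr.1, hr.2⟩)]
        rfl
      · rw [indicator_of_notMem hr, indicator_of_notMem fun h => hr ⟨h.2.1, h.2.2⟩]
    · rw [indicator_of_notMem hu]
      refine (lintegral_eq_zero_of_ae_eq_zero (ae_of_all _ fun r => ?_)).symm
      exact indicator_of_notMem (fun h => hu ⟨h.1, h.2.1.trans h.2.2⟩) _
  have h2 : ∀ r, (Ioo 0 s).indicator (fun r => ∫⁻ u in Ioo 0 r, F u r) r =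
      ∫⁻ u, T.indicator (Function.uncurry F) (u, r) := by
    intro r
    by_cases hr : r ∈ Ioo 0 s
    · rw [indicator_of_mem hr, ← lintegral_indicator measurableSet_Ioo]
      refine lintegral_congr fun u => ?_
      by_cases hu : u ∈ Ioo 0 r
      · rw [indicator_of_mem hu, indicator_of_mem (show (u, r) ∈ T from ⟨hu.1, hu.2, hr.2⟩)]
        rfl
      · rw [indicator_of_notMem hu, indicator_of_notMem fun h => hu ⟨h.1, h.2.1⟩]
    · rw [indicator_of_notMem hr]
      refine (lintegral_eq_zero_of_ae_eq_zero (ae_of_all _ fun u => ?_)).symm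
      exact indicator_of_notMem (fun h => hr ⟨h.1.trans h.2.1, h.2.2⟩) _
  rw [← lintegral_indicator measurableSet_Ioo, ← lintegral_indicator measurableSet_Ioo]
  simp_rw [h1, h2]
  exact lintegral_lintegral_swap (hF.indicator hT).aemeasurable

/-! ### Beta integrals -/

lemma lintegral_beta {a b : ℝ} (ha : 0 < a) (hb : 0 < b) :
    ∫⁻ y in Ioo (0 : ℝ) 1, ENNReal.ofReal (y ^ (a - 1) * (1 - y) ^ (b - 1)) =
      ENNReal.ofReal (beta a b) := by
  have h := lintegral_betaPDF_eq_one ha hb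
  have hp := beta_pos ha hb
  rw [lintegral_betaPDF] at h
  simp_rw [mul_assoc, ENNReal.ofReal_mul (one_div_pos.2 hp).le] at h
  rw [lintegral_const_mul' _ _ ENNReal.ofReal_ne_top] at h
  have h2 : ENNReal.ofReal (beta a b) * ENNReal.ofReal (1 / beta a b) = 1 := by
    rw [← ENNReal.ofReal_mul hp.le, mul_one_div_cancel hp.ne', ENNReal.ofReal_one]
  calc _ = ENNReal.ofReal (beta a b) * ENNReal.ofReal (1 / beta a b) * _ := by
        rw [h2, one_mul]
    _ = _ := by rw [mul_assoc, h, mul_one]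

/-- Euler's integral whose exponents add up to `-2`, evaluated by the Möbius substitution
`w = u (r - v) / (v (r - u))`. -/
lemma lintegral_beta_moebius {a b v r : ℝ} (ha : 0 < a) (hb : 0 < b) (hv : 0 < v) (hvr : v < r) :
    ∫⁻ u in Ioo 0 v, ENNReal.ofReal (u ^ (a - 1) * (v - u) ^ (b - 1) * (r - u) ^ (-(a + b))) =
      ENNReal.ofReal (beta a b * (v ^ (a + b - 1) * r ^ (-b) * (r - v) ^ (-a))) := by
  have hr : 0 < r := hv.trans hvr
  have hrv : 0 < r - v := sub_pos.2 hvr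
  have hru : ∀ u ∈ Ioo 0 v, 0 < r - u := fun u hu => by linarith [hu.2]
  set f : ℝ → ℝ := fun u => u * (r - v) / (v * (r - u)) with hf
  set f' : ℝ → ℝ := fun u => (r - v) * r / (v * (r - u) ^ 2) with hf'
  have hderiv : ∀ u ∈ Ioo 0 v, HasDerivWithinAt f (f' u) (Ioo 0 v) u := by
    intro u hu
    have h0 := (hru u hu).ne'
    have h1 : HasDerivAt (fun u => u * (r - v)) (1 * (r - v)) u :=
      (hasDerivAt_id u).mul_const _
    have h2 : HasDerivAt (fun u => v * (r - u)) (v * (-1)) u :=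
      ((hasDerivAt_id u).const_sub r).const_mul v
    have h3 := h1.div h2 (mul_ne_zero hv.ne' h0)
    refine (h3.congr_deriv ?_).hasDerivWithinAt
    simp only [hf']
    field_simp
    ring
  have hinj : InjOn f (Ioo 0 v) := by
    intro x hx y hy hxy
    have h1 := (hru x hx).ne'
    have h2 := (hru y hy).ne'
    simp only [hf] at hxy
    rw [div_eq_div_iff (mul_ne_zero hv.ne' h1) (mul_ne_zero hv.ne' h2)] at hxy
    have : (r - v) * v * r * (x - y) = 0 := by linear_combination hxy
    have h4 : (r - v) * v * r ≠ 0 := mul_ne_zero (mul_ne_zero hrv.ne' hv.ne') hr.ne'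
    linarith [(mul_eq_zero.1 this).resolve_left h4]
  have himg : f '' Ioo 0 v = Ioo 0 1 := by
    ext w
    constructor
    · rintro ⟨u, hu, rfl⟩
      have h1 := hru u hu
      refine ⟨div_pos (mul_pos hu.1 hrv) (mul_pos hv h1), ?_⟩
      rw [div_lt_one (mul_pos hv h1)]
      nlinarith [mul_pos hr (sub_pos.2 hu.2)]
    · rintro ⟨hw0, hw1⟩
      have hD : 0 < r - v + v * w := by nlinarith [mul_pos hv hw0]
      refine ⟨w * v * r / (r - v + v * w), ⟨by positivity, ?_⟩, ?_⟩
      · rw [div_lt_iff₀ hD]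
        nlinarith [mul_pos (mul_pos hv hrv) (sub_pos.2 hw1)]
      · simp only [hf]
        have h5 : r - w * v * r / (r - v + v * w) = (r - v) * r / (r - v + v * w) := by
          field_simp
          ring
        rw [h5]
        field_simp
  have hcv := lintegral_image_eq_lintegral_abs_deriv_mul measurableSet_Ioo hderiv hinj
    (fun w => ENNReal.ofReal (w ^ (a - 1) * (1 - w) ^ (b - 1)))
  rw [himg, lintegral_beta ha hb] at hcv
  have hcst : 0 < v ^ (a + b - 1) * r ^ (-b) * (r - v) ^ (-a) := by positivity
  rw [mul_comm (beta a b), ENNReal.ofReal_mul hcst.le, hcv,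
    ← lintegral_const_mul' _ _ ENNReal.ofReal_ne_top]
  refine setLIntegral_congr_fun measurableSet_Ioo fun u hu => ?_
  have h1 := hru u hu
  have hu0 : 0 < u := hu.1
  have hvu : 0 < v - u := sub_pos.2 hu.2
  have hf'0 : 0 < f' u := by simp only [hf']; positivity
  rw [abs_of_pos hf'0, ← ENNReal.ofReal_mul hf'0.le, ← ENNReal.ofReal_mul hcst.le]
  congr 1
  have e1 : 1 - f u = r * (v - u) / (v * (r - u)) := by
    simp only [hf]
    field_simp
    ring
  rw [e1]
  simp only [hf, hf']
  rw [Real.div_rpow (by positivity) (by positivity), Real.div_rpow (by positivity) (by positivity),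
    Real.mul_rpow hu0.le hrv.le, Real.mul_rpow hv.le h1.le, Real.mul_rpow hr.le hvu.le,
    Real.mul_rpow hv.le h1.le]
  have ea : ∀ x : ℝ, 0 < x → x ^ a = x ^ (a - 1) * x := fun x hx => by
    rw [← Real.rpow_add_one hx.ne']; congr 1; ring
  have eb : ∀ x : ℝ, 0 < x → x ^ b = x ^ (b - 1) * x := fun x hx => by
    rw [← Real.rpow_add_one hx.ne']; congr 1; ring
  have e2 : v ^ (a + b - 1) = v ^ (a - 1) * (v ^ (b - 1) * v) := by
    rw [← eb v hv, ← Real.rpow_add hv]; congr 1; ring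
  have e3 : (r - u) ^ (-(a + b)) =
      ((r - u) ^ (a - 1) * (r - u) * ((r - u) ^ (b - 1) * (r - u)))⁻¹ := by
    rw [Real.rpow_neg h1.le, Real.rpow_add h1, ea _ h1, eb _ h1]
  rw [e2, e3, Real.rpow_neg hr.le, Real.rpow_neg hrv.le, ea _ hrv, eb _ hr]
  have := Real.rpow_pos_of_pos hv (a - 1)
  have := Real.rpow_pos_of_pos hv (b - 1)
  have := Real.rpow_pos_of_pos hr (b - 1)
  have := Real.rpow_pos_of_pos hrv (a - 1)
  have := Real.rpow_pos_of_pos h1 (a - 1)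
  have := Real.rpow_pos_of_pos h1 (b - 1)
  field_simp

/-! ### The covariance of the Molchan–Golosov kernel for `H < 1/2` -/

section Rough

/-- The function `t^{-α} (t-u)^{-α} + α ∫_u^t r^{-α-1} (r-u)^{-α} dr`, `α = 1/2 - H`, to which the
Molchan–Golosov kernel `K_H(t, u)` is proportional up to the factor `u^α`. -/
noncomputable def roughKernel (α t u : ℝ) : ℝ≥0∞ :=
  ENNReal.ofReal (t ^ (-α) * (t - u) ^ (-α)) +
    ∫⁻ r in Ioo u t, ENNReal.ofReal (α * r ^ (-α - 1) * (r - u) ^ (-α))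

lemma measurable_roughKernel (α t : ℝ) : Measurable (roughKernel α t) := by
  have h0 : Measurable fun u : ℝ => ENNReal.ofReal (t ^ (-α) * (t - u) ^ (-α)) := by fun_prop
  refine h0.add ?_
  have hT : MeasurableSet {p : ℝ × ℝ | p.1 < p.2 ∧ p.2 < t} :=
    (measurableSet_lt measurable_fst measurable_snd).inter
      (measurableSet_lt measurable_snd measurable_const)
  have h1 : Measurable ({p : ℝ × ℝ | p.1 < p.2 ∧ p.2 < t}.indicator
      fun p => ENNReal.ofReal (α * p.2 ^ (-α - 1) * (p.2 - p.1) ^ (-α))) :=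
    Measurable.indicator (by fun_prop) hT
  have h2 := h1.lintegral_prod_right' (ν := volume)
  convert! h2 using 2 with u
  rw [← lintegral_indicator measurableSet_Ioo]
  refine lintegral_congr fun r => ?_
  by_cases hr : r ∈ Ioo u t
  · rw [indicator_of_mem hr, indicator_of_mem (show (u, r) ∈ {p : ℝ × ℝ | p.1 < p.2 ∧ p.2 < t}
      from ⟨hr.1, hr.2⟩)]
  · rw [indicator_of_notMem hr, indicator_of_notMem fun h => hr ⟨h.1, h.2⟩]

variable {α : ℝ}

/-- Representation of the kernel as an integral over the future `(t, ∞)`. Integrating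
`d/dr (r^{-α} (r-u)^{-α})` over `(t, ∞)` moves the integral of the definition past `t`; what remains
is its value over `(u, ∞)`, a beta integral. -/
lemma roughKernel_eq (h0 : 0 < α) (h1 : α < 1 / 2) {t u : ℝ} (hu : 0 < u) (hut : u < t) :
    roughKernel α t u =
      (∫⁻ r in Ioi t, ENNReal.ofReal (α * r ^ (-α) * (r - u) ^ (-α - 1))) +
        ENNReal.ofReal (α * beta (2 * α) (1 - α) * u ^ (-(2 * α))) := by
  have ht : 0 < t := hu.trans hut
  have hfut : ∫⁻ r in Ioi u, ENNReal.ofReal (α * r ^ (-α - 1) * (r - u) ^ (-α)) =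
      ENNReal.ofReal (α * beta (2 * α) (1 - α) * u ^ (-(2 * α))) := by
    have hderiv : ∀ w ∈ Ioo (0 : ℝ) 1,
        HasDerivWithinAt (fun w => u / w) (-u / w ^ 2) (Ioo 0 1) w := by
      intro w hw
      have h2 := ((hasDerivAt_inv hw.1.ne').const_mul u)
      refine (h2.congr_deriv ?_).hasDerivWithinAt
      ring
    have hinj : InjOn (fun w => u / w) (Ioo (0 : ℝ) 1) := by
      intro x hx y hy hxy
      simp only at hxy
      rw [div_eq_div_iff hx.1.ne' hy.1.ne'] at hxy
      exact (mul_left_cancel₀ hu.ne' hxy).symm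
    have himg : (fun w => u / w) '' Ioo (0 : ℝ) 1 = Ioi u := by
      ext r
      constructor
      · rintro ⟨w, hw, rfl⟩
        simp only [mem_Ioi]
        rw [lt_div_iff₀ hw.1]
        nlinarith [hw.2]
      · intro hr
        have hr0 : 0 < r := hu.trans hr
        refine ⟨u / r, ⟨by positivity, (div_lt_one hr0).2 hr⟩, ?_⟩
        field_simp
    have hcv := lintegral_image_eq_lintegral_abs_deriv_mul measurableSet_Ioo hderiv hinj
      (fun r => ENNReal.ofReal (α * r ^ (-α - 1) * (r - u) ^ (-α)))
    rw [himg] at hcv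
    rw [hcv]
    have hb := lintegral_beta (a := 2 * α) (b := 1 - α) (by linarith) (by linarith)
    have hc : 0 ≤ α * u ^ (-(2 * α)) := by positivity
    rw [show α * beta (2 * α) (1 - α) * u ^ (-(2 * α)) =
      (α * u ^ (-(2 * α))) * beta (2 * α) (1 - α) by ring, ENNReal.ofReal_mul hc, ← hb,
      ← lintegral_const_mul' _ _ ENNReal.ofReal_ne_top]
    refine setLIntegral_congr_fun measurableSet_Ioo fun w hw => ?_
    have hw0 : 0 < w := hw.1
    have hw1 : 0 < 1 - w := sub_pos.2 hw.2
    rw [← ENNReal.ofReal_mul (abs_nonneg _), ← ENNReal.ofReal_mul hc]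
    congr 1
    have e1 : |-u / w ^ 2| = u / w ^ 2 := by
      rw [neg_div, abs_neg, abs_of_pos (by positivity)]
    have e2 : u / w - u = u * (1 - w) / w := by
      field_simp
    rw [e1, e2, Real.div_rpow hu.le hw0.le, Real.div_rpow (by positivity) hw0.le,
      Real.mul_rpow hu.le hw1.le]
    have e3 : u ^ (-(2 * α)) = u ^ (-α - 1) * u ^ (-α) * u := by
      rw [← Real.rpow_add hu, ← Real.rpow_add_one hu.ne']
      congr 1
      ring
    have e4 : w ^ (-α - 1) * w ^ (-α) * w ^ (2 * α - 1) = (w ^ 2)⁻¹ := by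
      rw [← Real.rpow_add hw0, ← Real.rpow_add hw0, ← Real.rpow_natCast, ← Real.rpow_neg hw0.le]
      congr 1
      push_cast
      ring
    have e5 : (1 - w) ^ (1 - α - 1) = (1 - w) ^ (-α) := by
      congr 1
      ring
    have p1 := (Real.rpow_pos_of_pos hw0 (-α - 1)).ne'
    have p2 := (Real.rpow_pos_of_pos hw0 (-α)).ne'
    have e6 : w ^ (2 * α - 1) = (w ^ 2)⁻¹ / (w ^ (-α - 1) * w ^ (-α)) := by
      rw [← e4]
      field_simp
    rw [e5, e6, e3]
    field_simp
  have hsplit : ∫⁻ r in Ioi u, ENNReal.ofReal (α * r ^ (-α - 1) * (r - u) ^ (-α)) =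
      (∫⁻ r in Ioo u t, ENNReal.ofReal (α * r ^ (-α - 1) * (r - u) ^ (-α))) +
        ∫⁻ r in Ioi t, ENNReal.ofReal (α * r ^ (-α - 1) * (r - u) ^ (-α)) := by
    rw [← Ioc_union_Ioi_eq_Ioi hut.le, lintegral_union measurableSet_Ioi
      (Ioc_disjoint_Ioi le_rfl), restrict_Ioo_eq_restrict_Ioc]
  have hFTC : (∫⁻ r in Ioi t, ENNReal.ofReal (α * r ^ (-α) * (r - u) ^ (-α - 1))) +
      (∫⁻ r in Ioi t, ENNReal.ofReal (α * r ^ (-α - 1) * (r - u) ^ (-α))) =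
      ENNReal.ofReal (t ^ (-α) * (t - u) ^ (-α)) := by
    have hpos : ∀ r ∈ Ici t, 0 < r ∧ 0 < r - u := fun r hr =>
      ⟨ht.trans_le hr, sub_pos.2 (hut.trans_le hr)⟩
    have hd : ∀ r ∈ Ici t, HasDerivAt (fun r => -(r ^ (-α) * (r - u) ^ (-α)))
        (α * r ^ (-α) * (r - u) ^ (-α - 1) + α * r ^ (-α - 1) * (r - u) ^ (-α)) r := by
      intro r hr
      have h2 := Real.hasDerivAt_rpow_const (p := -α) (Or.inl (hpos r hr).1.ne')
      have h3 := ((hasDerivAt_id r).sub_const u).rpow_const (p := -α)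
        (Or.inl (hpos r hr).2.ne')
      refine (h2.mul h3).neg.congr_deriv ?_
      simp only [id]
      ring
    have hlim : Tendsto (fun r : ℝ => -(r ^ (-α) * (r - u) ^ (-α))) atTop (𝓝 0) := by
      have h2 := (tendsto_rpow_neg_atTop h0).mul
        ((tendsto_rpow_neg_atTop h0).comp (tendsto_atTop_add_const_right atTop (-u) tendsto_id))
      simpa [Function.comp_def, ← sub_eq_add_neg] using h2.neg
    have h4 := setLIntegral_Ioi_of_hasDerivAt (hd t self_mem_Ici).continuousAt.continuousWithinAt
      (fun r hr => hd r (Ioi_subset_Ici_self hr)) (fun r hr => by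
        obtain ⟨h5, h6⟩ := hpos r (Ioi_subset_Ici_self hr)
        positivity) hlim
    rw [zero_sub, neg_neg] at h4
    rw [← h4, ← lintegral_add_left (by fun_prop)]
    refine setLIntegral_congr_fun measurableSet_Ioi fun r hr => ?_
    obtain ⟨h5, h6⟩ := hpos r (Ioi_subset_Ici_self hr)
    rw [ENNReal.ofReal_add (by positivity) (by positivity)]
  rw [roughKernel, ← hFTC, ← hfut, hsplit, add_assoc,
    add_comm (∫⁻ r in Ioi t, ENNReal.ofReal (α * r ^ (-α - 1) * (r - u) ^ (-α)))]

/-- Integration against the kernel, by Tonelli's theorem on the triangle `u < r < s`. -/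
lemma lintegral_mul_roughKernel {w : ℝ → ℝ≥0∞} (hw : Measurable w) (h0 : 0 < α) {s : ℝ}
    (hs : 0 < s) :
    ∫⁻ u in Ioo 0 s, w u * roughKernel α s u =
      ENNReal.ofReal (s ^ (-α)) * (∫⁻ u in Ioo 0 s, w u * ENNReal.ofReal ((s - u) ^ (-α))) +
        ∫⁻ r in Ioo 0 s, ENNReal.ofReal (α * r ^ (-α - 1)) *
          ∫⁻ u in Ioo 0 r, w u * ENNReal.ofReal ((r - u) ^ (-α)) := by
  have e1 : ∀ u, w u * roughKernel α s u =
      ENNReal.ofReal (s ^ (-α)) * (w u * ENNReal.ofReal ((s - u) ^ (-α))) +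
        ∫⁻ r in Ioo u s, w u * ENNReal.ofReal (α * r ^ (-α - 1) * (r - u) ^ (-α)) := by
    intro u
    rw [roughKernel, mul_add, lintegral_const_mul _ (by fun_prop), ENNReal.ofReal_mul (by positivity)]
    ring
  simp_rw [e1]
  rw [lintegral_add_left (by fun_prop), lintegral_const_mul _ (by fun_prop),
    lintegral_triangle_swap (F := fun u r => w u * ENNReal.ofReal (α * r ^ (-α - 1) *
      (r - u) ^ (-α))) (by
        have : Measurable fun p : ℝ × ℝ => w p.1 := hw.comp measurable_fst
        exact this.mul (by fun_prop))]
  congr 1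
  refine setLIntegral_congr_fun measurableSet_Ioo fun r hr => ?_
  have hr0 : 0 < r := hr.1
  rw [← lintegral_const_mul _ (by fun_prop)]
  refine lintegral_congr fun u => ?_
  rw [ENNReal.ofReal_mul (by positivity)]
  ring

lemma lintegral_roughKernel (h0 : 0 < α) (h1 : α < 1 / 2) {s : ℝ} (hs : 0 < s) :
    ∫⁻ u in Ioo 0 s, roughKernel α s u = ENNReal.ofReal (s ^ (1 - 2 * α) / (1 - 2 * α)) := by
  have hJ : ∀ r : ℝ, 0 < r → ∫⁻ u in Ioo 0 r, ENNReal.ofReal ((r - u) ^ (-α)) =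
      ENNReal.ofReal (r ^ (1 - α) / (1 - α)) := by
    intro r hr
    have h2 := setLIntegral_Ioo_of_hasDerivAt (F := fun u => -((r - u) ^ (1 - α) / (1 - α)))
      (f := fun u => (r - u) ^ (-α)) hr.le ?_ ?_ ?_
    · rw [h2]
      congr 1
      rw [sub_self, Real.zero_rpow (by linarith), sub_zero]
      ring
    · refine ContinuousOn.neg (ContinuousOn.div_const ?_ _)
      exact ContinuousOn.rpow_const (by fun_prop) fun x hx => Or.inr (by linarith)
    · intro u hu
      have h3 := ((hasDerivAt_id u).const_sub r).rpow_const (p := 1 - α)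
        (Or.inl (sub_pos.2 hu.2).ne')
      refine (h3.div_const (1 - α)).neg.congr_deriv ?_
      have : 1 - α ≠ 0 := by linarith
      simp only [id]
      rw [show 1 - α - 1 = -α by ring]
      field_simp
    · intro u hu
      exact Real.rpow_nonneg (sub_pos.2 hu.2).le _
  have h2 := lintegral_mul_roughKernel (w := fun _ => 1) measurable_const h0 hs
  simp only [one_mul] at h2
  rw [h2, hJ s hs]
  have h3 : ∫⁻ r in Ioo 0 s, ENNReal.ofReal (α * r ^ (-α - 1)) *
      ∫⁻ u in Ioo 0 r, ENNReal.ofReal ((r - u) ^ (-α)) =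
      ∫⁻ r in Ioo 0 s, ENNReal.ofReal (α / (1 - α) * r ^ (-(2 * α))) := by
    refine setLIntegral_congr_fun measurableSet_Ioo fun r hr => ?_
    have hr0 : 0 < r := hr.1
    rw [hJ r hr0, ← ENNReal.ofReal_mul (by positivity)]
    congr 1
    rw [show α * r ^ (-α - 1) * (r ^ (1 - α) / (1 - α)) =
      α / (1 - α) * (r ^ (-α - 1) * r ^ (1 - α)) by ring, ← Real.rpow_add hr0]
    congr 2
    ring
  have h4 := setLIntegral_Ioo_of_hasDerivAt
    (F := fun r : ℝ => α / (1 - α) * (r ^ (1 - 2 * α) / (1 - 2 * α)))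
    (f := fun r => α / (1 - α) * r ^ (-(2 * α))) hs.le ?_ ?_ ?_
  · rw [h3, h4, Real.zero_rpow (by linarith), zero_div, mul_zero, sub_zero,
      ← ENNReal.ofReal_mul (by positivity), ← ENNReal.ofReal_add]
    · congr 1
      have e1 : s ^ (-α) * (s ^ (1 - α) / (1 - α)) = s ^ (1 - 2 * α) / (1 - α) := by
        rw [← mul_div_assoc, ← Real.rpow_add hs]
        congr 2
        ring
      rw [e1]
      have : 1 - α ≠ 0 := by linarith
      have : 1 - 2 * α ≠ 0 := by linarith
      field_simp
      ring
    · have : 0 < 1 - α := by linarith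
      positivity
    · have : 0 < 1 - α := by linarith
      have : 0 < 1 - 2 * α := by linarith
      positivity
  · refine ContinuousOn.mul continuousOn_const (ContinuousOn.div_const ?_ _)
    exact ContinuousOn.rpow_const (by fun_prop) fun x hx => Or.inr (by linarith)
  · intro r hr
    have h5 := Real.hasDerivAt_rpow_const (p := 1 - 2 * α) (Or.inl hr.1.ne')
    refine ((h5.div_const (1 - 2 * α)).const_mul (α / (1 - α))).congr_deriv ?_
    have h6 : 1 - 2 * α ≠ 0 := by linarith
    rw [show 1 - 2 * α - 1 = -(2 * α) by ring, mul_div_cancel_left₀ _ h6]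
  · intro r hr
    have : 0 < 1 - α := by linarith
    have := hr.1
    positivity

/-- Writing `(r / (t-u))^{1+α}` as an integral over `(0, r)` raises the exponent of the integrand
so that the inner integral becomes of Möbius type. -/
lemma lintegral_rpow_mul_rpow_mul_rpow (h0 : 0 < α) (h1 : α < 1 / 2) {r t : ℝ} (hr : 0 < r)
    (hrt : r < t) :
    ∫⁻ u in Ioo 0 r, ENNReal.ofReal (u ^ (2 * α) * (t - u) ^ (-α - 1)) *
        ENNReal.ofReal ((r - u) ^ (-α)) =
      ENNReal.ofReal ((1 + α) * beta (1 + 2 * α) (1 - α) * t ^ α) *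
        ∫⁻ ρ in Ioo 0 r, ENNReal.ofReal (ρ ^ α * (t - ρ) ^ (-(2 * α) - 1)) := by
  have ht : 0 < t := hr.trans hrt
  have hpos : ∀ u ∈ Ioo 0 r, ∀ ρ ∈ Icc 0 r, 0 < t - ρ * (u / r) := by
    intro u hu ρ hρ
    have : ρ * (u / r) ≤ r * 1 :=
      mul_le_mul hρ.2 ((div_le_one hr).2 hu.2.le) (div_nonneg hu.1.le hr.le) hr.le
    linarith
  have step1 : ∀ u ∈ Ioo 0 r, ENNReal.ofReal (u ^ (2 * α) * (t - u) ^ (-α - 1)) *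
        ENNReal.ofReal ((r - u) ^ (-α)) =
      ∫⁻ ρ in Ioo 0 r, ENNReal.ofReal ((u ^ (2 * α) * (r - u) ^ (-α) * r ^ (-(1 + α))) *
        ((1 + α) * (ρ / (t - ρ * (u / r))) ^ α * (t / (t - ρ * (u / r)) ^ 2))) := by
    intro u hu
    have hu0 : 0 < u := hu.1
    have hru : 0 < r - u := sub_pos.2 hu.2
    have htu : 0 < t - u := by linarith [hu.2]
    have h2 := setLIntegral_Ioo_of_hasDerivAt
      (F := fun ρ => (u ^ (2 * α) * (r - u) ^ (-α) * r ^ (-(1 + α))) *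
        (ρ / (t - ρ * (u / r))) ^ (1 + α))
      (f := fun ρ => (u ^ (2 * α) * (r - u) ^ (-α) * r ^ (-(1 + α))) *
        ((1 + α) * (ρ / (t - ρ * (u / r))) ^ α * (t / (t - ρ * (u / r)) ^ 2))) hr.le ?_ ?_ ?_
    · rw [h2, ← ENNReal.ofReal_mul (by positivity)]
      congr 1
      rw [zero_div, Real.zero_rpow (by linarith), mul_zero, sub_zero, mul_div_cancel₀ _ hr.ne',
        Real.div_rpow hr.le htu.le, Real.rpow_neg hr.le,
        show -α - 1 = -(1 + α) by ring, Real.rpow_neg htu.le]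
      have := Real.rpow_pos_of_pos hr (1 + α)
      field_simp
    · refine ContinuousOn.mul continuousOn_const (ContinuousOn.rpow_const ?_ fun x hx =>
        Or.inr (by linarith))
      exact ContinuousOn.div (by fun_prop) (by fun_prop) fun ρ hρ => (hpos u hu ρ hρ).ne'
    · intro ρ hρ
      have hp := hpos u hu ρ (Ioo_subset_Icc_self hρ)
      have hρ0 : 0 < ρ := hρ.1
      have h3 : HasDerivAt (fun ρ => t - ρ * (u / r)) (-(1 * (u / r))) ρ :=
        ((hasDerivAt_id ρ).mul_const (u / r)).const_sub t
      have h4 := (((hasDerivAt_id ρ).div h3 hp.ne').rpow_const (p := 1 + α)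
        (Or.inl (div_pos hρ0 hp).ne')).const_mul
          (u ^ (2 * α) * (r - u) ^ (-α) * r ^ (-(1 + α)))
      refine h4.congr_deriv ?_
      simp only [Pi.div_apply, id]
      rw [show 1 + α - 1 = α by ring]
      have e : 1 * (t - ρ * (u / r)) - ρ * -(1 * (u / r)) = t := by ring
      rw [e]
      ring
    · intro ρ hρ
      have hp := hpos u hu ρ (Ioo_subset_Icc_self hρ)
      have hρ0 : 0 < ρ := hρ.1
      positivity
  rw [setLIntegral_congr_fun measurableSet_Ioo step1,
    lintegral_lintegral_swap (Measurable.aemeasurable (by fun_prop)),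
    ← lintegral_const_mul' _ _ ENNReal.ofReal_ne_top]
  refine setLIntegral_congr_fun measurableSet_Ioo fun ρ hρ => ?_
  have hρ0 : 0 < ρ := hρ.1
  have htρ : 0 < t - ρ := by linarith [hρ.2]
  have hr' : r < t * r / ρ := by
    rw [lt_div_iff₀ hρ0]
    nlinarith [hρ.2]
  have hm := lintegral_beta_moebius (a := 1 + 2 * α) (b := 1 - α) (by linarith) (by linarith) hr hr'
  have hcst : 0 ≤ (1 + α) * t * ρ ^ α * r ^ (-(1 + α)) * (ρ / r) ^ (-(2 + α)) := by positivity
  have e0 : ∀ u ∈ Ioo 0 r, ENNReal.ofReal ((u ^ (2 * α) * (r - u) ^ (-α) * r ^ (-(1 + α))) *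
        ((1 + α) * (ρ / (t - ρ * (u / r))) ^ α * (t / (t - ρ * (u / r)) ^ 2))) =
      ENNReal.ofReal ((1 + α) * t * ρ ^ α * r ^ (-(1 + α)) * (ρ / r) ^ (-(2 + α))) *
      ENNReal.ofReal (u ^ (1 + 2 * α - 1) * (r - u) ^ (1 - α - 1) *
        (t * r / ρ - u) ^ (-(1 + 2 * α + (1 - α)))) := by
    intro u hu
    have hp := hpos u hu ρ (Ioo_subset_Icc_self hρ)
    have hru : 0 < r - u := sub_pos.2 hu.2
    rw [← ENNReal.ofReal_mul hcst]
    congr 1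
    have hq : 0 < t * r / ρ - u := by linarith [hu.2]
    have e1 : t - ρ * (u / r) = (ρ / r) * (t * r / ρ - u) := by
      field_simp
    have e2 : (ρ / (t - ρ * (u / r))) ^ α * (t / (t - ρ * (u / r)) ^ 2) =
        ρ ^ α * t * (t - ρ * (u / r)) ^ (-(2 + α)) := by
      rw [Real.div_rpow hρ0.le hp.le, Real.rpow_neg hp.le, Real.rpow_add hp, Real.rpow_two]
      have := Real.rpow_pos_of_pos hp α
      field_simp
    rw [mul_assoc (1 + α), e2, e1, Real.mul_rpow (by positivity) hq.le,
      show 1 + 2 * α - 1 = 2 * α by ring, show 1 - α - 1 = -α by ring,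
      show -(1 + 2 * α + (1 - α)) = -(2 + α) by ring]
    ring
  rw [setLIntegral_congr_fun measurableSet_Ioo e0,
    lintegral_const_mul' _ _ ENNReal.ofReal_ne_top, hm, ← ENNReal.ofReal_mul hcst]
  have hB := (beta_pos (α := 1 + 2 * α) (β := 1 - α) (by linarith) (by linarith)).le
  rw [← ENNReal.ofReal_mul (by positivity)]
  congr 1
  have e3 : t * r / ρ - r = (r / ρ) * (t - ρ) := by field_simp
  rw [e3, Real.mul_rpow (by positivity) htρ.le, Real.div_rpow hρ0.le hr.le,
    Real.div_rpow (by positivity) hρ0.le, Real.div_rpow hr.le hρ0.le, Real.mul_rpow ht.le hr.le,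
    show -(1 + 2 * α) = -(2 * α) - 1 by ring, show 1 + 2 * α + (1 - α) - 1 = 1 + α by ring]
  have er : r ^ (-(1 + α)) * r ^ (1 + α) = 1 := by
    rw [← Real.rpow_add hr]; simp
  have er2 : r ^ (-(1 - α)) * r ^ (-(2 * α) - 1) = r ^ (-(2 + α)) := by
    rw [← Real.rpow_add hr]; congr 1; ring
  have eρ2 : ρ ^ (-(1 - α)) * ρ ^ (-(2 * α) - 1) = ρ ^ (-(2 + α)) := by
    rw [← Real.rpow_add hρ0]; congr 1; ring
  have et : t ^ α = t * t ^ (-(1 - α)) := by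
    rw [mul_comm, ← Real.rpow_add_one ht.ne']; congr 1; ring
  have p1 := (Real.rpow_pos_of_pos hr (-(1 - α))).ne'
  have p2 := (Real.rpow_pos_of_pos hr (-(2 * α) - 1)).ne'
  have p3 := (Real.rpow_pos_of_pos hρ0 (-(1 - α))).ne'
  have p4 := (Real.rpow_pos_of_pos hρ0 (-(2 * α) - 1)).ne'
  rw [← er2, ← eρ2, et]
  calc _ = (1 + α) * t * ρ ^ α * (r ^ (-(1 + α)) * r ^ (1 + α)) *
        beta (1 + 2 * α) (1 - α) * t ^ (-(1 - α)) * (t - ρ) ^ (-(2 * α) - 1) := by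
        field_simp
    _ = _ := by rw [er]; ring

/-- The integral of the kernel at time `s` against the integrand at a future time `t` in
`roughKernel_eq`. After exchanging the order of integration, the two terms of the kernel combine to
a power of `t - ρ`. -/
lemma lintegral_rpow_mul_rpow_mul_roughKernel (h0 : 0 < α) (h1 : α < 1 / 2) {s t : ℝ} (hs : 0 < s)
    (hst : s < t) :
    ∫⁻ u in Ioo 0 s, ENNReal.ofReal (u ^ (2 * α) * (t - u) ^ (-α - 1)) * roughKernel α s u =
      ENNReal.ofReal ((1 + α) * beta (1 + 2 * α) (1 - α) * t ^ α *
        (((t - s) ^ (-(2 * α)) - t ^ (-(2 * α))) / (2 * α))) := by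
  have ht : 0 < t := hs.trans hst
  have hB := (beta_pos (α := 1 + 2 * α) (β := 1 - α) (by linarith) (by linarith)).le
  set C := (1 + α) * beta (1 + 2 * α) (1 - α) * t ^ α with hC
  have hC0 : 0 ≤ C := by positivity
  have hpow : ∀ ρ ∈ Ioo 0 s, ∫⁻ r in Ioo ρ s, ENNReal.ofReal (α * r ^ (-α - 1)) =
      ENNReal.ofReal (ρ ^ (-α) - s ^ (-α)) := by
    intro ρ hρ
    rw [setLIntegral_Ioo_of_hasDerivAt (F := fun r => -r ^ (-α)) hρ.2.le]
    · congr 1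
      ring
    · exact ContinuousOn.neg (ContinuousOn.rpow_const (by fun_prop) fun x hx =>
        Or.inl (hρ.1.trans_le hx.1).ne')
    · intro r hr
      exact (Real.hasDerivAt_rpow_const (p := -α) (Or.inl (hρ.1.trans hr.1).ne')).neg.congr_deriv
        (by ring)
    · intro r hr
      have := hρ.1.trans hr.1
      positivity
  rw [lintegral_mul_roughKernel (by fun_prop) h0 hs,
    lintegral_rpow_mul_rpow_mul_rpow h0 h1 hs hst]
  have e1 : ∫⁻ r in Ioo 0 s, ENNReal.ofReal (α * r ^ (-α - 1)) *
        ∫⁻ u in Ioo 0 r, ENNReal.ofReal (u ^ (2 * α) * (t - u) ^ (-α - 1)) *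
          ENNReal.ofReal ((r - u) ^ (-α)) =
      ENNReal.ofReal C * ∫⁻ ρ in Ioo 0 s, ENNReal.ofReal (ρ ^ α * (t - ρ) ^ (-(2 * α) - 1)) *
        ENNReal.ofReal (ρ ^ (-α) - s ^ (-α)) := by
    calc _ = ∫⁻ r in Ioo 0 s, ENNReal.ofReal C * ∫⁻ ρ in Ioo 0 r,
          ENNReal.ofReal (α * r ^ (-α - 1)) *
            ENNReal.ofReal (ρ ^ α * (t - ρ) ^ (-(2 * α) - 1)) := by
          refine setLIntegral_congr_fun measurableSet_Ioo fun r hr => ?_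
          rw [lintegral_rpow_mul_rpow_mul_rpow h0 h1 hr.1 (hr.2.trans hst),
            lintegral_const_mul _ (by fun_prop)]
          ring
      _ = ENNReal.ofReal C * ∫⁻ ρ in Ioo 0 s, ∫⁻ r in Ioo ρ s,
          ENNReal.ofReal (α * r ^ (-α - 1)) *
            ENNReal.ofReal (ρ ^ α * (t - ρ) ^ (-(2 * α) - 1)) := by
          rw [lintegral_const_mul' _ _ ENNReal.ofReal_ne_top, lintegral_triangle_swap
            (F := fun ρ r => ENNReal.ofReal (α * r ^ (-α - 1)) *
              ENNReal.ofReal (ρ ^ α * (t - ρ) ^ (-(2 * α) - 1))) (by fun_prop)]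
      _ = _ := by
          congr 1
          refine setLIntegral_congr_fun measurableSet_Ioo fun ρ hρ => ?_
          rw [lintegral_mul_const _ (by fun_prop), hpow ρ hρ, mul_comm]
  rw [e1, mul_left_comm, ← mul_add, ← lintegral_const_mul _ (by fun_prop),
    ← lintegral_add_left (by fun_prop), ENNReal.ofReal_mul hC0]
  congr 1
  have e2 : ∀ ρ ∈ Ioo 0 s, ENNReal.ofReal (s ^ (-α)) *
        ENNReal.ofReal (ρ ^ α * (t - ρ) ^ (-(2 * α) - 1)) +
      ENNReal.ofReal (ρ ^ α * (t - ρ) ^ (-(2 * α) - 1)) * ENNReal.ofReal (ρ ^ (-α) - s ^ (-α)) =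
      ENNReal.ofReal ((t - ρ) ^ (-(2 * α) - 1)) := by
    intro ρ hρ
    have hρ0 : 0 < ρ := hρ.1
    have htρ : 0 < t - ρ := by linarith [hρ.2]
    have h2 : 0 ≤ ρ ^ (-α) - s ^ (-α) :=
      sub_nonneg.2 (Real.rpow_le_rpow_of_nonpos hρ0 hρ.2.le (by linarith))
    have h3 : ρ ^ α * ρ ^ (-α) = 1 := by
      rw [← Real.rpow_add hρ0]; simp
    rw [← ENNReal.ofReal_mul (by positivity), ← ENNReal.ofReal_mul (by positivity),
      ← ENNReal.ofReal_add (by positivity) (by positivity)]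
    congr 1
    linear_combination (t - ρ) ^ (-(2 * α) - 1) * h3
  rw [setLIntegral_congr_fun measurableSet_Ioo e2,
    setLIntegral_Ioo_of_hasDerivAt (F := fun ρ => (t - ρ) ^ (-(2 * α)) / (2 * α)) hs.le]
  · congr 1
    rw [sub_zero]
    ring
  · exact ContinuousOn.div_const (ContinuousOn.rpow_const (by fun_prop) fun x hx =>
      Or.inl (by linarith [hx.2])) _
  · intro ρ hρ
    have h3 := ((hasDerivAt_id ρ).const_sub t).rpow_const (p := -(2 * α))
      (Or.inl (sub_pos.2 (hρ.2.trans hst)).ne')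
    refine (h3.div_const (2 * α)).congr_deriv ?_
    simp only [id]
    field_simp
  · intro ρ hρ
    exact Real.rpow_nonneg (by linarith [hρ.2]) _

lemma tendsto_rpow_sub_sub_rpow {p s : ℝ} (hp0 : 0 < p) (hp1 : p < 1) (hs : 0 ≤ s) :
    Tendsto (fun r : ℝ => (r - s) ^ p - r ^ p) atTop (𝓝 0) := by
  have h1 : Tendsto (fun r : ℝ => -(s * r ^ (-(1 - p)))) atTop (𝓝 0) := by
    simpa using ((tendsto_rpow_neg_atTop (y := 1 - p) (by linarith)).const_mul s).neg
  refine tendsto_of_tendsto_of_tendsto_of_le_of_le' h1 tendsto_const_nhds ?_ ?_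
  · filter_upwards [eventually_gt_atTop s] with r hr
    have hr0 : 0 < r := hs.trans_lt hr
    have h2 : 1 - s / r ≤ (1 - s / r) ^ p := by
      refine Real.self_le_rpow_of_le_one ?_ ?_ hp1.le
      · rw [sub_nonneg, div_le_one hr0]; exact hr.le
      · have : 0 ≤ s / r := by positivity
        linarith
    have h3 : r - s = r * (1 - s / r) := by field_simp
    have h4 : 0 ≤ 1 - s / r := by
      rw [sub_nonneg, div_le_one hr0]; exact hr.le
    have h5 : r ^ (-(1 - p)) = r ^ p / r := by
      rw [← Real.rpow_sub_one hr0.ne']; congr 1; ring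
    rw [h3, Real.mul_rpow hr0.le h4, h5]
    have := mul_le_mul_of_nonneg_left h2 (Real.rpow_nonneg hr0.le p)
    have e : r ^ p * (1 - s / r) = r ^ p - s * (r ^ p / r) := by ring
    linarith
  · filter_upwards [eventually_gt_atTop s] with r hr
    exact sub_nonpos.2 (Real.rpow_le_rpow (by linarith) (by linarith) hp0.le)

lemma beta_one_add_two_mul (h0 : 0 < α) (h1 : α < 1) :
    (1 + α) * beta (1 + 2 * α) (1 - α) = 2 * α * beta (2 * α) (1 - α) := by
  rw [beta, beta, add_comm 1 (2 * α), Real.Gamma_add_one (by linarith),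
    show 2 * α + 1 + (1 - α) = 1 + α + 1 by ring, Real.Gamma_add_one (by linarith),
    show 2 * α + (1 - α) = 1 + α by ring]
  have := (Real.Gamma_pos_of_pos (show 0 < 1 + α by linarith)).ne'
  field_simp

/-- Representing the kernel at the later time `t` by the future `(t, ∞)` reduces the covariance to
the integrals of the preceding lemmas. -/
lemma lintegral_roughKernel_mul_roughKernel (h0 : 0 < α) (h1 : α < 1 / 2) {s t : ℝ} (hs : 0 < s)
    (hst : s ≤ t) :
    ∫⁻ u in Ioo 0 s, ENNReal.ofReal (u ^ (2 * α)) * (roughKernel α t u * roughKernel α s u) =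
      ENNReal.ofReal (α * beta (2 * α) (1 - α) / (1 - 2 * α) *
        (t ^ (1 - 2 * α) - (t - s) ^ (1 - 2 * α) + s ^ (1 - 2 * α))) := by
  have ht : 0 < t := hs.trans_le hst
  have hp : 0 < 1 - 2 * α := by linarith
  have hB := (beta_pos (α := 2 * α) (β := 1 - α) (by linarith) (by linarith)).le
  have hmk := measurable_roughKernel α s
  have e1 : ∀ u ∈ Ioo 0 s,
      ENNReal.ofReal (u ^ (2 * α)) * (roughKernel α t u * roughKernel α s u) =
      (∫⁻ r in Ioi t, ENNReal.ofReal (α * r ^ (-α)) *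
        (ENNReal.ofReal (u ^ (2 * α) * (r - u) ^ (-α - 1)) * roughKernel α s u)) +
      ENNReal.ofReal (α * beta (2 * α) (1 - α)) * roughKernel α s u := by
    intro u hu
    have hu0 : 0 < u := hu.1
    rw [roughKernel_eq h0 h1 hu0 (hu.2.trans_le hst), add_mul, mul_add]
    congr 1
    · rw [← mul_assoc, ← lintegral_const_mul _ (by fun_prop), ← lintegral_mul_const _ (by fun_prop)]
      refine setLIntegral_congr_fun measurableSet_Ioi fun r hr => ?_
      have hr0 : 0 < r := ht.trans hr
      have hru : 0 < r - u := sub_pos.2 ((hu.2.trans_le hst).trans hr)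
      rw [← ENNReal.ofReal_mul (by positivity), ← mul_assoc (ENNReal.ofReal _),
        ← ENNReal.ofReal_mul (by positivity)]
      congr 2
      ring
    · rw [← mul_assoc, ← ENNReal.ofReal_mul (by positivity)]
      congr 2
      have : u ^ (2 * α) * u ^ (-(2 * α)) = 1 := by
        rw [← Real.rpow_add hu0]; simp
      linear_combination α * beta (2 * α) (1 - α) * this
  have hmeas : Measurable fun p : ℝ × ℝ => ENNReal.ofReal (α * p.2 ^ (-α)) *
      (ENNReal.ofReal (p.1 ^ (2 * α) * (p.2 - p.1) ^ (-α - 1)) * roughKernel α s p.1) := by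
    have : Measurable fun p : ℝ × ℝ => roughKernel α s p.1 := hmk.comp measurable_fst
    fun_prop
  rw [setLIntegral_congr_fun measurableSet_Ioo e1,
    lintegral_add_right _ (by fun_prop), lintegral_const_mul _ hmk, lintegral_roughKernel h0 h1 hs,
    lintegral_lintegral_swap hmeas.aemeasurable]
  have hnn : ∀ r ∈ Ioi t, 0 ≤ (r - s) ^ (-(2 * α)) - r ^ (-(2 * α)) := fun r hr =>
    sub_nonneg.2 (Real.rpow_le_rpow_of_nonpos (sub_pos.2 (hst.trans_lt hr)) (by linarith)
      (by linarith))
  have e2 : ∀ r ∈ Ioi t, ∫⁻ u in Ioo 0 s, ENNReal.ofReal (α * r ^ (-α)) *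
        (ENNReal.ofReal (u ^ (2 * α) * (r - u) ^ (-α - 1)) * roughKernel α s u) =
      ENNReal.ofReal (α * beta (2 * α) (1 - α) * ((r - s) ^ (-(2 * α)) - r ^ (-(2 * α)))) := by
    intro r hr
    have hr0 : 0 < r := ht.trans hr
    rw [lintegral_const_mul' _ _ ENNReal.ofReal_ne_top,
      lintegral_rpow_mul_rpow_mul_roughKernel h0 h1 hs (hst.trans_lt hr),
      ← ENNReal.ofReal_mul (by positivity), beta_one_add_two_mul h0 (by linarith)]
    congr 1
    have : r ^ (-α) * r ^ α = 1 := by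
      rw [← Real.rpow_add hr0]; simp
    have hq := div_mul_cancel₀ ((r - s) ^ (-(2 * α)) - r ^ (-(2 * α)))
      (show 2 * α ≠ 0 by positivity)
    linear_combination α * beta (2 * α) (1 - α) * ((r - s) ^ (-(2 * α)) - r ^ (-(2 * α))) * this +
      α * beta (2 * α) (1 - α) * (r ^ (-α) * r ^ α) * hq
  rw [setLIntegral_congr_fun measurableSet_Ioi e2,
    setLIntegral_Ioi_of_hasDerivAt (m := α * beta (2 * α) (1 - α) / (1 - 2 * α) * 0)
      (F := fun r => α * beta (2 * α) (1 - α) / (1 - 2 * α) *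
        ((r - s) ^ (1 - 2 * α) - r ^ (1 - 2 * α)))]
  · have h3 : (t - s) ^ (1 - 2 * α) ≤ t ^ (1 - 2 * α) :=
      Real.rpow_le_rpow (by linarith) (by linarith) hp.le
    have h4 : 0 ≤ α * beta (2 * α) (1 - α) / (1 - 2 * α) := by positivity
    rw [← ENNReal.ofReal_mul (by positivity), ← ENNReal.ofReal_add]
    · congr 1
      ring
    · nlinarith [mul_nonneg h4 (sub_nonneg.2 h3)]
    · positivity
  · refine (Continuous.continuousWithinAt ?_)
    exact continuous_const.mul (((continuous_id.sub continuous_const).rpow_const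
      fun _ => Or.inr hp.le).sub (continuous_id.rpow_const fun _ => Or.inr hp.le))
  · intro r hr
    have h3 := ((hasDerivAt_id r).sub_const s).rpow_const (p := 1 - 2 * α)
      (Or.inl (sub_pos.2 (hst.trans_lt hr)).ne')
    have h4 := Real.hasDerivAt_rpow_const (p := 1 - 2 * α) (Or.inl (ht.trans hr).ne')
    refine ((h3.sub h4).const_mul _).congr_deriv ?_
    simp only [id]
    rw [show 1 - 2 * α - 1 = -(2 * α) by ring]
    linear_combination ((r - s) ^ (-(2 * α)) - r ^ (-(2 * α))) *
      div_mul_cancel₀ (α * beta (2 * α) (1 - α)) hp.ne'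
  · intro r hr
    exact mul_nonneg (by positivity) (hnn r hr)
  · exact (tendsto_rpow_sub_sub_rpow hp (by linarith) hs.le).const_mul _

end Rough

/-! ### The covariance of the Molchan–Golosov kernel for `H > 1/2` -/

section Smooth

/-- The function `∫_u^t (r-u)^{γ-1} r^γ dr`, `γ = H - 1/2`, to which the Molchan–Golosov kernel
`K_H(t, u)` is proportional up to the factor `u^{-γ}`. -/
noncomputable def smoothKernel (γ t u : ℝ) : ℝ≥0∞ :=
  ∫⁻ r in Ioo u t, ENNReal.ofReal ((r - u) ^ (γ - 1) * r ^ γ)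

/-- The integrand of `smoothKernel`, extended by `0` to the whole line. -/
noncomputable def smoothKernelDensity (γ u r : ℝ) : ℝ≥0∞ :=
  (Ioi u).indicator (fun r => ENNReal.ofReal ((r - u) ^ (γ - 1) * r ^ γ)) r

lemma measurable_smoothKernelDensity (γ : ℝ) :
    Measurable fun p : ℝ × ℝ => smoothKernelDensity γ p.1 p.2 := by
  have h1 : Measurable ({p : ℝ × ℝ | p.1 < p.2}.indicator
      fun p => ENNReal.ofReal ((p.2 - p.1) ^ (γ - 1) * p.2 ^ γ)) :=
    Measurable.indicator (by fun_prop) (measurableSet_lt measurable_fst measurable_snd)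
  convert! h1 using 2 with p

lemma smoothKernel_eq (γ t : ℝ) {u : ℝ} (hu : 0 ≤ u) :
    smoothKernel γ t u = ∫⁻ r in Ioo 0 t, smoothKernelDensity γ u r := by
  unfold smoothKernel smoothKernelDensity
  rw [← lintegral_indicator measurableSet_Ioo, ← lintegral_indicator measurableSet_Ioo]
  refine lintegral_congr fun r => ?_
  rw [indicator_indicator]
  congr 1
  ext r
  simp only [mem_Ioo, mem_inter_iff, mem_Ioi]
  constructor
  · rintro ⟨h1, h2⟩
    exact ⟨⟨hu.trans_lt h1, h2⟩, h1⟩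
  · rintro ⟨⟨h1, h2⟩, h3⟩
    exact ⟨h3, h2⟩

lemma measurable_smoothKernel (γ t : ℝ) : Measurable (smoothKernel γ t) := by
  have hT : MeasurableSet {p : ℝ × ℝ | p.1 < p.2 ∧ p.2 < t} :=
    (measurableSet_lt measurable_fst measurable_snd).inter
      (measurableSet_lt measurable_snd measurable_const)
  have h1 : Measurable ({p : ℝ × ℝ | p.1 < p.2 ∧ p.2 < t}.indicator
      fun p => ENNReal.ofReal ((p.2 - p.1) ^ (γ - 1) * p.2 ^ γ)) :=
    Measurable.indicator (by fun_prop) hT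
  have h2 := h1.lintegral_prod_right' (ν := volume)
  convert! h2 using 2 with u
  rw [smoothKernel, ← lintegral_indicator measurableSet_Ioo]
  refine lintegral_congr fun r => ?_
  by_cases hr : r ∈ Ioo u t
  · rw [indicator_of_mem hr, indicator_of_mem (show (u, r) ∈ {p : ℝ × ℝ | p.1 < p.2 ∧ p.2 < t}
      from ⟨hr.1, hr.2⟩)]
  · rw [indicator_of_notMem hr, indicator_of_notMem fun h => hr ⟨h.1, h.2⟩]

variable {γ : ℝ}

lemma lintegral_smoothKernelDensity_mul_of_lt (h0 : 0 < γ) (h1 : γ < 1 / 2) {s v r : ℝ}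
    (hv : 0 < v) (hvs : v ≤ s) (hvr : v < r) :
    ∫⁻ u in Ioo 0 s, ENNReal.ofReal (u ^ (-(2 * γ))) *
        (smoothKernelDensity γ u r * smoothKernelDensity γ u v) =
      ENNReal.ofReal (beta (1 - 2 * γ) γ * |r - v| ^ (2 * γ - 1)) := by
  have hr : 0 < r := hv.trans hvr
  have hrv : 0 < r - v := sub_pos.2 hvr
  have e1 : ∫⁻ u in Ioo 0 s, ENNReal.ofReal (u ^ (-(2 * γ))) *
        (smoothKernelDensity γ u r * smoothKernelDensity γ u v) =
      ∫⁻ u in Ioo 0 v, ENNReal.ofReal (r ^ γ * v ^ γ) *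
        ENNReal.ofReal (u ^ (1 - 2 * γ - 1) * (v - u) ^ (γ - 1) *
          (r - u) ^ (-(1 - 2 * γ + γ))) := by
    rw [← lintegral_indicator measurableSet_Ioo, ← lintegral_indicator measurableSet_Ioo]
    refine lintegral_congr fun u => ?_
    by_cases hu : u ∈ Ioo 0 v
    · have hu0 : 0 < u := hu.1
      have hvu : 0 < v - u := sub_pos.2 hu.2
      have hru : 0 < r - u := by linarith
      rw [indicator_of_mem hu, indicator_of_mem (show u ∈ Ioo 0 s from ⟨hu.1, hu.2.trans_le hvs⟩),
        smoothKernelDensity, smoothKernelDensity,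
        indicator_of_mem (show r ∈ Ioi u from hu.2.trans hvr),
        indicator_of_mem (show v ∈ Ioi u from hu.2), ← ENNReal.ofReal_mul (by positivity),
        ← ENNReal.ofReal_mul (by positivity), ← ENNReal.ofReal_mul (by positivity),
        show 1 - 2 * γ - 1 = -(2 * γ) by ring, show -(1 - 2 * γ + γ) = γ - 1 by ring]
      congr 1
      ring
    · rw [indicator_of_notMem hu]
      by_cases hus : u ∈ Ioo 0 s
      · rw [indicator_of_mem hus, smoothKernelDensity, smoothKernelDensity,
          indicator_of_notMem (show v ∉ Ioi u from fun h => hu ⟨hus.1, h⟩), mul_zero, mul_zero]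
      · rw [indicator_of_notMem hus]
  rw [e1, lintegral_const_mul' _ _ ENNReal.ofReal_ne_top,
    lintegral_beta_moebius (by linarith) h0 hv hvr, ← ENNReal.ofReal_mul (by positivity)]
  congr 1
  rw [abs_of_pos hrv, show 1 - 2 * γ + γ - 1 = -γ by ring,
    show -(1 - 2 * γ) = 2 * γ - 1 by ring]
  have hr1 : r ^ γ * r ^ (-γ) = 1 := by
    rw [← Real.rpow_add hr]; simp
  have hv1 : v ^ γ * v ^ (-γ) = 1 := by
    rw [← Real.rpow_add hv]; simp
  linear_combination beta (1 - 2 * γ) γ * (r - v) ^ (2 * γ - 1) *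
    (r ^ γ * r ^ (-γ) * hv1 + hr1)

/-- Integrating out `u` turns the product of the two kernels into the kernel `|r - v|^{2H-2}` of the
covariance of fractional Gaussian noise. -/
lemma lintegral_smoothKernelDensity_mul (h0 : 0 < γ) (h1 : γ < 1 / 2) {s v r : ℝ}
    (hv : v ∈ Ioo 0 s) (hr : 0 < r) (hvr : r ≠ v) :
    ∫⁻ u in Ioo 0 s, ENNReal.ofReal (u ^ (-(2 * γ))) *
        (smoothKernelDensity γ u r * smoothKernelDensity γ u v) =
      ENNReal.ofReal (beta (1 - 2 * γ) γ * |r - v| ^ (2 * γ - 1)) := by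
  rcases hvr.lt_or_gt with h | h
  · rw [abs_sub_comm, ← lintegral_smoothKernelDensity_mul_of_lt h0 h1 hr (h.trans hv.2).le h]
    simp_rw [mul_comm (smoothKernelDensity γ _ r)]
  · exact lintegral_smoothKernelDensity_mul_of_lt h0 h1 hv.1 hv.2.le h

lemma lintegral_abs_sub_rpow (h0 : 0 < γ) {v t : ℝ} (hv : 0 < v) (hvt : v < t) :
    ∫⁻ r in Ioo 0 t, ENNReal.ofReal (|r - v| ^ (2 * γ - 1)) =
      ENNReal.ofReal ((v ^ (2 * γ) + (t - v) ^ (2 * γ)) / (2 * γ)) := by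
  have e1 : ∫⁻ r in Ioo 0 v, ENNReal.ofReal (|r - v| ^ (2 * γ - 1)) =
      ENNReal.ofReal (v ^ (2 * γ) / (2 * γ)) := by
    rw [setLIntegral_Ioo_of_hasDerivAt (F := fun r => -((v - r) ^ (2 * γ) / (2 * γ))) hv.le]
    · congr 1
      rw [sub_self, Real.zero_rpow (by positivity), sub_zero]
      ring
    · exact (ContinuousOn.div_const (ContinuousOn.rpow_const (by fun_prop) fun x hx =>
        Or.inr (by positivity)) _).neg
    · intro r hr
      have h3 := ((hasDerivAt_id r).const_sub v).rpow_const (p := 2 * γ)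
        (Or.inl (sub_pos.2 hr.2).ne')
      refine (h3.div_const (2 * γ)).neg.congr_deriv ?_
      rw [abs_sub_comm, abs_of_pos (sub_pos.2 hr.2)]
      simp only [id]
      field_simp
    · intro r hr
      positivity
  have e2 : ∫⁻ r in Ioo v t, ENNReal.ofReal (|r - v| ^ (2 * γ - 1)) =
      ENNReal.ofReal ((t - v) ^ (2 * γ) / (2 * γ)) := by
    rw [setLIntegral_Ioo_of_hasDerivAt (F := fun r => (r - v) ^ (2 * γ) / (2 * γ)) hvt.le]
    · congr 1
      rw [sub_self, Real.zero_rpow (by positivity)]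
      ring
    · exact (ContinuousOn.div_const (ContinuousOn.rpow_const (by fun_prop) fun x hx =>
        Or.inr (by positivity)) _)
    · intro r hr
      have h3 := ((hasDerivAt_id r).sub_const v).rpow_const (p := 2 * γ)
        (Or.inl (sub_pos.2 hr.1).ne')
      refine (h3.div_const (2 * γ)).congr_deriv ?_
      rw [abs_of_pos (sub_pos.2 hr.1)]
      simp only [id]
      field_simp
    · intro r hr
      positivity
  have htv : 0 < t - v := sub_pos.2 hvt
  rw [add_div, ENNReal.ofReal_add (by positivity) (by positivity), ← e1, ← e2,
    restrict_Ioo_eq_restrict_Ioc (a := 0) (b := v), ← lintegral_union measurableSet_Ioo,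
    Ioc_union_Ioo_eq_Ioo hv.le hvt]
  exact disjoint_left.2 fun x hx hx' => hx.2.not_gt hx'.1

lemma lintegral_smoothKernel_mul_smoothKernel (h0 : 0 < γ) (h1 : γ < 1 / 2) {s t : ℝ} (hs : 0 < s)
    (hst : s ≤ t) :
    ∫⁻ u in Ioo 0 s, ENNReal.ofReal (u ^ (-(2 * γ))) * (smoothKernel γ t u * smoothKernel γ s u) =
      ENNReal.ofReal (beta (1 - 2 * γ) γ / (2 * γ * (2 * γ + 1)) *
        (s ^ (2 * γ + 1) + t ^ (2 * γ + 1) - (t - s) ^ (2 * γ + 1))) := by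
  have hB := (beta_pos (α := 1 - 2 * γ) (β := γ) (by linarith) h0).le
  have hm := measurable_smoothKernelDensity γ
  have hmu : ∀ u, Measurable (smoothKernelDensity γ u) := fun u => hm.comp measurable_prodMk_left
  have e1 : ∀ u ∈ Ioo 0 s,
      ENNReal.ofReal (u ^ (-(2 * γ))) * (smoothKernel γ t u * smoothKernel γ s u) =
      ∫⁻ v in Ioo 0 s, ∫⁻ r in Ioo 0 t, ENNReal.ofReal (u ^ (-(2 * γ))) *
        (smoothKernelDensity γ u r * smoothKernelDensity γ u v) := by
    intro u hu
    rw [smoothKernel_eq γ t hu.1.le, smoothKernel_eq γ s hu.1.le,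
      ← lintegral_const_mul _ (hmu u), ← lintegral_const_mul _ ((hmu u).const_mul _)]
    refine lintegral_congr fun v => ?_
    rw [← lintegral_mul_const _ (hmu u), ← lintegral_const_mul _ ((hmu u).mul_const _)]
  have hm3 : Measurable fun p : (ℝ × ℝ) × ℝ => ENNReal.ofReal (p.1.1 ^ (-(2 * γ))) *
      (smoothKernelDensity γ p.1.1 p.2 * smoothKernelDensity γ p.1.1 p.1.2) := by
    have h2 : Measurable fun p : (ℝ × ℝ) × ℝ => smoothKernelDensity γ p.1.1 p.2 :=
      hm.comp ((measurable_fst.comp measurable_fst).prodMk measurable_snd)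
    have h3 : Measurable fun p : (ℝ × ℝ) × ℝ => smoothKernelDensity γ p.1.1 p.1.2 :=
      hm.comp measurable_fst
    fun_prop
  have hm2 : ∀ v, Measurable fun p : ℝ × ℝ => ENNReal.ofReal (p.1 ^ (-(2 * γ))) *
      (smoothKernelDensity γ p.1 p.2 * smoothKernelDensity γ p.1 v) := fun v =>
    hm3.comp ((measurable_fst.prodMk measurable_const).prodMk measurable_snd)
  rw [setLIntegral_congr_fun measurableSet_Ioo e1,
    lintegral_lintegral_swap (hm3.lintegral_prod_right').aemeasurable]
  have e2 : ∀ v ∈ Ioo 0 s, ∫⁻ u in Ioo 0 s, ∫⁻ r in Ioo 0 t, ENNReal.ofReal (u ^ (-(2 * γ))) *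
        (smoothKernelDensity γ u r * smoothKernelDensity γ u v) =
      ENNReal.ofReal (beta (1 - 2 * γ) γ * ((v ^ (2 * γ) + (t - v) ^ (2 * γ)) / (2 * γ))) := by
    intro v hv
    rw [lintegral_lintegral_swap (hm2 v).aemeasurable, ENNReal.ofReal_mul hB,
      ← lintegral_abs_sub_rpow h0 hv.1 (hv.2.trans_le hst),
      ← lintegral_const_mul' _ _ ENNReal.ofReal_ne_top]
    -- The formula fails only on the diagonal `r = v`, a null set.
    have hne : ∀ᵐ r ∂(volume : Measure ℝ), r ≠ v := by
      simp [ae_iff]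
    refine lintegral_congr_ae ?_
    filter_upwards [ae_restrict_of_ae hne, ae_restrict_mem measurableSet_Ioo] with r hr hr'
    rw [lintegral_smoothKernelDensity_mul h0 h1 hv hr'.1 hr, ENNReal.ofReal_mul hB]
  rw [setLIntegral_congr_fun measurableSet_Ioo e2,
    setLIntegral_Ioo_of_hasDerivAt (F := fun v => beta (1 - 2 * γ) γ / (2 * γ * (2 * γ + 1)) *
      (v ^ (2 * γ + 1) - (t - v) ^ (2 * γ + 1))) hs.le]
  · congr 1
    rw [Real.zero_rpow (by positivity), sub_zero]
    ring
  · exact ContinuousOn.mul continuousOn_const (ContinuousOn.sub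
      (ContinuousOn.rpow_const (by fun_prop) fun x hx => Or.inr (by positivity))
      (ContinuousOn.rpow_const (by fun_prop) fun x hx => Or.inr (by positivity)))
  · intro v hv
    have h3 := Real.hasDerivAt_rpow_const (p := 2 * γ + 1) (Or.inl hv.1.ne')
    have h4 := ((hasDerivAt_id v).const_sub t).rpow_const (p := 2 * γ + 1)
      (Or.inl (sub_pos.2 (hv.2.trans_le hst)).ne')
    refine ((h3.sub h4).const_mul _).congr_deriv ?_
    simp only [id]
    rw [show 2 * γ + 1 - 1 = 2 * γ by ring]
    field_simp
    ring
  · intro v hv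
    have := hv.1
    have : 0 < t - v := sub_pos.2 (hv.2.trans_le hst)
    positivity

end Smooth

/-! ### Fractional Brownian motion -/

lemma intervalIntegral_eq_toReal_lintegral {f : ℝ → ℝ} (hf : Measurable f) {a b : ℝ} (hab : a ≤ b)
    (h0 : ∀ x ∈ Ioo a b, 0 ≤ f x) :
    ∫ x in a..b, f x = (∫⁻ x in Ioo a b, ENNReal.ofReal (f x)).toReal := by
  rw [intervalIntegral.integral_of_le hab, integral_Ioc_eq_integral_Ioo,
    integral_eq_lintegral_of_nonneg_ae (ae_restrict_of_forall_mem measurableSet_Ioo h0)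
      hf.aestronglyMeasurable]

/-- The Molchan–Golosov kernels are nonnegative, and `∫_0^s K_H(t, u) K_H(s, u) du` is the
covariance of fractional Brownian motion. The kernel is represented by an `ℝ≥0∞`-valued function,
for which this integral needs no integrability. -/
lemma exists_ennreal_molchanGolosovKernel {H : ℝ} (hH0 : 0 < H) (hH1 : H < 1) :
    ∃ k : ℝ≥0 → ℝ → ℝ≥0∞, (∀ t, Measurable (k t)) ∧
      (∀ t : ℝ≥0, ∀ᵐ u ∂(volume.restrict (Ioo 0 (t : ℝ))),
        k t u ≠ ∞ ∧ molchanGolosovKernel H t u = (k t u).toReal) ∧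
      ∀ s t : ℝ≥0, 0 < s → s ≤ t → ∫⁻ u in Ioo 0 (s : ℝ), k t u * k s u =
        ENNReal.ofReal (((s : ℝ) ^ (2 * H) + (t : ℝ) ^ (2 * H) - ((t : ℝ) - s) ^ (2 * H)) / 2) := by
  rcases lt_trichotomy H (1 / 2) with hH | hH | hH
  · obtain ⟨α, rfl⟩ : ∃ α, H = 1 / 2 - α := ⟨1 / 2 - H, by ring⟩
    have h0 : 0 < α := by linarith
    have h1 : α < 1 / 2 := by linarith
    have hB := beta_pos (α := 2 * α) (β := 1 - α) (by linarith) (by linarith)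
    have hp : 0 < 1 - 2 * α := by linarith
    set c := Real.sqrt ((1 - 2 * α) / (2 * α * beta (2 * α) (1 - α))) with hc
    have hc0 : 0 ≤ c := Real.sqrt_nonneg _
    have hc2 : c * c = (1 - 2 * α) / (2 * α * beta (2 * α) (1 - α)) :=
      Real.mul_self_sqrt (by positivity)
    refine ⟨fun t u => ENNReal.ofReal (c * u ^ α) * roughKernel α t u,
      fun t => (Measurable.ennreal_ofReal (by fun_prop)).mul (measurable_roughKernel α t),
      fun t => ?_, fun s t hs hst => ?_⟩
    · rcases eq_or_ne t 0 with rfl | ht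
      · simp
      have ht0 : 0 < (t : ℝ) := by positivity
      have hfin : ∫⁻ u in Ioo 0 (t : ℝ), roughKernel α t u ≠ ∞ := by
        rw [lintegral_roughKernel h0 h1 ht0]
        exact ENNReal.ofReal_ne_top
      filter_upwards [ae_lt_top (measurable_roughKernel α t) hfin,
        ae_restrict_mem measurableSet_Ioo] with u hu hut
      have hu0 : 0 < u := hut.1
      have htu : 0 < t - u := sub_pos.2 hut.2
      refine ⟨ENNReal.mul_ne_top ENNReal.ofReal_ne_top hu.ne, ?_⟩
      rw [roughKernel] at hu
      have hi := (ENNReal.add_lt_top.1 hu).2.ne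
      rw [ENNReal.toReal_mul, ENNReal.toReal_ofReal (by positivity), roughKernel,
        ENNReal.toReal_add ENNReal.ofReal_ne_top hi, ENNReal.toReal_ofReal (by positivity),
        ← intervalIntegral_eq_toReal_lintegral (by fun_prop) hut.2.le fun r hr => ?_]
      · rw [molchanGolosovKernel, if_pos hH, show 2 * (1 / 2 - α) = 1 - 2 * α by ring,
          show 1 - (1 - 2 * α) = 2 * α by ring, show 1 / 2 - α + 1 / 2 = 1 - α by ring,
          show 1 / 2 - α - 1 / 2 = -α by ring, show 1 / 2 - (1 / 2 - α) = α by ring,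
          show 1 / 2 - α - 3 / 2 = -α - 1 by ring, ← hc]
        have e1 : ((t : ℝ) / u) ^ (-α) = u ^ α * (t : ℝ) ^ (-α) := by
          rw [Real.div_rpow ht0.le hu0.le, Real.rpow_neg hu0.le, div_inv_eq_mul, mul_comm]
        simp_rw [mul_assoc α]
        rw [e1, intervalIntegral.integral_const_mul]
        ring
      · have hr0 : 0 < r := hu0.trans hr.1
        have hru : 0 < r - u := sub_pos.2 hr.1
        positivity
    · have hs0 : 0 < (s : ℝ) := by positivity
      have hst' : (s : ℝ) ≤ t := by exact_mod_cast hst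
      have e : ∀ u ∈ Ioo 0 (s : ℝ), ENNReal.ofReal (c * u ^ α) * roughKernel α t u *
          (ENNReal.ofReal (c * u ^ α) * roughKernel α s u) = ENNReal.ofReal (c * c) *
            (ENNReal.ofReal (u ^ (2 * α)) * (roughKernel α t u * roughKernel α s u)) := by
        intro u hu
        have hu0 : 0 < u := hu.1
        rw [← mul_assoc (ENNReal.ofReal (c * c)), ← ENNReal.ofReal_mul (by positivity),
          mul_mul_mul_comm, ← ENNReal.ofReal_mul (by positivity)]
        congr 2
        rw [two_mul, Real.rpow_add hu0]
        ring
      rw [setLIntegral_congr_fun measurableSet_Ioo e,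
        lintegral_const_mul' _ _ ENNReal.ofReal_ne_top,
        lintegral_roughKernel_mul_roughKernel h0 h1 hs0 hst',
        ← ENNReal.ofReal_mul (by positivity), hc2, show 2 * (1 / 2 - α) = 1 - 2 * α by ring]
      congr 1
      field_simp
      ring
  · refine ⟨fun _ _ => 1, fun _ => measurable_const, fun t => Eventually.of_forall fun u => ?_,
      fun s t hs hst => ?_⟩
    · simp [molchanGolosovKernel, hH]
    · rw [hH, show (2 : ℝ) * (1 / 2) = 1 by ring]
      simp only [Real.rpow_one]
      rw [lintegral_const, mul_one, one_mul, Measure.restrict_apply_univ, Real.volume_Ioo]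
      congr 1
      ring
  · obtain ⟨γ, rfl⟩ : ∃ γ, H = γ + 1 / 2 := ⟨H - 1 / 2, by ring⟩
    have h0 : 0 < γ := by linarith
    have h1 : γ < 1 / 2 := by linarith
    have hB := beta_pos (α := 1 - 2 * γ) (β := γ) (by linarith) h0
    set c := Real.sqrt ((γ + 1 / 2) * (2 * γ) / beta (1 - 2 * γ) γ) with hc
    have hc0 : 0 ≤ c := Real.sqrt_nonneg _
    have hc2 : c * c = (γ + 1 / 2) * (2 * γ) / beta (1 - 2 * γ) γ :=
      Real.mul_self_sqrt (by positivity)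
    refine ⟨fun t u => ENNReal.ofReal (c * u ^ (-γ)) * smoothKernel γ t u,
      fun t => (Measurable.ennreal_ofReal (by fun_prop)).mul (measurable_smoothKernel γ t),
      fun t => ?_, fun s t hs hst => ?_⟩
    · rcases eq_or_ne t 0 with rfl | ht
      · simp
      have ht0 : 0 < (t : ℝ) := by positivity
      have hfin : ∫⁻ u in Ioo 0 (t : ℝ), ENNReal.ofReal (u ^ (-(2 * γ))) *
          (smoothKernel γ t u * smoothKernel γ t u) ≠ ∞ := by
        rw [lintegral_smoothKernel_mul_smoothKernel h0 h1 ht0 le_rfl]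
        exact ENNReal.ofReal_ne_top
      have hmk := measurable_smoothKernel γ t
      filter_upwards [ae_lt_top (by fun_prop) hfin,
        ae_restrict_mem measurableSet_Ioo] with u hu hut
      have hu0 : 0 < u := hut.1
      have hi : smoothKernel γ t u ≠ ∞ := by
        intro h
        rw [h, ENNReal.top_mul_top, ENNReal.mul_top] at hu
        · exact lt_irrefl _ hu
        · exact (ENNReal.ofReal_pos.2 (by positivity)).ne'
      refine ⟨ENNReal.mul_ne_top ENNReal.ofReal_ne_top hi, ?_⟩
      rw [ENNReal.toReal_mul, ENNReal.toReal_ofReal (by positivity), smoothKernel,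
        ← intervalIntegral_eq_toReal_lintegral (by fun_prop) hut.2.le fun r hr => ?_]
      · rw [molchanGolosovKernel, if_neg hH.not_gt, if_pos hH,
          show 2 * (γ + 1 / 2) - 1 = 2 * γ by ring, show 2 - 2 * (γ + 1 / 2) = 1 - 2 * γ by ring,
          show γ + 1 / 2 - 1 / 2 = γ by ring, show 1 / 2 - (γ + 1 / 2) = -γ by ring,
          show γ + 1 / 2 - 3 / 2 = γ - 1 by ring, ← hc]
      · have hr0 : 0 < r := hu0.trans hr.1
        have hru : 0 < r - u := sub_pos.2 hr.1
        positivity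
    · have hs0 : 0 < (s : ℝ) := by positivity
      have hst' : (s : ℝ) ≤ t := by exact_mod_cast hst
      have e : ∀ u ∈ Ioo 0 (s : ℝ), ENNReal.ofReal (c * u ^ (-γ)) * smoothKernel γ t u *
          (ENNReal.ofReal (c * u ^ (-γ)) * smoothKernel γ s u) = ENNReal.ofReal (c * c) *
            (ENNReal.ofReal (u ^ (-(2 * γ))) * (smoothKernel γ t u * smoothKernel γ s u)) := by
        intro u hu
        have hu0 : 0 < u := hu.1
        rw [← mul_assoc (ENNReal.ofReal (c * c)), ← ENNReal.ofReal_mul (by positivity),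
          mul_mul_mul_comm, ← ENNReal.ofReal_mul (by positivity)]
        congr 2
        rw [show -(2 * γ) = -γ + -γ by ring, Real.rpow_add hu0]
        ring
      rw [setLIntegral_congr_fun measurableSet_Ioo e,
        lintegral_const_mul' _ _ ENNReal.ofReal_ne_top,
        lintegral_smoothKernel_mul_smoothKernel h0 h1 hs0 hst',
        ← ENNReal.ofReal_mul (by positivity), hc2, show 2 * (γ + 1 / 2) = 2 * γ + 1 by ring]
      congr 1
      generalize beta (1 - 2 * γ) γ = b at hB
      field_simp

lemma truncatedKernel_ae_eq_indicator_Ioo {h : ℝ≥0 → ℝ → ℝ} {t : ℝ≥0} {g : ℝ → ℝ}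
    (hg : ∀ᵐ u ∂(volume.restrict (Ioo 0 (t : ℝ))), h t u = g u) :
    truncatedKernel h t =ᵐ[timeMeasure] (Ioo 0 (t : ℝ)).indicator g := by
  rw [ae_restrict_iff' measurableSet_Ioo] at hg
  refine ae_restrict_of_ae ?_
  have h0 : ∀ᵐ u ∂(volume : Measure ℝ), u ≠ 0 := by simp [ae_iff]
  have h1 : ∀ᵐ u ∂(volume : Measure ℝ), u ≠ (t : ℝ) := by simp [ae_iff]
  filter_upwards [hg, h0, h1] with u hu h0 h1
  by_cases hut : u ∈ Ioo 0 (t : ℝ)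
  · rw [truncatedKernel, indicator_of_mem hut, indicator_of_mem (Ioo_subset_Icc_self hut), hu hut]
  · rw [truncatedKernel, indicator_of_notMem hut, indicator_of_notMem fun h =>
      hut ⟨lt_of_le_of_ne h.1 h0.symm, lt_of_le_of_ne h.2 h1⟩]

lemma molchanGolosovKernel_memLp_and_integral_mul {H : ℝ} (hH0 : 0 < H) (hH1 : H < 1) :
    (∀ t, MemLp (truncatedKernel (molchanGolosovKernel H) t) 2 timeMeasure) ∧
    ∀ s t : ℝ≥0, s ≤ t → ∫ u, truncatedKernel (molchanGolosovKernel H) s u *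
        truncatedKernel (molchanGolosovKernel H) t u ∂timeMeasure =
      ((s : ℝ) ^ (2 * H) + (t : ℝ) ^ (2 * H) - ((t : ℝ) - s) ^ (2 * H)) / 2 := by
  obtain ⟨k, hkm, hk, hkI⟩ := exists_ennreal_molchanGolosovKernel hH0 hH1
  have hae : ∀ t, truncatedKernel (molchanGolosovKernel H) t =ᵐ[timeMeasure]
      (Ioo 0 (t : ℝ)).indicator fun u => (k t u).toReal := fun t =>
    truncatedKernel_ae_eq_indicator_Ioo ((hk t).mono fun u hu => hu.2)
  have hgm : ∀ t : ℝ≥0, Measurable ((Ioo 0 (t : ℝ)).indicator fun u => (k t u).toReal) := fun t =>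
    (hkm t).ennreal_toReal.indicator measurableSet_Ioo
  have hL : ∀ s t : ℝ≥0, 0 < s → s ≤ t →
      ∫⁻ u, ENNReal.ofReal ((Ioo 0 (s : ℝ)).indicator (fun u => (k s u).toReal) u *
        (Ioo 0 (t : ℝ)).indicator (fun u => (k t u).toReal) u) ∂timeMeasure =
      ENNReal.ofReal (((s : ℝ) ^ (2 * H) + (t : ℝ) ^ (2 * H) - ((t : ℝ) - s) ^ (2 * H)) / 2) := by
    intro s t hs hst
    have hsub : Ioo 0 (s : ℝ) ⊆ Ioo 0 (t : ℝ) := Ioo_subset_Ioo_right (by exact_mod_cast hst)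
    have hks := (ae_restrict_iff' measurableSet_Ioo).1 (hk s)
    have hkt := (ae_restrict_iff' measurableSet_Ioo).1 (hk t)
    rw [← hkI s t hs hst, ← lintegral_indicator measurableSet_Ioo, timeMeasure,
      ← lintegral_indicator measurableSet_Ici]
    refine lintegral_congr_ae ?_
    filter_upwards [hks, hkt] with u hus hut
    by_cases hu : u ∈ Ioo 0 (s : ℝ)
    · rw [indicator_of_mem (show u ∈ Ici 0 from hu.1.le), indicator_of_mem hu,
        indicator_of_mem hu, indicator_of_mem (hsub hu),
        ENNReal.ofReal_mul ENNReal.toReal_nonneg, ENNReal.ofReal_toReal (hus hu).1,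
        ENNReal.ofReal_toReal (hut (hsub hu)).1, mul_comm]
    · rw [indicator_of_notMem hu]
      by_cases hu0 : u ∈ Ici (0 : ℝ)
      · rw [indicator_of_mem hu0, indicator_of_notMem hu, zero_mul, ENNReal.ofReal_zero]
      · rw [indicator_of_notMem hu0]
  have hnn : ∀ (s t : ℝ≥0) (u : ℝ), 0 ≤ (Ioo 0 (s : ℝ)).indicator (fun u => (k s u).toReal) u *
        (Ioo 0 (t : ℝ)).indicator (fun u => (k t u).toReal) u := fun s t u =>
    mul_nonneg (indicator_nonneg (fun _ _ => ENNReal.toReal_nonneg) _)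
      (indicator_nonneg (fun _ _ => ENNReal.toReal_nonneg) _)
  constructor
  · intro t
    refine MemLp.ae_eq (hae t).symm ((memLp_two_iff_integrable_sq
      (hgm t).aestronglyMeasurable).2 ⟨((hgm t).pow_const 2).aestronglyMeasurable, ?_⟩)
    simp_rw [pow_two]
    rw [hasFiniteIntegral_iff_ofReal (Eventually.of_forall (hnn t t))]
    rcases eq_or_ne t 0 with rfl | ht
    · simp
    · rw [hL t t (pos_iff_ne_zero.2 ht) le_rfl]
      exact ENNReal.ofReal_lt_top
  · intro s t hst
    have hcongr : ∫ u, truncatedKernel (molchanGolosovKernel H) s u *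
        truncatedKernel (molchanGolosovKernel H) t u ∂timeMeasure =
        ∫ u, (Ioo 0 (s : ℝ)).indicator (fun u => (k s u).toReal) u *
          (Ioo 0 (t : ℝ)).indicator (fun u => (k t u).toReal) u ∂timeMeasure := by
      refine integral_congr_ae ?_
      filter_upwards [hae s, hae t] with u hs ht
      rw [hs, ht]
    rw [hcongr]
    rcases eq_or_ne s 0 with rfl | hs
    · simp [Real.zero_rpow (show 2 * H ≠ 0 by positivity)]
    · rw [integral_eq_lintegral_of_nonneg_ae (Eventually.of_forall (hnn s t))
        ((hgm s).mul (hgm t)).aestronglyMeasurable, hL s t (pos_iff_ne_zero.2 hs) hst,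
        ENNReal.toReal_ofReal]
      have hst' : (s : ℝ) ≤ t := by exact_mod_cast hst
      have h1 : ((t : ℝ) - s) ^ (2 * H) ≤ (t : ℝ) ^ (2 * H) :=
        Real.rpow_le_rpow (sub_nonneg.2 hst') (by linarith [s.coe_nonneg]) (by positivity)
      have h2 : 0 ≤ (s : ℝ) ^ (2 * H) := by positivity
      linarith

lemma memLp_truncatedKernel_molchanGolosovKernel {H : ℝ} (hH0 : 0 < H) (hH1 : H < 1) (t : ℝ≥0) :
    MemLp (truncatedKernel (molchanGolosovKernel H) t) 2 timeMeasure :=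
  (molchanGolosovKernel_memLp_and_integral_mul hH0 hH1).1 t

lemma isFractionalBrownianMotion_gaussianPart {Ω : Type*} [MeasurableSpace Ω] {P : Measure Ω}
    {W : Lp ℝ 2 timeMeasure → Ω → ℝ} (hW : IsIsonormal W P) {H : ℝ} (hH0 : 0 < H) (hH1 : H < 1) :
    IsFractionalBrownianMotion H (gaussianPart W (molchanGolosovKernel H)) P where
  gaussian := hW.gaussian.comp_right _
  mean_zero t := hW.mean_zero _
  cov s t := by
    have hL := memLp_truncatedKernel_molchanGolosovKernel hH0 hH1
    have e : ∫ ω, gaussianPart W (molchanGolosovKernel H) s ω *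
        gaussianPart W (molchanGolosovKernel H) t ω ∂P =
        ∫ u, truncatedKernel (molchanGolosovKernel H) s u *
          truncatedKernel (molchanGolosovKernel H) t u ∂timeMeasure :=
      (hW.cov _ _).trans (integral_toL2_mul_toL2 (hL s) (hL t))
    rw [e]
    rcases le_total s t with hst | hst
    · rw [(molchanGolosovKernel_memLp_and_integral_mul hH0 hH1).2 s t hst,
        abs_of_nonneg (sub_nonneg.2 (by exact_mod_cast hst))]
    · simp_rw [mul_comm (truncatedKernel (molchanGolosovKernel H) s _)]
      rw [(molchanGolosovKernel_memLp_and_integral_mul hH0 hH1).2 t s hst, abs_sub_comm,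
        abs_of_nonneg (sub_nonneg.2 (by exact_mod_cast hst))]
      ring

theorem theorem4p2
    {Ω Ω' : Type*} [MeasurableSpace Ω] [MeasurableSpace Ω']
    (P : Measure Ω) [IsProbabilityMeasure P] (P' : Measure Ω') [IsProbabilityMeasure P']
    (ν : Measure ℝ) (hν : IsSquareIntegrableLevyMeasure ν)
    (N : Ω → Measure (ℝ × ℝ)) (hN : IsPoissonRandomMeasure N (jumpIntensity ν) P)
    (W : Lp ℝ 2 timeMeasure → Ω' → ℝ) (hW : IsIsonormal W P')
    (hσ : Tendsto (fun ε : ℝ => smallJumpStd ν ε / ε) (𝓝[>] 0) atTop) :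
    -- convergence of the normalized small jumps
    (∀ (T : ℝ≥0) (h : ℝ≥0 → ℝ → ℝ),
      (∀ t ≤ T, MemLp (h t) 3 (volume.restrict (Ioo 0 (T : ℝ)))) →
      TendstoFDD (smallJumpPart N ν P h) (𝓝[>] 0) (gaussianPart W h) (Iic T) P P') ∧
    -- fractional Lévy processes of Molchan–Golosov type
    (∀ H : ℝ, 0 < H → H < 1 →
      -- the small jumps converge to a fractional Brownian motion
      TendstoFDD (smallJumpPart N ν P (molchanGolosovKernel H)) (𝓝[>] 0)
        (gaussianPart W (molchanGolosovKernel H)) univ P P' ∧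
      IsFractionalBrownianMotion H (gaussianPart W (molchanGolosovKernel H)) P' ∧
      (∀ ε : ℝ, 0 < ε →
        -- decomposition into large and small jumps
        (∀ t : ℝ≥0, ∀ᵐ ω ∂P, chaosProcess N ν P (molchanGolosovKernel H) t ω =
          largeJumpPart N ν P (molchanGolosovKernel H) ε t ω +
            smallJumpStd ν ε * smallJumpPart N ν P (molchanGolosovKernel H) ε t ω) ∧
        -- the large jumps are finite in number, and their part is the compensated sum over them
        (∀ t : ℝ≥0, ∀ᵐ ω ∂P, N ω (Icc 0 (t : ℝ) ×ˢ {x : ℝ | ε < |x|}) < ∞ ∧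
          largeJumpPart N ν P (molchanGolosovKernel H) ε t ω =
            (∫ z in Icc 0 (t : ℝ) ×ˢ {x : ℝ | ε < |x|},
              molchanGolosovKernel H t z.1 * z.2 ∂(N ω)) -
            ∫ z in Icc 0 (t : ℝ) ×ˢ {x : ℝ | ε < |x|},
              molchanGolosovKernel H t z.1 * z.2 ∂(jumpIntensity ν)) ∧
        -- the two parts are independent
        (∀ (d : ℕ) (t : Fin d → ℝ≥0),
          IndepFun (fun ω i => largeJumpPart N ν P (molchanGolosovKernel H) ε (t i) ω)
            (fun ω i => smallJumpPart N ν P (molchanGolosovKernel H) ε (t i) ω) P)) ∧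
      -- large jumps plus an independent scaled fractional Brownian motion
      TendstoFDD
        (fun (ε : ℝ) (t : ℝ≥0) (ω : Ω × Ω') =>
          largeJumpPart N ν P (molchanGolosovKernel H) ε t ω.1 +
            smallJumpStd ν ε * gaussianPart W (molchanGolosovKernel H) t ω.2)
        (𝓝[>] 0) (chaosProcess N ν P (molchanGolosovKernel H)) univ (P.prod P') P) := by
  refine ⟨fun T h hh => tendstoFDD_smallJumpPart hν hN hW hσ fun t ht =>
    memLp_truncatedKernel_of_memLp_three ht (hh t ht), fun H hH0 hH1 => ?_⟩
  have hk := memLp_truncatedKernel_molchanGolosovKernel hH0 hH1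
  exact ⟨tendstoFDD_smallJumpPart hν hN hW hσ fun t _ => hk t,
    isFractionalBrownianMotion_gaussianPart hW hH0 hH1,
    fun ε hε => ⟨fun t => chaosProcess_ae_eq_add hν hN hσ (hk t) hε,
      fun t => largeJumpPart_ae_eq hν hN (hk t) hε,
      fun d t => indepFun_largeJumpPart_smallJumpPart hν hN (fun j => hk (t j)) ε⟩,
    tendstoFDD_largeJumpPart_add hν hN hW fun t _ => hk t⟩
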